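/- Let $S$ be a locally compact Hausdorff topological semigroup (jointly continuous multiplication) with identity. Let $M(S)$ be the Banach algebra of bounded regular complex Borel measures on $S$ with total variation norm and convolution, $M_0(S)\subset M(S)$ the set of probability measures, and $1$ the functional $\langle 1,\mu\rangle=\mu(S)$. Let $M_a(S)$ be the space of all $\mu\in M(S)$ for which both $s\mapsto|\mu|*\delta_s$ and $s\mapsto\delta_s*|\mu|$ are continuous from $S$ into $M(S)$ with its weak topology; it is a left ideal of $M(S)$. For $f\in M_a(S)^*$, $\mu\in M(S)$ and $s\in S$ define $f\mu, fs\in M_a(S)^*$ by $\langle f\mu,\nu\rangle=\langle f,\mu*\nu\rangle$ and $\langle fs,\nu\rangle=\langle f,\delta_s*\nu\rangle$ for $\nu\in M_a(S)$. Let $\mathrm{wap}(M_a(S))$ be the space of all $f\in M_a(S)^*$ such that $\{f\mu:\mu\in M_a(S),\ \|\mu\|\le1\}$ is relatively weakly compact in $M_a(S)^*$. Assume that: (a) $S$ is a foundation semigroup, i.e. $\bigcup\{\operatorname{supp}\mu:\mu\in M_a(S)\}$ is dense in $S$; (b) $M(S)^*$ has a topologically right invariant mean, i.e. there is $m\in M(S)^{**}$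 with $\langle m,f\rangle\ge0$ whenever $f\ge0$, $\langle m,1\rangle=1$, and $\langle m,\mu f\rangle=\langle m,f\rangle$ for all $\mu\in M_0(S)$, $f\in M(S)^*$, where $\langle\mu f,\nu\rangle=\langle f,\nu*\mu\rangle$; (c) $(\mu_\alpha)$ is an asymptotically $M_0(S)$-invariant net in $M_0(S)$, i.e. $\|\mu*\mu_\alpha-\mu_\alpha\|\to0$ for every $\mu\in M_0(S)$. For $f\in\mathrm{wap}(M_a(S))$ the map $s\mapsto fs$ is Bochner integrable with respect to every measure in $M_0(S)$; put $E_\alpha[f]=\int_S fs\,d\mu_\alpha(s)$. Then: (1) For every $f\in\mathrm{wap}(M_a(S))$, $E_\alpha[f]$ converges in norm to an element $f'\in\mathrm{wap}(M_a(S))$ with $f's=f'$ for all $s\in S$, and $f'$ does not depend on the choice of the asymptotically $M_0(S)$-invariant net $(\mu_\alpha)$. (2) There is exactly one topologically left invariant mean $M$ on $\mathrm{wap}(M_a(S))$, i.e. one continuous linear functional $M$ on $\mathrm{wap}(M_a(S))$ with $\langle M,f\rangle\ge0$ whenever $f\ge0$, $\langle M,1\rangle=1$ and $\langle M,f\mu\rangle=\langle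 M,f\rangle$ for all $\mu\in M_0(S)$, $f\in\mathrm{wap}(M_a(S))$. With $Y=\{f\in\mathrm{wap}(M_a(S)): fs=f\text{ for all }s\in S\}$ and $Z$ the closed linear span of $\{f-fs: f\in\mathrm{wap}(M_a(S)),\ s\in S\}$ one has $$Y=\mathbb{C}1,\qquad Z=\{f\in\mathrm{wap}(M_a(S)):\langle M,f\rangle=0\}.$$ -/

import Mathlib

open MeasureTheory Set Filter Topology
open scoped ENNReal NNReal

set_option linter.unusedSectionVars false

noncomputable section
namespace SemigroupMeasure

section Regularity
variable {S : Type*} [TopologicalSpace S] [MeasurableSpace S] [BorelSpace S] [T2Space S]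

lemma regular_of_le {m n : Measure S} [IsFiniteMeasure n] [n.Regular] (h : m ≤ n) :
    m.Regular := by
  have : IsFiniteMeasure m := isFiniteMeasure_of_le n h
  have : m.InnerRegular := by
    refine ⟨fun A hA r hr => ?_⟩
    have hpos : m A - r ≠ 0 := (tsub_pos_of_lt hr).ne'
    obtain ⟨K, hKA, hK, hlt⟩ := hA.exists_isCompact_sdiff_lt (measure_ne_top n A) hpos
    refine ⟨K, hKA, hK, ?_⟩
    have h1 : m (A \ K) < m A - r := lt_of_le_of_lt (h _) hlt
    have h2 : m A ≤ m K + m (A \ K) := by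
      rw [← measure_inter_add_sdiff A hK.measurableSet, inter_eq_right.2 hKA]
    by_contra hcon
    push Not at hcon
    have h3 : m A < r + (m A - r) := lt_of_le_of_lt h2
      (lt_of_le_of_lt (add_le_add_left hcon _) (ENNReal.add_lt_add_left (ne_top_of_lt hr) h1))
    rw [add_tsub_cancel_of_le hr.le] at h3
    exact lt_irrefl _ h3
  infer_instance

lemma regular_add {m n : Measure S} [IsFiniteMeasure m] [IsFiniteMeasure n] [m.Regular]
    [n.Regular] : (m + n).Regular := by
  have : m.InnerRegular := inferInstance
  have : n.InnerRegular := inferInstance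
  infer_instance
end Regularity

variable (S : Type*) [TopologicalSpace S] [MeasurableSpace S] [BorelSpace S] [T2Space S]

/-- The space of complex Borel measures on `S` whose total variation is
finite and regular. -/
def regularComplexMeasures : Submodule ℂ (ComplexMeasure S) where
  carrier := {μ | IsFiniteMeasure μ.variation ∧ μ.variation.Regular}
  add_mem' := by
    rintro μ ν ⟨h1, h2⟩ ⟨h3, h4⟩
    have := regular_add (m := μ.variation) (n := ν.variation)
    exact ⟨isFiniteMeasure_of_le _ VectorMeasure.variation_add_le,
      regular_of_le VectorMeasure.variation_add_le⟩
  zero_mem' := by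
    simp only [mem_ofPred_eq, VectorMeasure.variation_zero]
    exact ⟨inferInstance, inferInstance⟩
  smul_mem' := by
    rintro c μ ⟨h1, h2⟩
    simp only [mem_ofPred_eq, VectorMeasure.variation_smul]
    exact ⟨inferInstance, inferInstance⟩

/-- `M(S)`. -/
abbrev M := ↥(regularComplexMeasures S)

variable {S}

instance (μ : M S) : IsFiniteMeasure μ.1.variation := μ.2.1
instance (μ : M S) : μ.1.variation.Regular := μ.2.2

instance : Norm (M S) := ⟨fun μ => μ.1.variation.real univ⟩

lemma norm_def (μ : M S) : ‖μ‖ = μ.1.variation.real univ := rfl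

lemma normCore : NormedSpace.Core ℂ (M S) where
  norm_nonneg μ := measureReal_nonneg
  norm_smul c μ := by
    simp only [norm_def, Submodule.coe_smul, VectorMeasure.variation_smul]
    simp [Measure.real]
  norm_triangle μ ν := by
    simp only [norm_def, Submodule.coe_add]
    rw [← measureReal_add_apply]
    exact ENNReal.toReal_mono (by finiteness) (VectorMeasure.variation_add_le _)
  norm_eq_zero_iff μ := by
    simp only [norm_def]
    rw [measureReal_eq_zero_iff, Measure.measure_univ_eq_zero, VectorMeasure.variation_eq_zero]
    simp

instance : NormedAddCommGroup (M S) := NormedAddCommGroup.ofCore normCore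
instance : NormedSpace ℂ (M S) := NormedSpace.ofCore normCore
instance : AddCommGroup (M S) := NormedAddCommGroup.toAddCommGroup
instance : AddCommMonoid (M S) := AddCommGroup.toAddCommMonoid
instance : Module ℂ (M S) := NormedSpace.toModule


/-- The integral of a complex function against a complex measure. -/
def cint (ν : ComplexMeasure S) (f : S → ℂ) : ℂ := ν.integral f (ContinuousLinearMap.mul ℝ ℂ)

lemma enorm_cint_le (ν : ComplexMeasure S) (f : S → ℂ) :
    ‖cint ν f‖ₑ ≤ ∫⁻ y, ‖f y‖ₑ ∂ν.variation := by
  refine (VectorMeasure.enorm_integral_le_lintegral_enorm (f := f)).trans ?_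
  conv_rhs => rw [← one_mul (lintegral _ _)]
  gcongr
  rw [← ofReal_norm]
  simp

lemma cint_const_smul (ν : ComplexMeasure S) (c : ℂ) (f : S → ℂ) :
    cint ν (fun y => c * f y) = c * cint ν f := by
  have := setToFun_smul (𝕜 := ℂ) (dominatedFinMeasAdditive_cbmApplyMeasure ν
    (ContinuousLinearMap.mul ℝ ℂ)) (by
      intro c s x
      simp [transpose_eq_cbmApplyMeasure, mul_assoc]) c f
  exact this

lemma cint_add (ν : ComplexMeasure S) {f g : S → ℂ} (hf : Integrable f ν.variation)
    (hg : Integrable g ν.variation) : cint ν (fun y => f y + g y) = cint ν f + cint ν g :=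
  VectorMeasure.integral_fun_add hf hg

lemma cint_measure_add (μ ν : ComplexMeasure S) {f : S → ℂ} (hf : Integrable f μ.variation)
    (hg : Integrable f ν.variation) : cint (μ + ν) f = cint μ f + cint ν f :=
  VectorMeasure.integral_add_vectorMeasure hf hg

lemma cint_measure_smul (c : ℂ) (ν : ComplexMeasure S) [IsFiniteMeasure ν.variation]
    {f : S → ℂ} (hf : Integrable f ν.variation) : cint (c • ν) f = c * cint ν f := by
  have hT := dominatedFinMeasAdditive_cbmApplyMeasure ν (ContinuousLinearMap.mul ℝ ℂ)
  have hdom : DominatedFinMeasAdditive ν.variation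
      ((c • ν).transpose (ContinuousLinearMap.mul ℝ ℂ)) (‖c‖ * 1) := by
    refine ⟨fun s t hs ht _ _ hst => VectorMeasure.of_union hst hs ht, fun s hs hfin => ?_⟩
    refine ContinuousLinearMap.opNorm_le_bound _ (by positivity) fun x => ?_
    have h1 : ‖ν s‖ ≤ ν.variation.real s := VectorMeasure.norm_measure_le_variation
    have h2 : (c • ν).transpose (ContinuousLinearMap.mul ℝ ℂ) s x = x * (c * ν s) := rfl
    rw [h2, norm_mul, norm_mul, mul_one, mul_comm]
    gcongr
  have h1 : cint (c • ν) f = setToFun ν.variation _ hdom f := by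
    refine (setToFun_congr_measure_of_integrable (‖c‖ₑ) (by finiteness) ?_ hdom _ f hf).symm
    rw [VectorMeasure.variation_smul]
    exact le_of_eq rfl
  have h2 : cint ν f = setToFun ν.variation _ hT f := rfl
  rw [h1, h2]
  refine Integrable.induction
    (P := fun f => setToFun ν.variation _ hdom f = c * setToFun ν.variation _ hT f)
    ?_ ?_ ?_ ?_ hf
  · intro x s hs hsf
    rw [setToFun_indicator_const _ hs hsf.ne, setToFun_indicator_const _ hs hsf.ne]
    change x * (c * ν s) = c * (x * ν s)
    ring
  · intro f g _ hf hg ihf ihg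
    rw [setToFun_add _ hf hg, setToFun_add _ hf hg, ihf, ihg, mul_add]
  · exact isClosed_eq (continuous_setToFun _) ((continuous_setToFun _).const_mul c)
  · intro f g hfg _ ih
    rw [← setToFun_congr_ae _ hfg, ← setToFun_congr_ae _ hfg, ih]

section Conv
variable [LocallyCompactSpace S] [Mul S] [ContinuousMul S]

lemma measurable_mulR (y : S) : Measurable fun x : S => x * y :=
  Continuous.measurable (by fun_prop)

lemma measurable_mulL (y : S) : Measurable fun x : S => y * x :=
  Continuous.measurable (by fun_prop)

lemma lowerSemicontinuous_section (m : Measure S) [m.Regular] {g : S → S → S}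
    (hg : Continuous (Function.uncurry g)) {U : Set S} (hU : IsOpen U) :
    LowerSemicontinuous fun y => m (g y ⁻¹' U) := by
  intro y c hc
  have hV : IsOpen (g y ⁻¹' U) :=
    hU.preimage (hg.comp (by fun_prop : Continuous fun x : S => (y, x)))
  obtain ⟨K, hKV, hK, hcK⟩ := hV.exists_lt_isCompact hc
  have : ∀ᶠ z in 𝓝 y, ∀ x ∈ K, g z x ∈ U := by
    refine hK.eventually_forall_of_forall_eventually fun x hx => ?_
    exact (hg.tendsto (y, x)).eventually (hU.mem_nhds (hKV hx) : ∀ᶠ w in 𝓝 (g y x), w ∈ U)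
  filter_upwards [this] with z hz
  exact lt_of_lt_of_le hcK (measure_mono hz)

lemma measurable_section' (m : Measure S) [IsFiniteMeasure m] [m.Regular] {g : S → S → S}
    (hg : Continuous (Function.uncurry g)) {E : Set S}
    (hE : MeasurableSet E) : Measurable fun y => m (g y ⁻¹' E) := by
  have hmeas : ∀ y : S, Measurable (g y) := fun y =>
    (hg.comp (by fun_prop : Continuous fun x : S => (y, x))).measurable
  have hgen : ‹MeasurableSpace S› = MeasurableSpace.generateFrom {U : Set S | IsOpen U} :=
    BorelSpace.measurable_eq
  induction E, hE using MeasurableSpace.induction_on_inter hgen isPiSystem_isOpen with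
  | empty => simp
  | basic U hU => exact (lowerSemicontinuous_section m hg hU).measurable
  | compl E hE ih =>
    have : (fun y => m (g y ⁻¹' Eᶜ)) = fun y => m univ - m (g y ⁻¹' E) := by
      ext y
      rw [preimage_compl, measure_compl (hmeas y hE) (measure_ne_top _ _)]
    rw [this]
    exact measurable_const.sub ih
  | iUnion f hd hf ih =>
    have : (fun y => m (g y ⁻¹' ⋃ i, f i)) = fun y => ∑' i, m (g y ⁻¹' f i) := by
      ext y
      rw [preimage_iUnion, measure_iUnion (fun i j hij => (hd hij).preimage _)
        (fun i => hmeas y (hf i))]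
    rw [this]
    exact Measurable.tsum ih

lemma measurable_section (m : Measure S) [IsFiniteMeasure m] [m.Regular] {E : Set S}
    (hE : MeasurableSet E) : Measurable fun y => m ((· * y) ⁻¹' E) :=
  measurable_section' m (g := fun y x => x * y)
    (by fun_prop : Continuous fun p : S × S => p.2 * p.1) hE

lemma measurable_section_left (m : Measure S) [IsFiniteMeasure m] [m.Regular] {E : Set S}
    (hE : MeasurableSet E) : Measurable fun y => m ((y * ·) ⁻¹' E) :=
  measurable_section' m (g := fun y x => y * x)
    (by fun_prop : Continuous fun p : S × S => p.1 * p.2) hE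

/-- Convolution of positive finite regular measures, `E ↦ ∫ m (E y⁻¹) dn(y)`. -/
def posConv (m n : Measure S) : Measure S := n.bind fun y => m.map (· * y)

lemma posConv_apply (m n : Measure S) [IsFiniteMeasure m] [m.Regular] {E : Set S}
    (hE : MeasurableSet E) : posConv m n E = ∫⁻ y, m ((· * y) ⁻¹' E) ∂n := by
  have hm : Measurable fun y : S => m.map (· * y) := by
    refine Measure.measurable_of_measurable_coe _ fun A hA => ?_
    simp_rw [Measure.map_apply (measurable_mulR _) hA]
    exact measurable_section m hA
  rw [posConv, Measure.bind_apply hE hm.aemeasurable]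
  simp_rw [Measure.map_apply (measurable_mulR _) hE]

lemma posConv_univ (m n : Measure S) [IsFiniteMeasure m] [m.Regular] :
    posConv m n univ = m univ * n univ := by
  simp [posConv_apply m n MeasurableSet.univ]

instance (m n : Measure S) [IsFiniteMeasure m] [m.Regular] [IsFiniteMeasure n] :
    IsFiniteMeasure (posConv m n) :=
  ⟨by rw [posConv_univ]; finiteness⟩

/-- Approximation from inside of the section integral of a set `W` by a directed family. -/
lemma exists_lt_lintegral_section {X Y : Type*} [MeasurableSpace X] [TopologicalSpace Y]
    [MeasurableSpace Y] [BorelSpace Y] [T2Space Y] (m : Measure X) [IsFiniteMeasure m]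
    (n : Measure Y) [IsFiniteMeasure n] [n.Regular] (W : Set (X × Y)) (V : Set (Set (X × Y)))
    (hV0 : ∅ ∈ V) (hVu : ∀ A ∈ V, ∀ B ∈ V, A ∪ B ∈ V)
    (hVm : ∀ A ∈ V, Measurable fun y => m ((·, y) ⁻¹' A))
    (hloc : ∀ (y : Y) (ε : ℝ≥0), 0 < ε → ∃ t ∈ 𝓝 y, ∃ A ∈ V, A ⊆ W ∧
      ∀ z ∈ t, m ((·, y) ⁻¹' W) ≤ m ((·, z) ⁻¹' A) + ε)
    {c : ℝ≥0∞} (hc : c < ∫⁻ y, m ((·, y) ⁻¹' W) ∂n) :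
    ∃ A ∈ V, A ⊆ W ∧ c < ∫⁻ y, m ((·, y) ⁻¹' A) ∂n := by
  set g : Y → ℝ≥0 := fun y => (m ((·, y) ⁻¹' W)).toNNReal with hg
  have hgc : ∀ y, (g y : ℝ≥0∞) = m ((·, y) ⁻¹' W) := fun y =>
    ENNReal.coe_toNNReal (measure_ne_top _ _)
  have hfin : ∫⁻ y, g y ∂n ≠ ∞ := by
    refine ne_top_of_le_ne_top (b := m univ * n univ) (by finiteness) ?_
    calc ∫⁻ y, g y ∂n ≤ ∫⁻ _, m univ ∂n :=
          lintegral_mono fun y => by rw [hgc]; exact measure_mono (subset_univ _)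
      _ = _ := by simp
  simp_rw [← hgc] at hc
  obtain ⟨d, hcd, hd⟩ := exists_between hc
  obtain ⟨u, hug, hu, hint⟩ := exists_upperSemicontinuous_le_lintegral_le g hfin
    (ε := (∫⁻ y, g y ∂n) - d) (tsub_pos_of_lt hd).ne'
  have hdu : d ≤ ∫⁻ y, u y ∂n := by
    have h1 : d + ((∫⁻ y, g y ∂n) - d) = ∫⁻ y, g y ∂n := add_tsub_cancel_of_le hd.le
    have h2 : d + ((∫⁻ y, g y ∂n) - d) ≤ (∫⁻ y, u y ∂n) + ((∫⁻ y, g y ∂n) - d) := by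
      rw [h1]; exact hint
    exact (ENNReal.add_le_add_iff_right (by finiteness)).1 h2
  obtain ⟨ε, hε, hεlt⟩ : ∃ ε : ℝ≥0, 0 < ε ∧
      c + (2 * ε * n univ + m univ * ε) < d := by
    have hcont : Tendsto (fun ε : ℝ≥0 => c + (2 * (ε : ℝ≥0∞) * n univ + m univ * ε)) (𝓝[>] 0)
        (𝓝 (c + (2 * ((0 : ℝ≥0) : ℝ≥0∞) * n univ + m univ * ((0 : ℝ≥0) : ℝ≥0∞)))) := by
      apply Tendsto.mono_left _ nhdsWithin_le_nhds
      have h0 : Tendsto (fun ε : ℝ≥0 => (ε : ℝ≥0∞)) (𝓝 0) (𝓝 ((0 : ℝ≥0) : ℝ≥0∞)) :=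
        ENNReal.continuous_coe.tendsto 0
      refine tendsto_const_nhds.add (Tendsto.add ?_ ?_)
      · exact ENNReal.Tendsto.mul_const (ENNReal.Tendsto.const_mul h0 (by simp)) (by simp)
      · exact ENNReal.Tendsto.const_mul h0 (by simp)
    have := hcont.eventually_lt_const (u := d) (by simpa using hcd)
    obtain ⟨ε, h1, h2⟩ := (this.and self_mem_nhdsWithin).exists
    exact ⟨ε, h2, h1⟩
  obtain ⟨K, -, hK, hKlt⟩ := (MeasurableSet.univ (α := Y)).exists_isCompact_sdiff_lt
    (measure_ne_top n univ) (ENNReal.coe_pos.2 hε).ne'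
  obtain ⟨A, hA, hAW, hAu⟩ : ∃ A ∈ V, A ⊆ W ∧
      ∀ z ∈ K, (u z : ℝ≥0∞) ≤ m ((·, z) ⁻¹' A) + 2 * ε := by
    refine hK.induction_on (p := fun t => ∃ A ∈ V, A ⊆ W ∧
      ∀ z ∈ t, (u z : ℝ≥0∞) ≤ m ((·, z) ⁻¹' A) + 2 * ε) ?_ ?_ ?_ ?_
    · exact ⟨∅, hV0, empty_subset _, by simp⟩
    · rintro s t hst ⟨A, h1, h2, h3⟩
      exact ⟨A, h1, h2, fun z hz => h3 z (hst hz)⟩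
    · rintro s t ⟨A, h1, h2, h3⟩ ⟨A', h1', h2', h3'⟩
      refine ⟨A ∪ A', hVu _ h1 _ h1', union_subset h2 h2', ?_⟩
      rintro z (hz | hz)
      · refine (h3 z hz).trans ?_
        gcongr
        exact subset_union_left
      · refine (h3' z hz).trans ?_
        gcongr
        exact subset_union_right
    · intro y _
      obtain ⟨t, ht, A, hA, hAW, hAm⟩ := hloc y ε hε
      have h2 : ∀ᶠ z in 𝓝 y, u z < u y + ε := hu y _ (lt_add_of_pos_right _ hε)
      refine ⟨t ∩ {z | u z < u y + ε}, mem_nhdsWithin_of_mem_nhds (inter_mem ht h2),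
        A, hA, hAW, ?_⟩
      rintro z ⟨hz1, hz2⟩
      have hz2' : u z < u y + ε := hz2
      calc (u z : ℝ≥0∞) ≤ u y + ε := by exact_mod_cast hz2'.le
        _ ≤ m ((·, y) ⁻¹' W) + ε := by rw [← hgc]; gcongr; exact_mod_cast hug y
        _ ≤ m ((·, z) ⁻¹' A) + ε + ε := by gcongr; exact hAm z hz1
        _ = _ := by rw [add_assoc, two_mul]
  refine ⟨A, hA, hAW, ?_⟩
  have hum : ∀ y, (u y : ℝ≥0∞) ≤ m univ := fun y =>
    le_trans (by exact_mod_cast hug y) ((hgc y).le.trans (measure_mono (subset_univ _)))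
  have key : d ≤ (∫⁻ y, m ((·, y) ⁻¹' A) ∂n) + (2 * ε * n univ + m univ * ε) := by
    calc d ≤ ∫⁻ y, u y ∂n := hdu
      _ ≤ ∫⁻ y, (m ((·, y) ⁻¹' A) + (2 * ε + Kᶜ.indicator (fun _ => m univ) y)) ∂n := by
        refine lintegral_mono fun y => ?_
        by_cases hy : y ∈ K
        · simpa [hy] using hAu y hy
        · have : y ∈ Kᶜ := hy
          simp only [this, indicator_of_mem]
          exact (hum y).trans (le_add_left le_add_self)
      _ = (∫⁻ y, m ((·, y) ⁻¹' A) ∂n) + (2 * ε * n univ + m univ * n Kᶜ) := by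
        rw [lintegral_add_left (hVm A hA),
          lintegral_add_left measurable_const, lintegral_const,
          lintegral_indicator_const hK.measurableSet.compl]
      _ ≤ _ := by
        gcongr
        rw [compl_eq_univ_sdiff]
        exact hKlt.le
  have h4 := hεlt.trans_le key
  exact (ENNReal.add_lt_add_iff_right (by finiteness)).1 h4

/-- One half of Fubini's theorem for an open set, which need not be measurable for the product of
the Borel `σ`-algebras. -/
lemma lintegral_section_le {X Y : Type*} [TopologicalSpace X] [MeasurableSpace X] [BorelSpace X]
    [T2Space X] [TopologicalSpace Y] [MeasurableSpace Y] [BorelSpace Y] [T2Space Y]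
    (m : Measure X) [IsFiniteMeasure m] [m.Regular] (n : Measure Y) [IsFiniteMeasure n]
    [n.Regular] {W : Set (X × Y)} (hW : IsOpen W) :
    ∫⁻ y, m ((·, y) ⁻¹' W) ∂n ≤ ∫⁻ x, n ((x, ·) ⁻¹' W) ∂m := by
  refine le_of_forall_lt fun c hc => ?_
  obtain ⟨A, hA', hAW, hlt⟩ := exists_lt_lintegral_section m n W {A | MeasurableSet A}
    (by simp) (fun A hA B hB => by
      simp only [mem_ofPred_eq] at *
      exact hA.union hB)
    (fun A hA => measurable_measure_prodMk_right (by simpa using hA)) (fun y ε hε => by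
      have hV : IsOpen ((·, y) ⁻¹' W) := hW.preimage (by fun_prop)
      obtain ⟨K, hKV, hK, hKlt⟩ := hV.measurableSet.exists_isCompact_lt_add
        (measure_ne_top m _) (ENNReal.coe_pos.2 hε).ne'
      obtain ⟨u, v, hu, hv, hKu, hyv, huv⟩ := generalized_tube_lemma hK
        (isCompact_singleton (x := y)) hW (by
          rintro ⟨a, b⟩ ⟨ha, hb⟩
          obtain rfl : b = y := hb
          exact hKV ha)
      refine ⟨v, hv.mem_nhds (hyv rfl), u ×ˢ v, hu.measurableSet.prod hv.measurableSet, huv,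
        fun z hz => hKlt.le.trans ?_⟩
      gcongr
      exact fun x hx => ⟨hKu hx, hz⟩) hc
  have hA : MeasurableSet A := by simpa using hA'
  refine hlt.trans_le ?_
  rw [← Measure.prod_apply_symm hA, Measure.prod_apply hA]
  exact lintegral_mono fun x => measure_mono fun y hy => hAW hy

lemma posConv_innerRegular (m n : Measure S) [IsFiniteMeasure m] [m.Regular] [IsFiniteMeasure n]
    [n.Regular] : (posConv m n).InnerRegularWRT IsCompact IsOpen := by
  intro U hU c hc
  rw [posConv_apply m n hU.measurableSet] at hc
  obtain ⟨A, ⟨L, hL, hLU, rfl⟩, -, hlt⟩ := exists_lt_lintegral_section m n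
    ((fun p : S × S => p.1 * p.2) ⁻¹' U)
    {A | ∃ L, IsCompact L ∧ L ⊆ U ∧ A = (fun p : S × S => p.1 * p.2) ⁻¹' L}
    ⟨∅, isCompact_empty, empty_subset _, rfl⟩
    (by
      rintro _ ⟨L, h1, h2, rfl⟩ _ ⟨L', h1', h2', rfl⟩
      exact ⟨L ∪ L', h1.union h1', union_subset h2 h2', rfl⟩)
    (by
      rintro _ ⟨L, h1, h2, rfl⟩
      exact measurable_section m h1.measurableSet)
    (fun y ε hε => by
      have hV : IsOpen ((· * y) ⁻¹' U) := hU.preimage (by fun_prop)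
      obtain ⟨K, hKV, hK, hKlt⟩ := hV.measurableSet.exists_isCompact_lt_add
        (measure_ne_top m _) (ENNReal.coe_pos.2 hε).ne'
      have hKy : IsCompact ((· * y) '' K) := hK.image (by fun_prop)
      obtain ⟨L, hL, hKL, hLU⟩ := exists_compact_between hKy hU (image_subset_iff.2 hKV)
      have h1 : ∀ᶠ z in 𝓝 y, ∀ x ∈ K, x * z ∈ interior L := by
        refine hK.eventually_forall_of_forall_eventually fun x hx => ?_
        have hc : Continuous fun p : S × S => p.2 * p.1 := by fun_prop
        exact (hc.tendsto (y, x)).eventually (isOpen_interior.mem_nhds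
          (hKL (mem_image_of_mem _ hx)) : ∀ᶠ w in 𝓝 (x * y), w ∈ interior L)
      refine ⟨_, h1, _, ⟨L, hL, hLU, rfl⟩, preimage_mono hLU, fun z hz => hKlt.le.trans ?_⟩
      gcongr
      exact fun x hx => (interior_subset (s := L)) (hz x hx)) hc
  exact ⟨L, hLU, hL, by rwa [posConv_apply m n hL.measurableSet]⟩

instance posConv_regular (m n : Measure S) [IsFiniteMeasure m] [m.Regular] [IsFiniteMeasure n]
    [n.Regular] : (posConv m n).Regular := by
  have h := posConv_innerRegular m n
  have hw : (posConv m n).WeaklyRegular :=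
    Measure.InnerRegularWRT.weaklyRegular_of_finite _
      (fun U hU c hc => by
        obtain ⟨K, h1, h2, h3⟩ := h hU c hc
        exact ⟨K, h1, h2.isClosed, h3⟩)
  exact { innerRegular := h }

lemma measurable_section_signed (s : SignedMeasure S) (m : Measure S) [IsFiniteMeasure m]
    [m.Regular] (h : s.variation ≤ m) {E : Set S} (hE : MeasurableSet E) :
    Measurable fun y => s ((· * y) ⁻¹' E) := by
  set j := s.toJordanDecomposition
  have hj : j.posPart + j.negPart ≤ m := by
    rw [← SignedMeasure.totalVariation_eq_variation] at h
    exact h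
  have h1 : j.posPart.Regular := regular_of_le (le_trans (Measure.le_add_right le_rfl) hj)
  have h2 : j.negPart.Regular := regular_of_le (le_trans (Measure.le_add_left le_rfl) hj)
  have : (fun y => s ((· * y) ⁻¹' E)) = fun y =>
      (j.posPart ((· * y) ⁻¹' E)).toReal - (j.negPart ((· * y) ⁻¹' E)).toReal := by
    ext y
    conv_lhs => rw [← s.toSignedMeasure_toJordanDecomposition]
    rw [JordanDecomposition.toSignedMeasure, Measure.toSignedMeasure_sub_apply (measurable_mulR y hE)]
    rfl
  rw [this]
  exact (measurable_section _ hE).ennreal_toReal.sub (measurable_section _ hE).ennreal_toReal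

lemma measurable_section_complex (μ : M S) {E : Set S} (hE : MeasurableSet E) :
    Measurable fun y => μ.1 ((· * y) ⁻¹' E) := by
  have h1 : (ComplexMeasure.re μ.1).variation ≤ μ.1.variation := by
    refine VectorMeasure.variation_le_of_forall_enorm_le fun A _ => ?_
    refine le_trans ?_ (VectorMeasure.enorm_measure_le_variation μ.1 A)
    rw [← ofReal_norm, ← ofReal_norm]
    exact ENNReal.ofReal_le_ofReal (Complex.abs_re_le_norm (μ.1 A))
  have h2 : (ComplexMeasure.im μ.1).variation ≤ μ.1.variation := by
    refine VectorMeasure.variation_le_of_forall_enorm_le fun A _ => ?_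
    refine le_trans ?_ (VectorMeasure.enorm_measure_le_variation μ.1 A)
    rw [← ofReal_norm, ← ofReal_norm]
    exact ENNReal.ofReal_le_ofReal (Complex.abs_im_le_norm (μ.1 A))
  have := (Complex.measurable_ofReal.comp (measurable_section_signed _ _ h1 hE)).add
    ((Complex.measurable_ofReal.comp (measurable_section_signed _ _ h2 hE)).mul_const Complex.I)
  convert this using 1
  ext y
  exact (Complex.re_add_im _).symm

lemma variation_mem (μ : M S) (A : Set S) : ‖μ.1 A‖ₑ ≤ μ.1.variation A :=
  VectorMeasure.enorm_measure_le_variation μ.1 A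

lemma integrable_section (μ ν : M S) {E : Set S} (hE : MeasurableSet E) :
    Integrable (fun y => μ.1 ((· * y) ⁻¹' E)) ν.1.variation := by
  refine ⟨(measurable_section_complex μ hE).aestronglyMeasurable, ?_⟩
  refine HasFiniteIntegral.of_bounded (C := ‖μ‖) (Eventually.of_forall fun y => ?_)
  rw [norm_def, ← ENNReal.ofReal_le_ofReal_iff measureReal_nonneg, ofReal_norm,
    ofReal_measureReal]
  exact (variation_mem μ _).trans (measure_mono (subset_univ _))

/-- The convolution of two complex measures as a set function:
`(μ * ν)(E) = ∫ μ (E y⁻¹) dν(y)` where `E y⁻¹ = {x | x y ∈ E}`. -/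
def convMeasure (μ ν : M S) : ComplexMeasure S where
  measureOf' E := open Classical in
    if MeasurableSet E then cint ν.1 (fun y => μ.1 ((· * y) ⁻¹' E)) else 0
  empty' := by
    simp only [MeasurableSet.empty, if_true, preimage_empty, VectorMeasure.empty]
    exact VectorMeasure.integral_zero
  not_measurable' E hE := if_neg hE
  m_iUnion' f hf hd := by
    simp only [hf, MeasurableSet.iUnion hf, if_true]
    have hsum : ∀ y, ∑' i, μ.1.variation ((· * y) ⁻¹' f i) = 
        μ.1.variation ((· * y) ⁻¹' ⋃ i, f i) := fun y => by
      rw [preimage_iUnion, measure_iUnion (fun i j hij => (hd hij).preimage _)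
        (fun i => measurable_mulR y (hf i))]
    refine VectorMeasure.hasSum_integral_of_dominated_convergence
      (fun i y => (μ.1.variation ((· * y) ⁻¹' f i)).toReal)
      (fun i => (measurable_section_complex μ (hf i)).aestronglyMeasurable)
      (fun i => Eventually.of_forall fun y => ?_)
      (Eventually.of_forall fun y => ?_) ?_ (Eventually.of_forall fun y => ?_)
    · rw [← ENNReal.ofReal_le_iff_le_toReal (by finiteness), ofReal_norm]
      exact variation_mem μ _
    · refine ENNReal.summable_toReal ?_
      rw [hsum]
      finiteness
    · have : (fun y => ∑' i, (μ.1.variation ((· * y) ⁻¹' f i)).toReal) = 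
          fun y => (μ.1.variation ((· * y) ⁻¹' ⋃ i, f i)).toReal := by
        ext y
        rw [← hsum, ENNReal.tsum_toReal_eq (fun i => by finiteness)]
      rw [this]
      refine ⟨(measurable_section _ (.iUnion hf)).ennreal_toReal.aestronglyMeasurable, ?_⟩
      refine HasFiniteIntegral.of_bounded (C := ‖μ‖) (Eventually.of_forall fun y => ?_)
      rw [Real.norm_of_nonneg ENNReal.toReal_nonneg]
      exact ENNReal.toReal_mono (by finiteness) (measure_mono (subset_univ _))
    · rw [preimage_iUnion]
      exact μ.1.m_iUnion (fun i => measurable_mulR y (hf i)) (fun i j hij => (hd hij).preimage _)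

lemma convMeasure_apply (μ ν : M S) {E : Set S} (hE : MeasurableSet E) :
    convMeasure μ ν E = cint ν.1 (fun y => μ.1 ((· * y) ⁻¹' E)) := if_pos hE

lemma variation_convMeasure_le (μ ν : M S) :
    (convMeasure μ ν).variation ≤ posConv μ.1.variation ν.1.variation := by
  refine VectorMeasure.variation_le_of_forall_enorm_le fun E hE => ?_
  rw [convMeasure_apply μ ν hE, posConv_apply _ _ hE]
  exact (enorm_cint_le _ _).trans (lintegral_mono fun y => variation_mem μ _)

/-- Convolution on `M(S)`. -/
def conv (μ ν : M S) : M S := ⟨convMeasure μ ν, by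
  exact ⟨isFiniteMeasure_of_le _ (variation_convMeasure_le μ ν),
    regular_of_le (variation_convMeasure_le μ ν)⟩⟩

lemma norm_conv_le (μ ν : M S) : ‖conv μ ν‖ ≤ ‖μ‖ * ‖ν‖ := by
  simp only [norm_def, Measure.real]
  rw [← ENNReal.toReal_mul, ← posConv_univ]
  exact ENNReal.toReal_mono (by finiteness) (variation_convMeasure_le μ ν _)

/-- Convolution as a bounded bilinear map. -/
def convL : M S →L[ℂ] M S →L[ℂ] M S :=
  LinearMap.mkContinuous₂ (LinearMap.mk₂ ℂ conv
    (fun μ μ' ν => Subtype.ext <| VectorMeasure.ext fun E hE => by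
      simp only [conv, Submodule.coe_add, add_apply, convMeasure_apply _ _ hE]
      exact cint_add _ (integrable_section μ ν hE) (integrable_section μ' ν hE))
    (fun c μ ν => Subtype.ext <| VectorMeasure.ext fun E hE => by
      simp only [conv, Submodule.coe_smul, smul_apply, convMeasure_apply _ _ hE]
      exact cint_const_smul _ _ _)
    (fun μ ν ν' => Subtype.ext <| VectorMeasure.ext fun E hE => by
      simp only [conv, Submodule.coe_add, add_apply, convMeasure_apply _ _ hE]
      exact cint_measure_add _ _ (integrable_section μ ν hE) (integrable_section μ ν' hE))
    (fun c μ ν => Subtype.ext <| VectorMeasure.ext fun E hE => by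
      simp only [conv, Submodule.coe_smul, smul_apply, convMeasure_apply _ _ hE]
      exact cint_measure_smul _ _ (integrable_section μ ν hE))) 1 (fun μ ν => by
        simpa using norm_conv_le μ ν)

end Conv

section Positive

/-- A finite regular positive measure as an element of `M(S)`. -/
def ofM (m : Measure S) [IsFiniteMeasure m] [m.Regular] : M S :=
  ⟨m.withDensityᵥ fun _ => (1 : ℂ), by
    have h : (m.withDensityᵥ fun _ => (1 : ℂ)).variation = m := by
      rw [Measure.variation_withDensityᵥ (integrable_const _)]
      simp
    change IsFiniteMeasure _ ∧ Measure.Regular _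
    rw [h]
    exact ⟨inferInstance, inferInstance⟩⟩

lemma variation_ofM (m : Measure S) [IsFiniteMeasure m] [m.Regular] :
    (ofM m).1.variation = m := by
  rw [ofM, Measure.variation_withDensityᵥ (integrable_const _)]
  simp

lemma ofM_apply (m : Measure S) [IsFiniteMeasure m] [m.Regular] {E : Set S}
    (hE : MeasurableSet E) : (ofM m).1 E = (m.real E : ℂ) := by
  rw [ofM, withDensityᵥ_apply (integrable_const _) hE]
  simp

lemma norm_ofM (m : Measure S) [IsFiniteMeasure m] [m.Regular] : ‖ofM m‖ = m.real univ := by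
  rw [norm_def, variation_ofM]

lemma ofM_congr {m n : Measure S} [IsFiniteMeasure m] [m.Regular] [IsFiniteMeasure n] [n.Regular]
    (h : m = n) : ofM m = ofM n := by
  subst h; rfl

instance (x : S) : (Measure.dirac x).Regular := by
  have : (Measure.dirac x).InnerRegular := by
    refine ⟨fun A hA r hr => ?_⟩
    by_cases hx : x ∈ A
    · refine ⟨{x}, by simpa using hx, isCompact_singleton, ?_⟩
      rw [Measure.dirac_apply' _ hA] at hr
      simpa [hx] using hr
    · rw [Measure.dirac_apply' _ hA] at hr
      simp [hx] at hr
  infer_instance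

/-- The total variation `|μ|` as an element of `M(S)`. -/
def absM (μ : M S) : M S := ofM μ.1.variation

/-- Unit point mass. -/
def delta (s : S) : M S := ofM (Measure.dirac s)

variable {l : Measure S} [IsFiniteMeasure l] [l.Regular]

lemma regular_withDensity {f : S → ℂ} (hf : Integrable f l) :
    (l.withDensity fun x => ‖f x‖ₑ).Regular := by
  have hfin : IsFiniteMeasure (l.withDensity fun x => ‖f x‖ₑ) := ⟨by simpa using! hf.2⟩
  have : (l.withDensity fun x => ‖f x‖ₑ).InnerRegular := by
    refine ⟨fun A hA r hr => ?_⟩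
    obtain ⟨δ, hδ, hδ'⟩ := exists_pos_setLIntegral_lt_of_measure_lt (f := fun x => ‖f x‖ₑ)
      (μ := l) hf.2.ne (tsub_pos_of_lt hr).ne'
    obtain ⟨K, hKA, hK, hlt⟩ := hA.exists_isCompact_sdiff_lt (measure_ne_top l A) hδ.ne'
    refine ⟨K, hKA, hK, ?_⟩
    set m := l.withDensity fun x => ‖f x‖ₑ
    have h1 : m (A \ K) < m A - r := by
      rw [withDensity_apply _ (hA.diff hK.measurableSet)]
      exact hδ' _ hlt
    have h2 : m A ≤ m K + m (A \ K) := by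
      rw [← measure_inter_add_sdiff A hK.measurableSet, inter_eq_right.2 hKA]
    by_contra hcon
    push Not at hcon
    have h3 : m A < r + (m A - r) := lt_of_le_of_lt h2
      (lt_of_le_of_lt (add_le_add_left hcon _) (ENNReal.add_lt_add_left (ne_top_of_lt hr) h1))
    rw [add_tsub_cancel_of_le hr.le] at h3
    exact lt_irrefl _ h3
  infer_instance

/-- Integrable functions as measures. -/
def dens : (S →₁[l] ℂ) →L[ℂ] M S :=
  LinearMap.mkContinuous
    { toFun := fun f => ⟨l.withDensityᵥ f, by
        change IsFiniteMeasure _ ∧ Measure.Regular _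
        rw [Measure.variation_withDensityᵥ (L1.integrable_coeFn f)]
        exact ⟨⟨by simpa using! (L1.integrable_coeFn f).2⟩,
          regular_withDensity (L1.integrable_coeFn f)⟩⟩
      map_add' := fun f g => Subtype.ext <| by
        change l.withDensityᵥ _ = l.withDensityᵥ _ + l.withDensityᵥ _
        rw [← withDensityᵥ_add (L1.integrable_coeFn f) (L1.integrable_coeFn g)]
        exact WithDensityᵥEq.congr_ae (Lp.coeFn_add f g)
      map_smul' := fun c f => Subtype.ext <| by
        change l.withDensityᵥ _ = c • l.withDensityᵥ _
        rw [← withDensityᵥ_smul]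
        exact WithDensityᵥEq.congr_ae (Lp.coeFn_smul c f) } 1 (fun f => by
      change (l.withDensityᵥ f).variation.real univ ≤ _
      rw [Measure.variation_withDensityᵥ (L1.integrable_coeFn f), one_mul, L1.norm_def]
      simp [Measure.real])

lemma dens_apply (f : S →₁[l] ℂ) : (dens f).1 = l.withDensityᵥ f := rfl

lemma exists_density (s : SignedMeasure S) (C : ℝ≥0) (h : ∀ E, ‖s E‖ₑ ≤ (C • l) E) :
    ∃ g : S → ℝ, Measurable g ∧ (∀ x, |g x| ≤ C) ∧
      ∀ E, MeasurableSet E → s E = ∫ x in E, g x ∂l := by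
  have hac : s ≪ᵥ l.toENNRealVectorMeasure := by
    refine VectorMeasure.AbsolutelyContinuous.mk fun E hE h0 => ?_
    rw [Measure.toENNRealVectorMeasure_apply_measurable hE] at h0
    simpa [h0] using h E
  have hd := s.withDensityᵥ_rnDeriv_eq l hac
  have hint := SignedMeasure.integrable_rnDeriv s l
  have hle : ∀ E, MeasurableSet E → |∫ x in E, s.rnDeriv l x ∂l| ≤ C * l.real E := by
    intro E hE
    rw [← withDensityᵥ_apply hint hE, hd]
    have := ENNReal.toReal_mono (by finiteness) (h E)
    simpa [Measure.real] using this
  have h1 : s.rnDeriv l ≤ᵐ[l] fun _ => (C : ℝ) := by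
    refine ae_le_of_forall_setIntegral_le hint (integrable_const _) fun E hE _ => ?_
    have := (abs_le.1 (hle E hE)).2
    simpa [mul_comm] using this
  have h2 : (fun _ => -(C : ℝ)) ≤ᵐ[l] s.rnDeriv l := by
    refine ae_le_of_forall_setIntegral_le (integrable_const _) hint fun E hE _ => ?_
    have := (abs_le.1 (hle E hE)).1
    simpa [mul_comm] using this
  refine ⟨fun x => max (-C) (min C (s.rnDeriv l x)),
    measurable_const.max (measurable_const.min (SignedMeasure.measurable_rnDeriv s l)),
    fun x => abs_le.2 ⟨le_max_left _ _, max_le (by linarith [C.2]) (min_le_left _ _)⟩,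
    fun E hE => ?_⟩
  conv_lhs => rw [← hd, withDensityᵥ_apply hint hE]
  refine setIntegral_congr_ae hE ?_
  filter_upwards [h1, h2] with x h1 h2 _
  rw [min_eq_right h1, max_eq_right h2]

/-- A bounded functional is given by a bounded Borel function on the measures dominated by `l`. -/
lemma exists_repr (F : StrongDual ℂ (M S)) (l : Measure S) [IsFiniteMeasure l] [l.Regular] :
    ∃ h : S → ℂ, Measurable h ∧ (∃ C, ∀ x, ‖h x‖ ≤ C) ∧
      ∀ (m : Measure S) [IsFiniteMeasure m] [m.Regular], m ≪ l → F (ofM m) = ∫ x, h x ∂m := by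
  classical
  let σ₀ : Set S → ℂ := fun E => if hE : MeasurableSet E then
    F (dens (indicatorConstLp 1 hE (measure_ne_top l E) (1 : ℂ))) else 0
  have hσ₀ : ∀ E, ‖σ₀ E‖ₑ ≤ (‖F‖₊ • l) E := by
    intro E
    by_cases hE : MeasurableSet E
    · simp only [σ₀, hE, dif_pos]
      rw [← ofReal_norm]
      have h1 : ‖F (dens (indicatorConstLp 1 hE (measure_ne_top l E) (1 : ℂ)))‖
          ≤ ‖F‖ * l.real E := by
        refine (F.le_opNorm _).trans ?_
        gcongr
        refine (dens.le_opNorm _).trans ?_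
        refine (mul_le_mul_of_nonneg_right (LinearMap.mkContinuous_norm_le _ zero_le_one _)
          (norm_nonneg _)).trans ?_
        rw [norm_indicatorConstLp one_ne_zero ENNReal.one_ne_top]
        simp
      refine (ENNReal.ofReal_le_ofReal h1).trans ?_
      rw [ENNReal.ofReal_mul (norm_nonneg _), ofReal_measureReal]
      rw [ofReal_norm]
      exact le_of_eq rfl
    · simp [σ₀, hE]
  let σ : ComplexMeasure S := VectorMeasure.of_additive_of_le_measure σ₀ hσ₀ (by
      intro E E' hE hE' hd
      simp only [σ₀, hE, hE', hE.union hE', dif_pos]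
      rw [indicatorConstLp_disjoint_union hE hE' (measure_ne_top _ _) (measure_ne_top _ _) hd,
        map_add, map_add]) (fun E hE => by simp [σ₀, hE])
  have hσ : ∀ E, (hE : MeasurableSet E) →
      σ E = F (dens (indicatorConstLp 1 hE (measure_ne_top l E) (1 : ℂ))) := fun E hE => by
    change σ₀ E = _
    simp [σ₀, hE]
  obtain ⟨g₁, hg₁, hb₁, he₁⟩ := exists_density (l := l) (ComplexMeasure.re σ) ‖F‖₊ fun E => by
    refine le_trans ?_ (hσ₀ E)
    rw [← ofReal_norm, ← ofReal_norm]
    exact ENNReal.ofReal_le_ofReal (Complex.abs_re_le_norm (σ₀ E))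
  obtain ⟨g₂, hg₂, hb₂, he₂⟩ := exists_density (l := l) (ComplexMeasure.im σ) ‖F‖₊ fun E => by
    refine le_trans ?_ (hσ₀ E)
    rw [← ofReal_norm, ← ofReal_norm]
    exact ENNReal.ofReal_le_ofReal (Complex.abs_im_le_norm (σ₀ E))
  set h : S → ℂ := fun x => g₁ x + g₂ x * Complex.I with hh
  have hhm : Measurable h := (Complex.measurable_ofReal.comp hg₁).add
    ((Complex.measurable_ofReal.comp hg₂).mul_const _)
  have hhb : ∀ x, ‖h x‖ ≤ ‖F‖ + ‖F‖ := fun x => by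
    refine (norm_add_le _ _).trans (add_le_add ?_ ?_)
    · simpa using hb₁ x
    · simpa using hb₂ x
  have hσh : ∀ E, MeasurableSet E → σ E = ∫ x in E, h x ∂l := by
    intro E hE
    have i1 : Integrable g₁ (l.restrict E) := Integrable.of_bound
      hg₁.aestronglyMeasurable (C := ‖F‖) (Eventually.of_forall fun x => by simpa using hb₁ x)
    have i2 : Integrable g₂ (l.restrict E) := Integrable.of_bound
      hg₂.aestronglyMeasurable (C := ‖F‖) (Eventually.of_forall fun x => by simpa using hb₂ x)
    rw [hh, integral_add i1.ofReal (i2.ofReal.mul_const _), integral_mul_const,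
      integral_complex_ofReal, integral_complex_ofReal]
    change _ = ((∫ x in E, g₁ x ∂l : ℝ) : ℂ) + ((∫ x in E, g₂ x ∂l : ℝ) : ℂ) * Complex.I
    rw [← he₁ E hE, ← he₂ E hE]
    exact (Complex.re_add_im _).symm
  have hint : ∀ g : S →₁[l] ℂ, Integrable (fun x => h x * g x) l := fun g =>
    (L1.integrable_coeFn g).bdd_mul (c := ‖F‖ + ‖F‖) hhm.aestronglyMeasurable
      (Eventually.of_forall hhb)
  let R : (S →₁[l] ℂ) →L[ℂ] ℂ := LinearMap.mkContinuous
    { toFun := fun g => ∫ x, h x * g x ∂l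
      map_add' := fun g g' => by
        rw [← integral_add (hint g) (hint g')]
        refine integral_congr_ae ?_
        filter_upwards [Lp.coeFn_add g g'] with x hx
        rw [hx, Pi.add_apply, mul_add]
      map_smul' := fun c g => by
        rw [RingHom.id_apply, smul_eq_mul, ← integral_const_mul]
        refine integral_congr_ae ?_
        filter_upwards [Lp.coeFn_smul c g] with x hx
        rw [hx, Pi.smul_apply, smul_eq_mul]
        ring } (‖F‖ + ‖F‖) (fun g => by
      refine (norm_integral_le_integral_norm _).trans ?_
      rw [L1.norm_eq_integral_norm, ← integral_const_mul]
      refine integral_mono (hint g).norm ((L1.integrable_coeFn g).norm.const_mul _) fun x => ?_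
      rw [norm_mul]
      exact mul_le_mul_of_nonneg_right (hhb x) (norm_nonneg _))
  have hFR : ∀ g : S →₁[l] ℂ, F (dens g) = R g := by
    refine Lp.induction ENNReal.one_ne_top _ ?_ ?_ ?_
    · intro c E hE hlt
      have e1 : (Lp.simpleFunc.indicatorConst 1 hE hlt.ne c : S →₁[l] ℂ) =
          c • indicatorConstLp 1 hE hlt.ne (1 : ℂ) := by
        rw [Lp.simpleFunc.coe_indicatorConst]
        refine Lp.ext ?_
        filter_upwards [indicatorConstLp_coeFn (p := 1) (hs := hE) (hμs := hlt.ne) (c := c),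
          indicatorConstLp_coeFn (p := 1) (hs := hE) (hμs := hlt.ne) (c := (1 : ℂ)),
          Lp.coeFn_smul c (indicatorConstLp 1 hE hlt.ne (1 : ℂ))] with x h1 h2 h3
        rw [h1, h3, Pi.smul_apply, h2]
        by_cases hxE : x ∈ E <;> simp [hxE]
      rw [e1, map_smul, map_smul, map_smul, ← hσ E hE, hσh E hE]
      congr 1
      change _ = ∫ x, h x * indicatorConstLp 1 hE hlt.ne (1 : ℂ) x ∂l
      rw [← integral_indicator hE]
      refine integral_congr_ae ?_
      filter_upwards [indicatorConstLp_coeFn (p := 1) (hs := hE) (hμs := hlt.ne) (c := (1 : ℂ))]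
        with x hx
      rw [hx]
      by_cases hxE : x ∈ E <;> simp [hxE]
    · intro f g hf hg _ h1 h2
      rw [map_add, map_add, map_add, h1, h2]
    · exact isClosed_eq (F.continuous.comp dens.continuous) R.continuous
  refine ⟨h, hhm, ⟨_, hhb⟩, fun m _ _ hml => ?_⟩
  have hrn : Integrable (fun x => ((m.rnDeriv l x).toReal : ℂ)) l :=
    (Measure.integrable_toReal_rnDeriv).ofReal
  have e1 : ofM m = dens (hrn.toL1 _) := by
    refine Subtype.ext (VectorMeasure.ext fun E hE => ?_)
    rw [ofM_apply m hE, dens_apply, WithDensityᵥEq.congr_ae hrn.coeFn_toL1,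
      withDensityᵥ_apply hrn hE, integral_complex_ofReal, Measure.setIntegral_toReal_rnDeriv hml]
  rw [e1, hFR]
  change ∫ x, h x * (hrn.toL1 _ : S →₁[l] ℂ) x ∂l = _
  rw [← integral_rnDeriv_smul hml]
  refine integral_congr_ae ?_
  filter_upwards [hrn.coeFn_toL1] with x hx
  rw [hx, mul_comm, Complex.real_smul]

lemma cint_ofM (m : Measure S) [IsFiniteMeasure m] [m.Regular] {f : S → ℂ} (hf : Integrable f m) :
    cint (ofM m).1 f = ∫ x, f x ∂m := by
  have hv := variation_ofM m
  have hf' : Integrable f (ofM m).1.variation := by rwa [hv]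
  have hdom : DominatedFinMeasAdditive m
      ((ofM m).1.transpose (ContinuousLinearMap.mul ℝ ℂ)) ‖ContinuousLinearMap.mul ℝ ℂ‖ := by
    have := dominatedFinMeasAdditive_cbmApplyMeasure (ofM m).1 (ContinuousLinearMap.mul ℝ ℂ)
    rwa [hv] at this
  have h1 : cint (ofM m).1 f = setToFun m _ hdom f :=
    setToFun_congr_measure_of_integrable 1 (by simp) (by rw [hv, one_smul]) _ hdom f hf'
  rw [h1, integral_eq_setToFun]
  refine setToFun_congr_left' _ _ (fun E hE _ => ?_) f
  ext x
  change x * (ofM m).1 E = m.real E • x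
  rw [ofM_apply m hE, Complex.real_smul, mul_comm]

/-- The functional on `M(S)` given by a bounded Borel function. -/
lemma exists_bddFunctional {g : S → ℂ} (hg : Measurable g) {C : ℝ} (hC : ∀ x, ‖g x‖ ≤ C) :
    ∃ G : StrongDual ℂ (M S), ∀ (m : Measure S) [IsFiniteMeasure m] [m.Regular],
      G (ofM m) = ∫ x, g x ∂m := by
  have hint : ∀ (m : Measure S) [IsFiniteMeasure m], Integrable g m := fun m _ =>
    Integrable.of_bound hg.aestronglyMeasurable C (Eventually.of_forall hC)
  refine ⟨LinearMap.mkContinuous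
    { toFun := fun μ => cint μ.1 g
      map_add' := fun μ ν => cint_measure_add _ _ (hint _) (hint _)
      map_smul' := fun c μ => cint_measure_smul c _ (hint _) } C (fun μ => ?_), fun m _ _ => ?_⟩
  · change ‖cint μ.1 g‖ ≤ C * μ.1.variation.real univ
    have h1 : ‖cint μ.1 g‖ₑ ≤ ENNReal.ofReal C * μ.1.variation univ := by
      refine (enorm_cint_le _ _).trans ?_
      rw [← lintegral_const]
      refine lintegral_mono fun x => ?_
      rw [← ofReal_norm]
      exact ENNReal.ofReal_le_ofReal (hC x)
    have h2 := ENNReal.toReal_mono (by finiteness) h1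
    rcases isEmpty_or_nonempty S with hS | ⟨⟨x⟩⟩
    · have : univ = (∅ : Set S) := univ_eq_empty_iff.2 hS
      simpa [this, toReal_enorm] using h2
    · have hC0 : 0 ≤ C := (norm_nonneg _).trans (hC x)
      simpa [toReal_enorm, ENNReal.toReal_ofReal hC0, Measure.real] using h2
  · exact cint_ofM m (hint m)

lemma exists_null (μ : M S) (l : Measure S) [IsFiniteMeasure l] :
    ∃ A, MeasurableSet A ∧ l A = 0 ∧ ∀ B, l B = 0 → μ.1.variation (B \ A) = 0 := by
  obtain ⟨N, hN, h1, h2⟩ := Measure.mutuallySingular_singularPart μ.1.variation l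
  refine ⟨Nᶜ, hN.compl, h2, fun B hB => ?_⟩
  rw [Measure.haveLebesgueDecomposition_add μ.1.variation l, Measure.add_apply, add_eq_zero]
  refine ⟨measure_mono_null (fun x hx => by simpa using hx.2) h1, ?_⟩
  exact withDensity_absolutelyContinuous _ _ (measure_mono_null sdiff_subset hB)

/-- The total mass of the part singular to `l` is a bounded functional. -/
lemma exists_singFunctional (l : Measure S) [IsFiniteMeasure l] :
    ∃ G : StrongDual ℂ (M S), ∀ (m : Measure S) [IsFiniteMeasure m] [m.Regular],
      ∃ A, MeasurableSet A ∧ l A = 0 ∧ m.restrict Aᶜ ≪ l ∧ G (ofM m) = m.real A := by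
  choose A hA hlA hB using fun μ : M S => exists_null μ l
  have key : ∀ (μ : M S) (B : Set S), MeasurableSet B → l B = 0 → A μ ⊆ B → 
      μ.1 B = μ.1 (A μ) := by
    intro μ B hBm hlB hAB
    have h0 : μ.1 (B \ A μ) = 0 := by
      have := VectorMeasure.enorm_measure_le_variation μ.1 (B \ A μ)
      rw [hB μ B hlB] at this
      simpa using this
    rw [← union_sdiff_cancel hAB, VectorMeasure.of_union disjoint_sdiff_right (hA μ)
      (hBm.diff (hA μ)), h0, add_zero]
  refine ⟨LinearMap.mkContinuous
    { toFun := fun μ => μ.1 (A μ)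
      map_add' := fun μ ν => ?_
      map_smul' := fun c μ => ?_ } 1 (fun μ => ?_), fun m _ _ => ?_⟩
  · have hm : MeasurableSet (A μ ∪ A ν ∪ A (μ + ν)) := ((hA μ).union (hA ν)).union (hA _)
    have hl : l (A μ ∪ A ν ∪ A (μ + ν)) = 0 := by simp [measure_union_null_iff, hlA]
    rw [← key (μ + ν) _ hm hl subset_union_right,
      ← key μ _ hm hl (subset_union_left.trans subset_union_left),
      ← key ν _ hm hl (subset_union_right.trans subset_union_left)]
    rfl
  · have hm : MeasurableSet (A μ ∪ A (c • μ)) := (hA μ).union (hA _)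
    have hl : l (A μ ∪ A (c • μ)) = 0 := by simp [measure_union_null_iff, hlA]
    rw [← key (c • μ) _ hm hl subset_union_right, ← key μ _ hm hl subset_union_left]
    rfl
  · rw [one_mul]
    change ‖μ.1 (A μ)‖ ≤ _
    refine (VectorMeasure.norm_measure_le_variation (E := A μ)).trans ?_
    exact measureReal_mono (subset_univ _)
  · refine ⟨A (ofM m), hA _, hlA _, ?_, ofM_apply m (hA _)⟩
    refine Measure.AbsolutelyContinuous.mk fun B hBm hlB => ?_
    rw [Measure.restrict_apply hBm]
    have := hB (ofM m) B hlB
    rwa [variation_ofM] at this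

/-- Density of the continuous functions of compact support in `L¹`. -/
lemma exists_approx [LocallyCompactSpace S] (m : Measure S) [IsFiniteMeasure m] [m.Regular]
    {h : S → ℂ} (hh : Integrable h m) {ε : ℝ} (hε : 0 < ε) :
    ∃ k : S → ℂ, HasCompactSupport k ∧ ∫ x, ‖h x - k x‖ ∂m ≤ ε ∧ Continuous k := by
  have hd : ∀ (c : ℂ) ⦃E : Set S⦄, MeasurableSet E → m E < ∞ → ∀ {δ : ℝ≥0∞}, δ ≠ 0 →
      ∃ g : S → ℂ, eLpNorm (g - E.indicator fun _ => c) 1 m ≤ δ ∧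
        (HasCompactSupport g ∧ Continuous g) := by
    intro c E hE _ δ hδ
    obtain ⟨η, hη, hηδ⟩ : ∃ η : ℝ≥0∞, η ≠ 0 ∧ ‖c‖ₑ * (η + η) ≤ δ := by
      have h1 : Tendsto (fun η : ℝ≥0∞ => ‖c‖ₑ * (η + η)) (𝓝[>] 0) (𝓝 (‖c‖ₑ * (0 + 0))) :=
        (ENNReal.Tendsto.const_mul (tendsto_id.add tendsto_id) (by simp)).mono_left
          nhdsWithin_le_nhds
      have h2 := h1.eventually_lt_const (u := δ) (by simpa using pos_iff_ne_zero.2 hδ)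
      obtain ⟨η, h3, h4⟩ := (h2.and self_mem_nhdsWithin).exists
      exact ⟨η, (ne_of_gt h4), h3.le⟩
    obtain ⟨K, hKE, hK, hKlt⟩ := hE.exists_isCompact_sdiff_lt (measure_ne_top m E) hη
    obtain ⟨U, hEU, hU, -, hUlt⟩ := hE.exists_isOpen_sdiff_lt (measure_ne_top m E) hη
    obtain ⟨f, hf1, hf0, hfs, hf01⟩ := exists_continuous_one_zero_of_isCompact hK
      hU.isClosed_compl (disjoint_compl_right_iff_subset.2 (hKE.trans hEU))
    refine ⟨fun x => (f x : ℂ) * c, ?_, ?_, by fun_prop⟩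
    · rw [eLpNorm_one_eq_lintegral_enorm]
      calc ∫⁻ x, ‖((fun x => (f x : ℂ) * c) - E.indicator fun _ => c) x‖ₑ ∂m
          ≤ ∫⁻ x, (U \ K).indicator (fun _ => ‖c‖ₑ) x ∂m := by
            refine lintegral_mono fun x => ?_
            by_cases hxK : x ∈ K
            · have h1 : f x = 1 := hf1 hxK
              have h2 : x ∈ E := hKE hxK
              simp [h1, h2]
            · by_cases hxU : x ∈ U
              · have h3 : x ∈ U \ K := ⟨hxU, hxK⟩
                rw [indicator_of_mem h3, ← ofReal_norm, ← ofReal_norm]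
                refine ENNReal.ofReal_le_ofReal ?_
                obtain ⟨h4, h5⟩ := hf01 x
                by_cases hxE : x ∈ E
                · have : ((f x : ℂ) * c - c) = ((f x - 1 : ℝ) : ℂ) * c := by
                    push_cast; ring
                  simp only [Pi.sub_apply, indicator_of_mem hxE, this, norm_mul,
                    Complex.norm_real, Real.norm_eq_abs]
                  exact mul_le_of_le_one_left (norm_nonneg _)
                    (abs_le.2 ⟨by linarith, by linarith⟩)
                · simp only [Pi.sub_apply, indicator_of_notMem hxE, sub_zero, norm_mul,
                    Complex.norm_real, Real.norm_eq_abs]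
                  exact mul_le_of_le_one_left (norm_nonneg _)
                    (abs_le.2 ⟨by linarith, by linarith⟩)
              · have h1 : f x = 0 := hf0 hxU
                have h2 : x ∉ E := fun h => hxU (hEU h)
                simp [h1, h2]
        _ = ‖c‖ₑ * m (U \ K) := lintegral_indicator_const
            (hU.measurableSet.diff hK.measurableSet) _
        _ ≤ ‖c‖ₑ * (η + η) := by
            gcongr
            refine (measure_mono (t := (U \ E) ∪ (E \ K)) fun x hx => ?_).trans
              ((measure_union_le _ _).trans (add_le_add hUlt.le hKlt.le))
            by_cases hxE : x ∈ E
            · exact Or.inr ⟨hxE, hx.2⟩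
            · exact Or.inl ⟨hx.1, hxE⟩
        _ ≤ δ := hηδ
    · have : HasCompactSupport fun x => ((f x : ℝ) : ℂ) := hfs.comp_left (g := Complex.ofReal) rfl
      exact this.mul_right
  obtain ⟨k, hk, hks, hkc⟩ := MemLp.induction_dense (p := 1) ENNReal.one_ne_top
    (fun k : S → ℂ => HasCompactSupport k ∧ Continuous k) (μ := m) hd
    (fun f g hf hg => ⟨hf.1.add hg.1, hf.2.add hg.2⟩)
    (fun f hf => hf.2.measurable.aestronglyMeasurable) (memLp_one_iff_integrable.2 hh)
    (ε := ENNReal.ofReal ε) (by simpa using hε)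
  refine ⟨k, hks, ?_, hkc⟩
  have e1 := integral_norm_eq_lintegral_enorm (hh.aestronglyMeasurable.sub
    hkc.measurable.aestronglyMeasurable)
  rw [eLpNorm_one_eq_lintegral_enorm] at hk
  exact e1.le.trans (ENNReal.toReal_le_of_le_ofReal hε.le hk)

/-- A family of positive measures dominated by a weakly continuous family is weakly continuous
as soon as it is vaguely continuous. -/
lemma weaklyContinuous_of_le [LocallyCompactSpace S] {X : Type*} [TopologicalSpace X]
    (φ ψ : X → Measure S)
    [∀ x, IsFiniteMeasure (φ x)] [∀ x, (φ x).Regular] [∀ x, IsFiniteMeasure (ψ x)]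
    [∀ x, (ψ x).Regular] (hle : ∀ x, ψ x ≤ φ x)
    (hφ : ∀ F : StrongDual ℂ (M S), Continuous fun x => F (ofM (φ x)))
    (hψ : ∀ k : S → ℂ, Continuous k → HasCompactSupport k → Continuous fun x => ∫ y, k y ∂ψ x)
    (F : StrongDual ℂ (M S)) : Continuous fun x => F (ofM (ψ x)) := by
  rw [continuous_iff_continuousAt]
  intro x₀
  obtain ⟨h, hm, ⟨C, hC⟩, hF⟩ := exists_repr F (φ x₀)
  have hint : ∀ (m : Measure S) [IsFiniteMeasure m], Integrable h m := fun m _ =>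
    Integrable.of_bound hm.aestronglyMeasurable C (Eventually.of_forall hC)
  obtain ⟨G, hG⟩ := exists_singFunctional (φ x₀)
  -- the singular part tends to zero
  have hC0 : 0 ≤ |C| := abs_nonneg C
  have hCb : ∀ x, ‖h x‖ ≤ |C| := fun x => (hC x).trans (le_abs_self C)
  have hG0 : Tendsto (fun x => G (ofM (φ x))) (𝓝 x₀) (𝓝 0) := by
    have := (hφ G).tendsto x₀
    obtain ⟨A, hA, h0, -, h2⟩ := hG (φ x₀)
    rw [h2, measureReal_def, h0] at this
    simpa using this
  have hdiff : ∀ x, ‖F (ofM (ψ x)) - ∫ y, h y ∂ψ x‖ ≤ (‖F‖ + |C|) * ‖G (ofM (φ x))‖ := by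
    intro x
    obtain ⟨A, hA, -, hac, h2⟩ := hG (φ x)
    have r1 : ((ψ x).restrict A).Regular := regular_of_le Measure.restrict_le_self
    have r2 : ((ψ x).restrict Aᶜ).Regular := regular_of_le Measure.restrict_le_self
    have hac' : (ψ x).restrict Aᶜ ≪ φ x₀ :=
      (Measure.absolutelyContinuous_of_le (Measure.restrict_mono le_rfl (hle x))).trans hac
    have hsplit : ofM (ψ x) = ofM ((ψ x).restrict A) + ofM ((ψ x).restrict Aᶜ) := by
      refine Subtype.ext (VectorMeasure.ext fun E hE => ?_)
      rw [Submodule.coe_add, add_apply, ofM_apply _ hE, ofM_apply _ hE, ofM_apply _ hE,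
        ← Complex.ofReal_add, ← measureReal_add_apply, Measure.restrict_add_restrict_compl hA]
    have hsplit2 : ∫ y, h y ∂ψ x = ∫ y in A, h y ∂ψ x + ∫ y in Aᶜ, h y ∂ψ x :=
      (integral_add_compl hA (hint _)).symm
    rw [hsplit, map_add, hF _ hac', hsplit2, add_sub_add_right_eq_sub, h2]
    have hle' : (ψ x).real A ≤ (φ x).real A :=
      ENNReal.toReal_mono (by finiteness) (hle x A)
    calc ‖F (ofM ((ψ x).restrict A)) - ∫ y in A, h y ∂ψ x‖
        ≤ ‖F‖ * (ψ x).real A + |C| * (ψ x).real A := by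
          refine (norm_sub_le _ _).trans (add_le_add ?_ ?_)
          · refine (F.le_opNorm _).trans ?_
            rw [norm_ofM]
            simp
          · refine (norm_integral_le_of_norm_le_const (Eventually.of_forall hCb)).trans ?_
            simp
      _ ≤ (‖F‖ + |C|) * ‖((φ x).real A : ℂ)‖ := by
          rw [Complex.norm_real, Real.norm_of_nonneg measureReal_nonneg, ← add_mul]
          gcongr
  have hlim1 : Tendsto (fun x => F (ofM (ψ x)) - ∫ y, h y ∂ψ x) (𝓝 x₀) (𝓝 0) := by
    refine squeeze_zero_norm hdiff ?_
    simpa using hG0.norm.const_mul (‖F‖ + |C|)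
  have hx₀ : F (ofM (ψ x₀)) = ∫ y, h y ∂ψ x₀ :=
    hF _ (Measure.absolutelyContinuous_of_le (hle x₀))
  -- the regular part
  have hlim2 : Tendsto (fun x => ∫ y, h y ∂ψ x) (𝓝 x₀) (𝓝 (∫ y, h y ∂ψ x₀)) := by
    rw [Metric.tendsto_nhds]
    intro ε hε
    obtain ⟨k, hks, hk, hkc⟩ := exists_approx (φ x₀) (hint (φ x₀))
      (ε := ε / 4) (by positivity)
    obtain ⟨D, hD⟩ := hkc.bounded_above_of_compact_support hks
    have hki : ∀ (m : Measure S) [IsFiniteMeasure m], Integrable k m := fun m _ =>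
      Integrable.of_bound hkc.measurable.aestronglyMeasurable D (Eventually.of_forall hD)
    obtain ⟨H, hH⟩ := exists_bddFunctional (g := fun y => ((‖h y - k y‖ : ℝ) : ℂ))
      (Complex.measurable_ofReal.comp (hm.sub hkc.measurable).norm) (C := C + D) (fun y => by
        rw [Complex.norm_real, norm_norm]
        exact (norm_sub_le _ _).trans (add_le_add (hC y) (hD y)))
    have hH' : ∀ x, H (ofM (φ x)) = ((∫ y, ‖h y - k y‖ ∂φ x : ℝ) : ℂ) := fun x => by
      rw [hH, integral_complex_ofReal]
    have e1 : ∀ᶠ x in 𝓝 x₀, ∫ y, ‖h y - k y‖ ∂φ x < ε / 3 := by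
      have h1 := (Complex.continuous_re.comp (hφ H)).tendsto x₀
      simp only [Function.comp_def, hH', Complex.ofReal_re] at h1
      exact h1.eventually_lt_const (by linarith)
    have e2 := Metric.tendsto_nhds.1 ((hψ k hkc hks).tendsto x₀) (ε / 3) (by positivity)
    have bd : ∀ x, ‖∫ y, h y ∂ψ x - ∫ y, k y ∂ψ x‖ ≤ ∫ y, ‖h y - k y‖ ∂φ x := fun x => by
      rw [← integral_sub (hint _) (hki _)]
      refine (norm_integral_le_integral_norm _).trans ?_
      exact integral_mono_measure (hle x) (Eventually.of_forall fun y => norm_nonneg _)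
        ((hint _).sub (hki _)).norm
    have bd0 := (bd x₀).trans_lt e1.self_of_nhds
    filter_upwards [e1, e2] with x h1 h2
    rw [dist_eq_norm] at h2 ⊢
    have h3 := (bd x).trans_lt h1
    calc ‖∫ y, h y ∂ψ x - ∫ y, h y ∂ψ x₀‖
        = ‖(∫ y, h y ∂ψ x - ∫ y, k y ∂ψ x) + (∫ y, k y ∂ψ x - ∫ y, k y ∂ψ x₀)
            - (∫ y, h y ∂ψ x₀ - ∫ y, k y ∂ψ x₀)‖ := by congr 1; ring
      _ ≤ ‖∫ y, h y ∂ψ x - ∫ y, k y ∂ψ x‖ + ‖∫ y, k y ∂ψ x - ∫ y, k y ∂ψ x₀‖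
            + ‖∫ y, h y ∂ψ x₀ - ∫ y, k y ∂ψ x₀‖ := by
            refine (norm_sub_le _ _).trans ?_
            gcongr
            exact norm_add_le _ _
      _ < ε := by linarith
  have := hlim1.add hlim2
  rw [zero_add, ← hx₀] at this
  simpa [ContinuousAt] using this

end Positive

section Ideal
variable [LocallyCompactSpace S] [Semigroup S] [ContinuousMul S]

lemma conv_ofM (m n : Measure S) [IsFiniteMeasure m] [m.Regular] [IsFiniteMeasure n]
    [n.Regular] : conv (ofM m) (ofM n) = ofM (posConv m n) := by
  refine Subtype.ext (VectorMeasure.ext fun E hE => ?_)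
  have hi : Integrable (fun y => (ofM m).1 ((· * y) ⁻¹' E)) n := by
    have := integrable_section (ofM m) (ofM n) hE
    rwa [variation_ofM] at this
  rw [ofM_apply _ hE]
  change convMeasure _ _ E = _
  rw [convMeasure_apply _ _ hE, cint_ofM n hi, measureReal_def, posConv_apply _ _ hE]
  simp_rw [ofM_apply m (measurable_mulR _ hE)]
  rw [integral_complex_ofReal]
  simp only [measureReal_def]
  rw [integral_toReal (measurable_section m hE).aemeasurable
    (Eventually.of_forall fun y => measure_lt_top _ _)]

lemma ofM_add (m n : Measure S) [IsFiniteMeasure m] [m.Regular] [IsFiniteMeasure n]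
    [n.Regular] [(m + n).Regular] : ofM (m + n) = ofM m + ofM n := by
  refine Subtype.ext (VectorMeasure.ext fun E hE => ?_)
  rw [Submodule.coe_add, add_apply, ofM_apply _ hE, ofM_apply _ hE, ofM_apply _ hE,
        ← Complex.ofReal_add, ← measureReal_add_apply]

lemma posConv_assoc (a b c : Measure S) [IsFiniteMeasure a] [a.Regular] [IsFiniteMeasure b]
    [b.Regular] [IsFiniteMeasure c] [c.Regular] :
    posConv (posConv a b) c = posConv a (posConv b c) := by
  have hm : Measurable fun y : S => b.map (· * y) := by
    refine Measure.measurable_of_measurable_coe _ fun A hA => ?_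
    simp_rw [Measure.map_apply (measurable_mulR _) hA]
    exact measurable_section b hA
  ext E hE
  rw [posConv_apply _ _ hE, posConv_apply _ _ hE]
  conv_rhs => rw [posConv]
  rw [Measure.lintegral_bind hm.aemeasurable (measurable_section a hE).aemeasurable]
  refine lintegral_congr fun z => ?_
  rw [posConv_apply _ _ (measurable_mulR z hE), lintegral_map (measurable_section a hE) (measurable_mulR z)]
  refine lintegral_congr fun y => ?_
  congr 1
  ext x
  simp [mul_assoc]

lemma conv_assoc_pos (a b c : Measure S) [IsFiniteMeasure a] [a.Regular] [IsFiniteMeasure b]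
    [b.Regular] [IsFiniteMeasure c] [c.Regular] :
    conv (conv (ofM a) (ofM b)) (ofM c) = conv (ofM a) (conv (ofM b) (ofM c)) := by
  simp only [conv_ofM]
  exact ofM_congr (posConv_assoc a b c)

lemma posConv_dirac (m : Measure S) [IsFiniteMeasure m] [m.Regular] (s : S) :
    posConv m (Measure.dirac s) = m.map (· * s) := by
  ext E hE
  rw [posConv_apply _ _ hE, lintegral_dirac' _ (measurable_section m hE),
    Measure.map_apply (measurable_mulR _) hE]

lemma dirac_posConv (m : Measure S) (s : S) :
    posConv (Measure.dirac s) m = m.map (s * ·) := by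
  ext E hE
  rw [posConv_apply _ _ hE, Measure.map_apply (measurable_mulL _) hE,
    ← lintegral_indicator_one (measurable_mulL _ hE)]
  refine lintegral_congr fun y => ?_
  rw [Measure.dirac_apply' _ (measurable_mulR _ hE)]
  rfl

lemma dirac_posConv_dirac (s t : S) :
    posConv (Measure.dirac s) (Measure.dirac t) = Measure.dirac (s * t) := by
  rw [dirac_posConv, Measure.map_dirac' (measurable_mulL _)]

/-- Continuity of integrals depending on a parameter. -/
lemma continuous_integral_param (m : Measure S) [IsFiniteMeasure m] [m.Regular]
    {X : Type*} [TopologicalSpace X] {f : X → S → ℂ} (hf : Continuous (Function.uncurry f))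
    {C : ℝ} (hC : ∀ x y, ‖f x y‖ ≤ C) : Continuous fun x => ∫ y, f x y ∂m := by
  have hi : ∀ x, Integrable (f x) m := fun x => Integrable.of_bound
    (hf.comp (by fun_prop : Continuous fun y => (x, y))).measurable.aestronglyMeasurable C
    (Eventually.of_forall (hC x))
  rw [continuous_iff_continuousAt]
  intro x₀
  rw [ContinuousAt, Metric.tendsto_nhds]
  intro ε hε
  have hC0 : 0 ≤ |C| := abs_nonneg C
  set η : ℝ := ε / (2 * (m.real univ + 2 * |C| + 1)) with hη
  have hpos : 0 < m.real univ + 2 * |C| + 1 := by positivity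
  have hη0 : 0 < η := by positivity
  obtain ⟨K, -, hK, hKlt⟩ := (MeasurableSet.univ (α := S)).exists_isCompact_sdiff_lt
    (measure_ne_top m univ) (ε := ENNReal.ofReal η) (by simpa using hη0)
  have hKc : m.real Kᶜ ≤ η := by
    rw [compl_eq_univ_sdiff]
    exact ENNReal.toReal_le_of_le_ofReal hη0.le hKlt.le
  have hev : ∀ᶠ x in 𝓝 x₀, ∀ y ∈ K, ‖f x y - f x₀ y‖ < η := by
    refine hK.eventually_forall_of_forall_eventually fun y _ => ?_
    have hc : Continuous fun p : X × S => ‖f p.1 p.2 - f x₀ p.2‖ :=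
      ((hf.comp (by fun_prop : Continuous fun p : X × S => (p.1, p.2))).sub
        (hf.comp (by fun_prop : Continuous fun p : X × S => (x₀, p.2)))).norm
    have := hc.tendsto (x₀, y)
    simp only [sub_self, norm_zero] at this
    exact this.eventually_lt_const hη0
  filter_upwards [hev] with x hx
  have hadd := integral_add_compl hK.measurableSet ((hi x).sub (hi x₀))
  simp only [Pi.sub_apply] at hadd
  rw [dist_eq_norm, ← integral_sub (hi x) (hi x₀), ← hadd]
  have h1 : ‖∫ y in K, (f x y - f x₀ y) ∂m‖ ≤ η * m.real univ := by
    refine (norm_setIntegral_le_of_norm_le_const (measure_lt_top _ _)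
      (fun y hy => (hx y hy).le)).trans ?_
    exact mul_le_mul_of_nonneg_left (measureReal_mono (subset_univ _)) hη0.le
  have h2 : ‖∫ y in Kᶜ, (f x y - f x₀ y) ∂m‖ ≤ (2 * |C|) * η := by
    refine (norm_setIntegral_le_of_norm_le_const (C := 2 * |C|) (measure_lt_top _ _)
      (fun y _ => ?_)).trans ?_
    · refine (norm_sub_le _ _).trans ?_
      have := (hC x y).trans (le_abs_self C)
      have := (hC x₀ y).trans (le_abs_self C)
      linarith
    · gcongr
  calc _ ≤ η * m.real univ + (2 * |C|) * η := (norm_add_le _ _).trans (add_le_add h1 h2)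
    _ ≤ η * (m.real univ + 2 * |C| + 1) := by nlinarith
    _ = ε / 2 := by rw [hη]; field_simp
    _ < ε := by linarith

/-- Weak continuity of `s ↦ m * δ_s`. -/
def RightCont (m : Measure S) [IsFiniteMeasure m] [m.Regular] : Prop :=
  ∀ F : StrongDual ℂ (M S), Continuous fun s => F (conv (ofM m) (delta s))

/-- Weak continuity of `s ↦ δ_s * m`. -/
def LeftCont (m : Measure S) [IsFiniteMeasure m] [m.Regular] : Prop :=
  ∀ F : StrongDual ℂ (M S), Continuous fun s => F (conv (delta s) (ofM m))

lemma posConv_mono_left {a b : Measure S} [IsFiniteMeasure b] [b.Regular] (h : a ≤ b)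
    (n : Measure S) : posConv a n ≤ posConv b n := by
  have : IsFiniteMeasure a := isFiniteMeasure_of_le b h
  have : a.Regular := regular_of_le h
  refine Measure.le_iff.2 fun E hE => ?_
  rw [posConv_apply _ _ hE, posConv_apply _ _ hE]
  exact lintegral_mono fun y => h _

lemma posConv_mono_right (m : Measure S) [IsFiniteMeasure m] [m.Regular] {a b : Measure S}
    (h : a ≤ b) : posConv m a ≤ posConv m b := by
  refine Measure.le_iff.2 fun E hE => ?_
  rw [posConv_apply _ _ hE, posConv_apply _ _ hE]
  exact lintegral_mono' h le_rfl

lemma RightCont.of_le {m n : Measure S} [IsFiniteMeasure m] [m.Regular] [IsFiniteMeasure n]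
    [n.Regular] (hm : RightCont m) (h : n ≤ m) : RightCont n := by
  unfold RightCont delta at *
  simp only [conv_ofM] at *
  refine weaklyContinuous_of_le _ _ (fun s => posConv_mono_left h _) hm fun k hk hks => ?_
  obtain ⟨D, hD⟩ := hk.bounded_above_of_compact_support hks
  have : ∀ s, ∫ y, k y ∂posConv n (Measure.dirac s) = ∫ y, k (y * s) ∂n := fun s => by
    rw [posConv_dirac, integral_map (measurable_mulR _).aemeasurable
      hk.measurable.aestronglyMeasurable]
  simp_rw [this]
  exact continuous_integral_param n (f := fun s y => k (y * s))
    (hk.comp (by fun_prop : Continuous fun p : S × S => p.2 * p.1)) (fun _ _ => hD _)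

lemma LeftCont.of_le {m n : Measure S} [IsFiniteMeasure m] [m.Regular] [IsFiniteMeasure n]
    [n.Regular] (hm : LeftCont m) (h : n ≤ m) : LeftCont n := by
  unfold LeftCont delta at *
  simp only [conv_ofM] at *
  refine weaklyContinuous_of_le _ _ (fun s => posConv_mono_right _ h) hm fun k hk hks => ?_
  obtain ⟨D, hD⟩ := hk.bounded_above_of_compact_support hks
  have : ∀ s, ∫ y, k y ∂posConv (Measure.dirac s) n = ∫ y, k (s * y) ∂n := fun s => by
    rw [dirac_posConv, integral_map (measurable_mulL _).aemeasurable
      hk.measurable.aestronglyMeasurable]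
  simp_rw [this]
  exact continuous_integral_param n (f := fun s y => k (s * y))
    (hk.comp (by fun_prop : Continuous fun p : S × S => p.1 * p.2)) (fun _ _ => hD _)

/-- Convolution with the order of integration reversed. -/
lemma exists_kernel (m n : Measure S) [IsFiniteMeasure m] [m.Regular] [IsFiniteMeasure n]
    [n.Regular] : ∃ κ : ProbabilityTheory.Kernel S S, (∀ t, κ t = n.map (t * ·)) ∧
      posConv m n = m.bind κ := by
  have hm : Measurable fun t : S => n.map (t * ·) := by
    refine Measure.measurable_of_measurable_coe _ fun A hA => ?_
    simp_rw [Measure.map_apply (measurable_mulL _) hA]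
    exact measurable_section_left n hA
  refine ⟨⟨fun t => n.map (t * ·), hm⟩, fun t => rfl, ?_⟩
  change posConv m n = m.bind fun t => n.map (t * ·)
  have happ : ∀ E, MeasurableSet E →
      (m.bind fun t => n.map (t * ·)) E = ∫⁻ t, n ((t * ·) ⁻¹' E) ∂m := fun E hE => by
    rw [Measure.bind_apply hE hm.aemeasurable]
    simp_rw [Measure.map_apply (measurable_mulL _) hE]
  refine ext_of_generate_finite _ (BorelSpace.measurable_eq (α := S)) isPiSystem_isOpen
    (fun U hU => ?_) ?_
  · replace hU : IsOpen U := hU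
    rw [posConv_apply _ _ hU.measurableSet, happ _ hU.measurableSet]
    refine le_antisymm ?_ ?_
    · exact lintegral_section_le m n (W := (fun p : S × S => p.1 * p.2) ⁻¹' U)
        (hU.preimage (by fun_prop))
    · exact lintegral_section_le n m (W := (fun p : S × S => p.2 * p.1) ⁻¹' U)
        (hU.preimage (by fun_prop))
  · rw [posConv_univ, happ _ .univ]
    simp [mul_comm]

lemma functional_posConv {m n : Measure S} [IsFiniteMeasure m] [m.Regular] [IsFiniteMeasure n]
    [n.Regular] (hn : LeftCont n) (F : StrongDual ℂ (M S)) :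
    F (ofM (posConv m n)) = ∫ t, F (conv (delta t) (ofM n)) ∂m := by
  obtain ⟨κ, hκ, hbind⟩ := exists_kernel m n
  obtain ⟨h, hh, ⟨C, hC⟩, hF⟩ := exists_repr F (posConv m n)
  have hint : ∀ (m : Measure S) [IsFiniteMeasure m], Integrable h m := fun m _ =>
    Integrable.of_bound hh.aestronglyMeasurable C (Eventually.of_forall hC)
  have hac : ∀ t ∈ m.support, posConv (Measure.dirac t) n ≪ posConv m n := by
    intro t ht
    refine Measure.AbsolutelyContinuous.mk fun N hN h0 => ?_
    by_contra hne
    obtain ⟨G, hG⟩ := exists_bddFunctional (g := N.indicator fun _ => (1 : ℂ))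
      (measurable_const.indicator hN) (C := 1) (fun x => by
        by_cases hx : x ∈ N <;> simp [hx])
    have hG' : ∀ s, G (conv (delta s) (ofM n)) = ((n ((s * ·) ⁻¹' N)).toReal : ℂ) := fun s => by
      rw [delta, conv_ofM, hG, integral_indicator hN, dirac_posConv]
      simp [Measure.real, Measure.map_apply (measurable_mulL s) hN]
    have hcont : Continuous fun s => (n ((s * ·) ⁻¹' N)).toReal := by
      have := Complex.continuous_re.comp (hn G)
      simpa only [Function.comp_def, hG', Complex.ofReal_re] using this
    rw [dirac_posConv, Measure.map_apply (measurable_mulL t) hN] at hne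
    have hpos : 0 < (n ((t * ·) ⁻¹' N)).toReal := ENNReal.toReal_pos hne (by finiteness)
    have hev : {s | 0 < (n ((s * ·) ⁻¹' N)).toReal} ∈ 𝓝 t :=
      hcont.tendsto t |>.eventually_const_lt hpos
    have hmpos : 0 < m {s | 0 < (n ((s * ·) ⁻¹' N)).toReal} :=
      Measure.mem_support_iff_forall t |>.1 ht _ hev
    rw [hbind, Measure.bind_apply hN κ.aemeasurable, lintegral_eq_zero_iff
      (κ.measurable_coe hN)] at h0
    have : m {s | 0 < (n ((s * ·) ⁻¹' N)).toReal} = 0 := by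
      refine measure_mono_null (fun s hs => ?_) h0
      change ¬ (κ s N = 0)
      rw [hκ, Measure.map_apply (measurable_mulL s) hN]
      intro h
      have hs' : 0 < (n ((s * ·) ⁻¹' N)).toReal := hs
      rw [h] at hs'
      simp at hs'
    exact hmpos.ne' this
  have hsupp : ∀ᵐ t ∂m, t ∈ m.support := by
    rw [ae_iff]
    exact Measure.measure_compl_support_of_regular
  rw [hF _ Measure.AbsolutelyContinuous.rfl]
  have e1 : ∫ x, h x ∂posConv m n = ∫ t, ∫ y, h y ∂κ t ∂m := by
    have hb : posConv m n = (ProbabilityTheory.Kernel.comp κ (ProbabilityTheory.Kernel.const Unit m)) () := by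
      rw [ProbabilityTheory.Kernel.comp_apply, ProbabilityTheory.Kernel.const_apply, hbind]
    rw [hb, ProbabilityTheory.Kernel.integral_comp (by rw [← hb]; exact hint _),
      ProbabilityTheory.Kernel.const_apply]
  rw [e1]
  refine integral_congr_ae ?_
  filter_upwards [hsupp] with t ht
  rw [delta, conv_ofM, hF _ (hac t ht), hκ, dirac_posConv]

lemma RightCont.conv {m n : Measure S} [IsFiniteMeasure m] [m.Regular] [IsFiniteMeasure n]
    [n.Regular] (hn : RightCont n) : RightCont (posConv m n) := by
  intro F
  have := hn (F ∘L convL (ofM m))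
  refine this.congr fun s => ?_
  rw [← conv_ofM, delta, conv_assoc_pos]
  rfl

lemma LeftCont.conv {m n : Measure S} [IsFiniteMeasure m] [m.Regular] [IsFiniteMeasure n]
    [n.Regular] (hn : LeftCont n) : LeftCont (posConv m n) := by
  intro F
  have h1 : ∀ s, F (SemigroupMeasure.conv (delta s) (ofM (posConv m n))) =
      ∫ t, F (SemigroupMeasure.conv (delta (s * t)) (ofM n)) ∂m := fun s => by
    rw [← conv_ofM, delta, ← conv_assoc_pos, conv_ofM, conv_ofM, functional_posConv hn]
    rw [dirac_posConv, integral_map (measurable_mulL _).aemeasurable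
      (hn F).measurable.aestronglyMeasurable]
  simp_rw [h1]
  refine continuous_integral_param m (C := ‖F‖ * ‖ofM n‖)
    (f := fun s t => F (SemigroupMeasure.conv (delta (s * t)) (ofM n)))
    ((hn F).comp (by fun_prop : Continuous fun p : S × S => p.1 * p.2)) fun s t => ?_
  refine (F.le_opNorm _).trans ?_
  gcongr
  refine (norm_conv_le _ _).trans ?_
  rw [delta, norm_ofM]
  simp

lemma weaklyContinuous_iff {X : Type*} [TopologicalSpace X] (φ : X → M S) :
    (Continuous fun x => toWeakSpace ℂ (M S) (φ x)) ↔
      ∀ F : StrongDual ℂ (M S), Continuous fun x => F (φ x) :=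
  ⟨fun h F => (WeakBilin.eval_continuous (topDualPairing ℂ (M S)).flip F).comp h,
    fun h => WeakBilin.continuous_of_continuous_eval _ h⟩

end Ideal

section AbsolutelyContinuous
variable (S) [LocallyCompactSpace S] [Semigroup S] [ContinuousMul S]

/-- `M_a(S)`: the measures `μ ∈ M(S)` for which `s ↦ |μ| * δ_s` and `s ↦ δ_s * |μ|` are weakly
continuous maps from `S` to `M(S)`. -/
def Ma : Submodule ℂ (M S) where
  carrier := {μ |
    (Continuous fun s : S => toWeakSpace ℂ (M S) (conv (absM μ) (delta s))) ∧
    (Continuous fun s : S => toWeakSpace ℂ (M S) (conv (delta s) (absM μ)))}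
  add_mem' := by
    intro μ ν hμ hν
    simp only [mem_ofPred_eq, weaklyContinuous_iff, absM] at *
    have hr := regular_add (m := μ.1.variation) (n := ν.1.variation)
    have hle : (μ + ν).1.variation ≤ μ.1.variation + ν.1.variation :=
      VectorMeasure.variation_add_le
    refine ⟨RightCont.of_le (m := μ.1.variation + ν.1.variation) (fun F => ?_) hle,
      LeftCont.of_le (m := μ.1.variation + ν.1.variation) (fun F => ?_) hle⟩
    · refine ((hμ.1 F).add (hν.1 F)).congr fun s => ?_
      change F _ + F _ = _
      rw [ofM_add, ← map_add]
      exact congrArg F (congrArg (fun T => T (delta s)) (map_add convL _ _)).symm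
    · refine ((hμ.2 F).add (hν.2 F)).congr fun s => ?_
      change F _ + F _ = _
      rw [ofM_add, ← map_add]
      exact congrArg F (map_add (convL (delta s)) _ _).symm
  zero_mem' := by
    have h0 : absM (0 : M S) = 0 := by
      refine Subtype.ext (VectorMeasure.ext fun E hE => ?_)
      rw [absM, ofM_apply _ hE]
      simp [VectorMeasure.variation_zero]
    have h1 : ∀ μ : M S, conv μ 0 = 0 := fun μ => map_zero (convL μ)
    have h2 : ∀ μ : M S, conv 0 μ = 0 := fun μ =>
      congrArg (fun T => T μ) (map_zero (convL (S := S)))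
    simp only [mem_ofPred_eq, h0, h1, h2]
    exact ⟨continuous_const, continuous_const⟩
  smul_mem' := by
    intro c μ hμ
    have h0 : absM (c • μ) = (‖c‖ : ℂ) • absM μ := by
      refine Subtype.ext (VectorMeasure.ext fun E hE => ?_)
      rw [Submodule.coe_smul, smul_apply, absM, absM, ofM_apply _ hE, ofM_apply _ hE]
      simp [VectorMeasure.variation_smul, Measure.real]
    simp only [mem_ofPred_eq, weaklyContinuous_iff, h0] at hμ ⊢
    refine ⟨fun F => ((hμ.1 F).const_smul (‖c‖ : ℂ)).congr fun s => ?_,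
      fun F => ((hμ.2 F).const_smul (‖c‖ : ℂ)).congr fun s => ?_⟩
    · change (‖c‖ : ℂ) • F _ = _
      rw [← map_smul]
      exact congrArg F (congrArg (fun T => T (delta s)) (map_smul convL _ _)).symm
    · change (‖c‖ : ℂ) • F _ = _
      rw [← map_smul]
      exact congrArg F (map_smul (convL (delta s)) _ _).symm

variable {S}

/-- `M_a(S)` is a left ideal of `M(S)`. -/
lemma conv_mem_Ma (μ : M S) {ν : M S} (hν : ν ∈ Ma S) : conv μ ν ∈ Ma S := by
  obtain ⟨h1, h2⟩ := hν
  rw [weaklyContinuous_iff] at h1 h2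
  have hR : RightCont ν.1.variation := h1
  have hL : LeftCont ν.1.variation := h2
  refine ⟨(weaklyContinuous_iff _).2 ?_, (weaklyContinuous_iff _).2 ?_⟩
  · exact RightCont.of_le (m := posConv μ.1.variation ν.1.variation) hR.conv
      (variation_convMeasure_le μ ν)
  · exact LeftCont.of_le (m := posConv μ.1.variation ν.1.variation) hL.conv
      (variation_convMeasure_le μ ν)

end AbsolutelyContinuous

section Associativity
variable [LocallyCompactSpace S]

lemma signed_mem_span (s : SignedMeasure S) (m : Measure S) [IsFiniteMeasure m] [m.Regular]
    (h : s.variation ≤ m) : ∃ (a b : Measure S) (_ : IsFiniteMeasure a) (_ : a.Regular)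
      (_ : IsFiniteMeasure b) (_ : b.Regular), ∀ E, MeasurableSet E →
        ((s E : ℝ) : ℂ) = (ofM a - ofM b).1 E := by
  set j := s.toJordanDecomposition
  have hj : j.posPart + j.negPart ≤ m := by
    rw [← SignedMeasure.totalVariation_eq_variation] at h
    exact h
  have h1 : j.posPart.Regular := regular_of_le (le_trans (Measure.le_add_right le_rfl) hj)
  have h2 : j.negPart.Regular := regular_of_le (le_trans (Measure.le_add_left le_rfl) hj)
  refine ⟨j.posPart, j.negPart, inferInstance, h1, inferInstance, h2, fun E hE => ?_⟩
  conv_lhs => rw [← s.toSignedMeasure_toJordanDecomposition]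
  rw [JordanDecomposition.toSignedMeasure, Measure.toSignedMeasure_sub_apply hE,
    Submodule.coe_sub, sub_apply, ofM_apply _ hE, ofM_apply _ hE,
    Complex.ofReal_sub]

/-- Every measure in `M(S)` is a linear combination of positive ones. -/
lemma induction_pos {P : M S → Prop}
    (hpos : ∀ (m : Measure S) [IsFiniteMeasure m] [m.Regular], P (ofM m))
    (hadd : ∀ μ ν, P μ → P ν → P (μ + ν)) (hsmul : ∀ (c : ℂ) μ, P μ → P (c • μ)) (μ : M S) :
    P μ := by
  have h1 : (ComplexMeasure.re μ.1).variation ≤ μ.1.variation := by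
    refine VectorMeasure.variation_le_of_forall_enorm_le fun A _ => ?_
    refine le_trans ?_ (VectorMeasure.enorm_measure_le_variation μ.1 A)
    rw [← ofReal_norm, ← ofReal_norm]
    exact ENNReal.ofReal_le_ofReal (Complex.abs_re_le_norm (μ.1 A))
  have h2 : (ComplexMeasure.im μ.1).variation ≤ μ.1.variation := by
    refine VectorMeasure.variation_le_of_forall_enorm_le fun A _ => ?_
    refine le_trans ?_ (VectorMeasure.enorm_measure_le_variation μ.1 A)
    rw [← ofReal_norm, ← ofReal_norm]
    exact ENNReal.ofReal_le_ofReal (Complex.abs_im_le_norm (μ.1 A))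
  obtain ⟨a, b, _, _, _, _, hab⟩ := signed_mem_span _ _ h1
  obtain ⟨c, d, _, _, _, _, hcd⟩ := signed_mem_span _ _ h2
  have hsub : ∀ μ ν, P μ → P ν → P (μ - ν) := fun μ ν hμ hν => by
    have := hadd _ _ hμ (hsmul (-1) _ hν)
    rwa [neg_one_smul, ← sub_eq_add_neg] at this
  have : μ = (ofM a - ofM b) + Complex.I • (ofM c - ofM d) := by
    refine Subtype.ext (VectorMeasure.ext fun E hE => ?_)
    rw [Submodule.coe_add, add_apply, Submodule.coe_smul, smul_apply,
      ← hab E hE, ← hcd E hE, smul_eq_mul, mul_comm]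
    exact (Complex.re_add_im _).symm
  rw [this]
  exact hadd _ _ (hsub _ _ (hpos a) (hpos b)) (hsmul _ _ (hsub _ _ (hpos c) (hpos d)))

variable [Semigroup S] [ContinuousMul S]

lemma add_conv (μ ν ρ : M S) : conv (μ + ν) ρ = conv μ ρ + conv ν ρ :=
  congrArg (fun T => T ρ) (map_add convL μ ν)

lemma conv_add (μ ν ρ : M S) : conv ρ (μ + ν) = conv ρ μ + conv ρ ν := map_add (convL ρ) μ ν

lemma smul_conv (c : ℂ) (μ ρ : M S) : conv (c • μ) ρ = c • conv μ ρ :=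
  congrArg (fun T => T ρ) (map_smul convL c μ)

lemma conv_smul (c : ℂ) (μ ρ : M S) : conv ρ (c • μ) = c • conv ρ μ := map_smul (convL ρ) c μ

lemma conv_assoc (μ ν ρ : M S) : conv (conv μ ν) ρ = conv μ (conv ν ρ) := by
  refine induction_pos (P := fun μ => conv (conv μ ν) ρ = conv μ (conv ν ρ)) (fun a _ _ => ?_)
    (fun μ μ' h h' => by simp only [add_conv, h, h'])
    (fun c μ h => by simp only [smul_conv, h]) μ
  refine induction_pos (P := fun ν => conv (conv _ ν) ρ = conv _ (conv ν ρ)) (fun b _ _ => ?_)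
    (fun μ μ' h h' => by simp only [add_conv, conv_add, h, h'])
    (fun c μ h => by simp only [smul_conv, conv_smul, h]) ν
  exact induction_pos (P := fun ρ => conv (conv _ _) ρ = conv _ (conv _ ρ))
    (fun c _ _ => conv_assoc_pos a b c)
    (fun μ μ' h h' => by simp only [conv_add, h, h'])
    (fun c μ h => by simp only [conv_smul, h]) ρ

lemma conv_univ (μ ν : M S) : (conv μ ν).1 univ = μ.1 univ * ν.1 univ := by
  change convMeasure μ ν univ = _
  rw [convMeasure_apply _ _ .univ]
  refine induction_pos (P := fun ν => cint ν.1 (fun y => μ.1 ((· * y) ⁻¹' univ)) =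
    μ.1 univ * ν.1 univ) (fun n _ _ => ?_) (fun ν ν' h h' => ?_) (fun c ν h => ?_) ν
  · simp only [preimage_univ]
    rw [cint_ofM _ (integrable_const _), ofM_apply _ .univ]
    simp [mul_comm]
  · simp only [preimage_univ] at *
    rw [Submodule.coe_add, cint_measure_add _ _ (integrable_const _) (integrable_const _), h, h',
      add_apply, mul_add]
  · simp only [preimage_univ] at *
    rw [Submodule.coe_smul, cint_measure_smul _ _ (integrable_const _), h, smul_apply,
      smul_eq_mul]
    ring

end Associativity

section Functionals
variable (S)

/-- The functional `1` on `M(S)`: `⟨1, μ⟩ = μ(S)`. -/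
def oneM : StrongDual ℂ (M S) :=
  LinearMap.mkContinuous
    { toFun := fun μ => μ.1 univ
      map_add' := fun μ ν => by simp
      map_smul' := fun c μ => by simp } 1 fun μ => by
    have := ENNReal.toReal_mono (by finiteness) (VectorMeasure.enorm_measure_le_variation μ.1 univ)
    simpa [norm_def, Measure.real] using this

/-- `M_0(S)`: the regular Borel probability measures on `S`. -/
def M₀ := {m : Measure S // IsProbabilityMeasure m ∧ m.Regular}

variable {S}

instance (m : M₀ S) : IsProbabilityMeasure m.1 := m.2.1
instance (m : M₀ S) : m.1.Regular := m.2.2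

/-- A probability measure as an element of `M(S)`. -/
def M₀.toM (m : M₀ S) : M S := ofM m.1

/-- Positivity of a measure in `M(S)`. -/
def IsPositive (μ : M S) : Prop := ∃ (m : Measure S) (_ : IsFiniteMeasure m) (_ : m.Regular),
  μ = ofM m

variable [LocallyCompactSpace S] [Semigroup S] [ContinuousMul S]

/-- `μ f ∈ M(S)^*`, where `⟨μ f, ν⟩ = ⟨f, ν * μ⟩`. -/
def leftAct (μ : M S) (f : StrongDual ℂ (M S)) : StrongDual ℂ (M S) := f ∘L convL.flip μ

/-- `f ≥ 0` in `M(S)^*`: `⟨f, μ⟩ ≥ 0` for all positive measures `μ`. -/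
def DualNonneg (f : StrongDual ℂ (M S)) : Prop :=
  ∀ μ : M S, IsPositive μ → ∃ r : ℝ, 0 ≤ r ∧ f μ = r

variable (S) in
/-- `M` is a topologically right invariant mean on `M(S)^*`. -/
structure IsTopRightInvariantMean (m : StrongDual ℂ (StrongDual ℂ (M S))) : Prop where
  nonneg : ∀ f, DualNonneg f → ∃ r : ℝ, 0 ≤ r ∧ m f = r
  one : m (oneM S) = 1
  invariant : ∀ (μ : M₀ S) (f : StrongDual ℂ (M S)), m (leftAct μ.toM f) = m f

variable (S) in
/-- `S` is a foundation semigroup: the supports of the measures in `M_a(S)` have dense union. -/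
def IsFoundation : Prop := Dense (⋃ μ ∈ Ma S, μ.1.variation.support)

/-- The net `(μ_α)` in `M_0(S)` is asymptotically `M_0(S)`-invariant. -/
def AsympInvariant {ι : Type*} [Preorder ι] (μ : ι → M₀ S) : Prop :=
  ∀ ν : M₀ S, Tendsto (fun α => ‖conv ν.toM (μ α).toM - (μ α).toM‖) atTop (𝓝 0)

variable (S) in
/-- The dual space `M_a(S)^*`. -/
abbrev MaDual := StrongDual ℂ (Ma S)

instance : AddCommGroup (MaDual S) := NormedAddCommGroup.toAddCommGroup
instance : AddCommMonoid (MaDual S) := AddCommGroup.toAddCommMonoid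
instance : Module ℂ (MaDual S) := NormedSpace.toModule

variable (S) in
/-- The restriction to `M_a(S)` of the functional `1`. -/
def one : MaDual S := oneM S ∘L (Ma S).subtypeL

/-- `f μ ∈ M_a(S)^*` for `f ∈ M_a(S)^*` and `μ ∈ M(S)`, where `⟨f μ, ν⟩ = ⟨f, μ * ν⟩`. -/
def act (f : MaDual S) (μ : M S) : MaDual S :=
  f ∘L ((convL μ ∘L (Ma S).subtypeL).codRestrict (Ma S) fun ν => conv_mem_Ma μ ν.2)

/-- `f s ∈ M_a(S)^*`, where `⟨f s, ν⟩ = ⟨f, δ_s * ν⟩`. -/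
def translate (f : MaDual S) (s : S) : MaDual S := act f (delta s)

lemma act_apply (f : MaDual S) (μ : M S) (ν : Ma S) :
    act f μ ν = f ⟨conv μ ν, conv_mem_Ma μ ν.2⟩ := rfl

lemma act_act (f : MaDual S) (μ ν : M S) : act (act f μ) ν = act f (conv μ ν) := by
  ext ρ
  simp only [act_apply, conv_assoc]

/-- The set of all `f μ` with `μ` in the closed unit ball of `M_a(S)`. -/
def orbit (f : MaDual S) : Set (MaDual S) := {g | ∃ μ ∈ Ma S, ‖μ‖ ≤ 1 ∧ g = act f μ}

/-- A subset of a Banach space is relatively weakly compact. -/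
def RelWeaklyCompact {X : Type*} [NormedAddCommGroup X] [NormedSpace ℂ X] (A : Set X) : Prop :=
  IsCompact (closure (toWeakSpace ℂ X '' A))

lemma weakSpace_t2 (X : Type*) [NormedAddCommGroup X] [NormedSpace ℂ X] :
    T2Space (WeakSpace ℂ X) := by
  refine (WeakBilin.isEmbedding (B := (topDualPairing ℂ X).flip) ?_).t2Space
  intro x y h
  exact (SeparatingDual.eq_iff_forall_dual_eq (R := ℂ)).2 fun g => congrArg (fun T => T g) h

lemma RelWeaklyCompact.of_subset {X : Type*} [NormedAddCommGroup X] [NormedSpace ℂ X]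
    {A : Set X} {K : Set (WeakSpace ℂ X)} (hK : IsCompact K)
    (h : ∀ x ∈ A, toWeakSpace ℂ X x ∈ K) : RelWeaklyCompact A := by
  have := weakSpace_t2 X
  exact hK.of_isClosed_subset isClosed_closure
    (closure_minimal (image_subset_iff.2 h) hK.isClosed)

variable (S) in
/-- `wap(M_a(S))`: the weakly almost periodic functionals on `M_a(S)`. -/
def wap : Submodule ℂ (MaDual S) where
  carrier := {f | RelWeaklyCompact (orbit f)}
  add_mem' := by
    intro f g hf hg
    refine RelWeaklyCompact.of_subset (IsCompact.add hf hg) ?_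
    rintro _ ⟨μ, hμ, h1, rfl⟩
    exact ⟨_, subset_closure (mem_image_of_mem _ ⟨μ, hμ, h1, rfl⟩), _,
      subset_closure (mem_image_of_mem _ ⟨μ, hμ, h1, rfl⟩), rfl⟩
  zero_mem' := by
    refine RelWeaklyCompact.of_subset (isCompact_singleton (x := 0)) ?_
    rintro _ ⟨μ, hμ, h1, rfl⟩
    rfl
  smul_mem' := by
    intro c f hf
    refine RelWeaklyCompact.of_subset (IsCompact.image hf (continuous_const_smul c)) ?_
    rintro _ ⟨μ, hμ, h1, rfl⟩
    exact ⟨_, subset_closure ⟨_, ⟨μ, hμ, h1, rfl⟩, rfl⟩, rfl⟩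

lemma act_mem_wap {f : MaDual S} (hf : f ∈ wap S) (μ : M S) : act f μ ∈ wap S := by
  refine RelWeaklyCompact.of_subset
    (IsCompact.image hf (continuous_const_smul ((‖μ‖ : ℂ)))) ?_
  rintro _ ⟨ν, hν, h1, rfl⟩
  by_cases h0 : ‖μ‖ = 0
  · have hz : μ = 0 := norm_eq_zero.1 h0
    refine ⟨_, subset_closure ⟨_, ⟨ν, hν, h1, rfl⟩, rfl⟩, ?_⟩
    have : conv (0 : M S) ν = 0 := congrArg (fun T => T ν) (map_zero (convL (S := S)))
    rw [act_act, hz, this]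
    have h2 : act f (0 : M S) = 0 := by
      ext ρ
      have : (⟨conv 0 ρ, conv_mem_Ma 0 ρ.2⟩ : Ma S) = 0 :=
        Subtype.ext (congrArg (fun T => T ρ.1) (map_zero (convL (S := S))))
      rw [act_apply, this, map_zero]
      rfl
    rw [h2]
    simp
  · have hc : (‖μ‖ : ℂ) ≠ 0 := by exact_mod_cast h0
    refine ⟨_, subset_closure ⟨_, ⟨(‖μ‖ : ℂ)⁻¹ • conv μ ν,
      (Ma S).smul_mem _ (conv_mem_Ma μ hν), ?_, rfl⟩, rfl⟩, ?_⟩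
    · rw [norm_smul, norm_inv, Complex.norm_real, norm_norm]
      refine (mul_le_mul_of_nonneg_left (norm_conv_le μ ν) (by positivity)).trans ?_
      rw [← mul_assoc, inv_mul_cancel₀ h0, one_mul]
      exact h1
    · rw [act_act]
      change toWeakSpace ℂ _ ((‖μ‖ : ℂ) • act f _) = _
      congr 1
      ext ρ
      have : (⟨conv ((‖μ‖ : ℂ)⁻¹ • conv μ ν) ρ, conv_mem_Ma _ ρ.2⟩ : Ma S) =
          (‖μ‖ : ℂ)⁻¹ • ⟨conv (conv μ ν) ρ, conv_mem_Ma _ ρ.2⟩ :=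
        Subtype.ext (smul_conv _ _ _)
      rw [smul_apply, act_apply, this, map_smul, smul_smul, mul_inv_cancel₀ hc, one_smul]
      rfl

lemma act_one (μ : M S) : act (one S) μ = μ.1 univ • one S := by
  ext ν
  exact conv_univ μ ν

lemma one_mem_wap : one S ∈ wap S := by
  refine RelWeaklyCompact.of_subset (K := (fun c : ℂ => toWeakSpace ℂ _ (c • one S)) ''
    Metric.closedBall 0 1) (IsCompact.image (isCompact_closedBall _ _) ?_) ?_
  · exact (toWeakSpaceCLM ℂ (MaDual S)).continuous.comp (by fun_prop)
  · rintro _ ⟨ν, hν, h1, rfl⟩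
    refine ⟨ν.1 univ, ?_, by rw [act_one]⟩
    rw [mem_closedBall_zero_iff]
    refine le_trans ?_ h1
    have := ENNReal.toReal_mono (by finiteness) (variation_mem ν univ)
    simpa [norm_def, Measure.real] using this

variable (S) in
/-- `M` is a topologically left invariant mean on `wap(M_a(S))`. -/
structure IsTopLeftInvariantMean (m : StrongDual ℂ (wap S)) : Prop where
  nonneg : ∀ f : wap S, (∀ μ : Ma S, IsPositive (μ : M S) → ∃ r : ℝ, 0 ≤ r ∧ f.1 μ = r) →
    ∃ r : ℝ, 0 ≤ r ∧ m f = r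
  one : m ⟨one S, one_mem_wap⟩ = 1
  invariant : ∀ (μ : M₀ S) (f : wap S), m ⟨act f.1 μ.toM, act_mem_wap f.2 _⟩ = m f

/-- The average `∫ f s dμ(s)`, a Bochner integral in `M_a(S)^*`. -/
def average (μ : M₀ S) (f : MaDual S) : MaDual S := ∫ s, translate f s ∂μ.1

variable (S) in
/-- `Y`: the functionals `f ∈ wap(M_a(S))` with `f s = f` for all `s ∈ S`. -/
def fixedSpace : Set (MaDual S) := {f | f ∈ wap S ∧ ∀ s : S, translate f s = f}

variable (S) in
/-- `Z`: the closed linear span of the functionals `f - f s`, `f ∈ wap(M_a(S))`, `s ∈ S`. -/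
def coboundarySpace : Submodule ℂ (MaDual S) :=
  (Submodule.span ℂ {g | ∃ f ∈ wap S, ∃ s : S, g = f - translate f s}).topologicalClosure

end Functionals

end SemigroupMeasure

end

universe u v w

open SemigroupMeasure

/-! The engine is a mean ergodic argument. From the invariant mean m on M(S)^* build `meanAct m f`,
the functional ν ↦ m(ρ ↦ ⟨f, ρ * ν⟩). Right invariance of m makes it a fixed point of every
probability measure (`act_meanAct`). A priori it is only a weak* limit of the functionals f ρ. For f
in `wap S`, however, the set of all f ρ is convex and relatively weakly compact, so its norm closure
is already weak* closed (`mem_closure_of_forall_re_le`), and `meanAct m f` is a norm limit of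
functionals f ρ (`IsFoundation.meanAct_mem_closure`). If f ρ is close to f' = `meanAct m f`, then f
(ρ * μ_α) = (f ρ) μ_α is as close to f' μ_α = f', while f (ρ * μ_α) - f μ_α tends to 0. Hence f μ_α
→ f' for every asymptotically invariant net (`IsFoundation.tendsto_act`).

Two points must be settled first. The orbit in the definition of `wap` uses only measures in M_a(S),
whereas ρ and μ_α are arbitrary probability measures. Since S is a foundation semigroup, M_a(S) has
probability measures concentrated near the identity, and μ * e with such e lies in M_a(S) and
approximates μ weak* (`IsFoundation.re_act_le`). The average must also be a Bochner integral equal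
to f μ_α. Here f is a norm limit of functionals f e with e in M_a(S), and s ↦ (f e) s = f (e * δ_s)
is strongly measurable because s ↦ e * δ_s is (`RightCont.aestronglyMeasurable`). That last fact
rests on Pettis's theorem: almost all e * δ_s lie in a separable space, found from a jointly
measurable density.

A translation invariant g is constant: if G extends g, then G(σ * ρ) = σ(S) g(ρ) for ρ in M_a(S), so
applying m gives g(ρ) = m(G) for every probability measure ρ in M_a(S) (`exists_eq_smul_one`). So f'
= c 1. Any invariant mean p is constant on the f ρ and continuous, which forces c = p(f)
(`IsFoundation.smul_one_eq_meanAct`); this is uniqueness. Existence comes from evaluating f' at a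
probability measure in M_a(S). Finally f - f μ_α = ∫ (f - f s) dμ_α(s) lies in Z and tends to f -
p(f) 1, so the kernel of p is contained in Z; the reverse inclusion is invariance under point
masses. -/

noncomputable section
namespace SemigroupMeasure

/-! ### Weak compactness in dual spaces -/

section WeakTopology

/-- A point of a dual space that cannot be separated from a convex relatively weakly compact set
by an element of the predual lies in the norm closure of that set. -/
lemma mem_closure_of_forall_re_le {E : Type*} [NormedAddCommGroup E] [NormedSpace ℂ E]
    {A : Set (StrongDual ℂ E)} (hA : Convex ℝ A) (hc : RelWeaklyCompact A) {x : StrongDual ℂ E}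
    (h : ∀ (v : E) (c : ℝ), (∀ a ∈ A, (a v).re ≤ c) → (x v).re ≤ c) : x ∈ closure A := by
  by_contra hx
  -- `j` is the identity from the weak to the weak* topology of the dual. It is continuous because
  -- evaluation at a vector of `E` is one of the functionals in the bidual.
  let j : WeakSpace ℂ (StrongDual ℂ E) →ₗ[ℂ] WeakBilin (topDualPairing ℂ E) :=
    LinearMap.id (M := StrongDual ℂ E)
  have hj : Continuous j := WeakBilin.continuous_of_continuous_eval _ fun v =>
    WeakBilin.eval_continuous (topDualPairing ℂ (StrongDual ℂ E)).flip
      (NormedSpace.inclusionInDoubleDual ℂ E v)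
  have hT2 : T2Space (WeakBilin (topDualPairing ℂ E)) :=
    inferInstanceAs (T2Space (WeakDual ℂ E))
  -- Mazur: for a convex set the weak and norm closures agree. So the norm closure is weakly
  -- compact, its image under `j` is weak* compact, and therefore weak* closed.
  have hcl : closure (toWeakSpace ℂ (StrongDual ℂ E) '' A) =
      toWeakSpace ℂ (StrongDual ℂ E) '' closure A := (hA.toWeakSpace_closure ℂ).symm
  have hK : IsCompact (j '' (toWeakSpace ℂ (StrongDual ℂ E) '' closure A)) := by
    rw [← hcl]
    exact IsCompact.image hc hj
  have hconv : Convex ℝ (j '' (toWeakSpace ℂ (StrongDual ℂ E) '' closure A)) := by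
    refine Convex.is_linear_image (Convex.is_linear_image hA.closure ?_) ?_
    · exact ⟨fun _ _ => rfl, fun _ _ => rfl⟩
    · exact ⟨fun _ _ => rfl, fun _ _ => rfl⟩
  have hxK : j (toWeakSpace ℂ (StrongDual ℂ E) x) ∉
      j '' (toWeakSpace ℂ (StrongDual ℂ E) '' closure A) := by
    rintro ⟨_, ⟨y, hy, rfl⟩, hyx⟩
    have : y = x := hyx
    exact hx (this ▸ hy)
  obtain ⟨φ, u, hu, hux⟩ := RCLike.geometric_hahn_banach_closed_point (𝕜 := ℂ) hconv
    hK.isClosed hxK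
  -- The separating functional is weak* continuous, hence is evaluation at some `v` of the predual,
  -- to which `h` applies.
  obtain ⟨v, rfl⟩ := LinearMap.dualEmbedding_surjective (topDualPairing ℂ E) φ
  have h1 : (x v).re ≤ u := h v u fun a ha =>
    (hu _ ⟨_, ⟨a, subset_closure ha, rfl⟩, rfl⟩).le
  exact absurd hux (not_lt.2 h1)

lemma tendsto_toWeakSpace_iff {X ι : Type*} [NormedAddCommGroup X] [NormedSpace ℂ X]
    {l : Filter ι} {g : ι → X} {x : X} :
    Tendsto (fun i => toWeakSpace ℂ X (g i)) l (𝓝 (toWeakSpace ℂ X x)) ↔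
      ∀ F : StrongDual ℂ X, Tendsto (fun i => F (g i)) l (𝓝 (F x)) := by
  refine (WeakBilin.tendsto_iff_forall_eval_tendsto (topDualPairing ℂ X).flip ?_).trans Iff.rfl
  intro x y h
  exact (SeparatingDual.eq_iff_forall_dual_eq (R := ℂ)).2 fun g => congrArg (fun T => T g) h

/-- A family all of whose ultrafilter limits exist weakly is relatively weakly compact. -/
lemma relWeaklyCompact_range_of_ultrafilter {X ι : Type*} [NormedAddCommGroup X]
    [NormedSpace ℂ X] (g : ι → X) (h : ∀ U : Ultrafilter ι, ∃ x : X, ∀ F : StrongDual ℂ X,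
      Tendsto (fun i => F (g i)) U (𝓝 (F x))) : RelWeaklyCompact (range g) := by
  have := weakSpace_t2 X
  -- For discrete `ι` the ultrafilters form the Stone–Čech compactification. The assumed limits are
  -- exactly what is needed to extend the family continuously, and the compact image of the
  -- extension contains the range.
  let _ : TopologicalSpace ι := ⊥
  have hd : DiscreteTopology ι := ⟨rfl⟩
  let G : ι → WeakSpace ℂ X := fun i => toWeakSpace ℂ X (g i)
  have hcont : Continuous (isDenseInducing_pure.extend G) := by
    refine isDenseInducing_pure.continuous_extend fun U => ?_
    obtain ⟨x, hx⟩ := h U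
    exact ⟨toWeakSpace ℂ X x, (tendsto_toWeakSpace_iff.2 hx).mono_left
      (ultrafilter_comap_pure_nhds U)⟩
  refine RelWeaklyCompact.of_subset (isCompact_range hcont) ?_
  rintro _ ⟨i, rfl⟩
  exact ⟨pure i, isDenseInducing_pure.extend_eq continuous_of_discreteTopology i⟩

/-- Relative weak compactness is stable under uniform limits of families. -/
lemma relWeaklyCompact_range_of_uniform_limit {X ι : Type*} [NormedAddCommGroup X]
    [NormedSpace ℂ X] [CompleteSpace X] (g : ι → X)
    (h : ∀ ε > 0, ∃ g' : ι → X, RelWeaklyCompact (range g') ∧ ∀ i, ‖g i - g' i‖ ≤ ε) :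
    RelWeaklyCompact (range g) := by
  refine relWeaklyCompact_range_of_ultrafilter g fun U => ?_
  have hε : ∀ n : ℕ, (0 : ℝ) < 1 / (n + 1) := fun n => by positivity
  choose g' hg' hgg' using fun n : ℕ => h _ (hε n)
  have hlim : ∀ n, ∃ x : X, ∀ F : StrongDual ℂ X,
      Tendsto (fun i => F (g' n i)) U (𝓝 (F x)) := by
    intro n
    have hc : IsCompact (closure (toWeakSpace ℂ X '' range (g' n))) := hg' n
    obtain ⟨x, -, hx⟩ := hc.ultrafilter_le_nhds (U.map fun i => toWeakSpace ℂ X (g' n i))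
      (le_principal_iff.2 (Filter.mem_map.2 (Eventually.of_forall fun i =>
        subset_closure (mem_image_of_mem _ (mem_range_self i)))))
    exact ⟨(toWeakSpace ℂ X).symm x, tendsto_toWeakSpace_iff.1 hx⟩
  choose x hx using hlim
  -- The norm is weakly lower semicontinuous, so the uniform distance between two approximating
  -- families bounds the distance of their weak limits. Hence these limits form a Cauchy sequence.
  have hdist : ∀ n k, ‖x n - x k‖ ≤ 1 / (n + 1) + 1 / (k + 1) := by
    intro n k
    refine NormedSpace.norm_le_dual_bound ℂ _ (by positivity) fun F => ?_
    have h1 : Tendsto (fun i => ‖F (g' n i - g' k i)‖) U (𝓝 ‖F (x n - x k)‖) := by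
      simp only [map_sub]
      exact ((hx n F).sub (hx k F)).norm
    refine le_of_tendsto h1 (Eventually.of_forall fun i => ?_)
    refine (F.le_opNorm _).trans ?_
    rw [mul_comm]
    gcongr
    calc ‖g' n i - g' k i‖ = ‖(g i - g' k i) - (g i - g' n i)‖ := by congr 1; abel
      _ ≤ ‖g i - g' k i‖ + ‖g i - g' n i‖ := norm_sub_le _ _
      _ ≤ _ := by linarith [hgg' n i, hgg' k i]
  have hcauchy : CauchySeq x := by
    refine Metric.cauchySeq_iff'.2 fun ε hε' => ?_
    obtain ⟨N, hN⟩ := exists_nat_one_div_lt (half_pos hε')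
    refine ⟨N, fun n hn => ?_⟩
    rw [dist_eq_norm]
    have : (1 : ℝ) / (n + 1) ≤ 1 / (N + 1) := Nat.one_div_le_one_div hn
    linarith [hdist n N]
  obtain ⟨y, hy⟩ := cauchySeq_tendsto_of_complete hcauchy
  refine ⟨y, fun F => ?_⟩
  -- Uniformity in `i` permits exchanging the limit in `n` with the limit along `U`.
  have hunif : TendstoUniformly (fun n i => F (g' n i)) (fun i => F (g i)) atTop := by
    rw [Metric.tendstoUniformly_iff]
    intro ε hε'
    have ht : Tendsto (fun n : ℕ => ‖F‖ * (1 / ((n : ℝ) + 1))) atTop (𝓝 0) := by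
      simpa using tendsto_one_div_add_atTop_nhds_zero_nat.const_mul ‖F‖
    filter_upwards [ht.eventually_lt_const hε'] with n hn i
    rw [dist_eq_norm, ← map_sub]
    exact ((F.le_opNorm _).trans (mul_le_mul_of_nonneg_left (hgg' n i) (norm_nonneg _))).trans_lt hn
  exact (hunif.tendstoUniformlyOnFilter.mono_right le_top).tendsto_of_eventually_tendsto
    (Eventually.of_forall fun n => hx n F) ((F.continuous.tendsto y).comp hy)

end WeakTopology

/-! ### Pettis's measurability theorem -/

section Pettis
variable {α X : Type*} [MeasurableSpace α] [NormedAddCommGroup X] [NormedSpace ℂ X]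

/-- Scalarly measurable functions with separable range are strongly measurable. -/
lemma stronglyMeasurable_of_dual {g : α → X} {t : Set X} (ht : TopologicalSpace.IsSeparable t)
    (hgt : ∀ s, g s ∈ t) (hg : ∀ F : StrongDual ℂ X, Measurable fun s => F (g s)) :
    StronglyMeasurable g := by
  borelize X
  -- The span is taken because the differences `g s - y` must also be approximated by a countable
  -- set.
  have hsep : TopologicalSpace.IsSeparable (Submodule.span ℂ t : Set X) := ht.span
  obtain ⟨D, hDc, hD⟩ := hsep
  have : Countable D := hDc
  choose Φ hΦ1 hΦ using fun d : D => exists_dual_vector'' ℂ (d : X)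
  -- Norming functionals for a countable dense set recover the norm as a countable supremum, so that
  -- distances `‖g s - y‖` are measurable from the scalar hypothesis. The distance from `y` to `d`
  -- is lost twice, once in `y` and once in `Φ d y`, whence `ε / 2`.
  have hnorm : ∀ y ∈ closure D, ‖y‖ₑ = ⨆ d : D, ‖Φ d y‖ₑ := by
    intro y hy
    refine le_antisymm ?_ (iSup_le fun d => ?_)
    · refine ENNReal.le_of_forall_pos_le_add fun ε hε _ => ?_
      obtain ⟨d, hd, hdy⟩ := Metric.mem_closure_iff.1 hy (ε / 2) (by positivity)
      have h1 : ‖y‖ ≤ ‖Φ ⟨d, hd⟩ y‖ + ε := by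
        have h2 : ‖Φ ⟨d, hd⟩ (y - d)‖ ≤ ‖y - d‖ := by
          simpa using (Φ ⟨d, hd⟩).le_of_opNorm_le (hΦ1 _) (y - d)
        have h3 : ‖Φ ⟨d, hd⟩ d‖ = ‖d‖ := by rw [hΦ]; simp
        have h4 : ‖Φ ⟨d, hd⟩ d‖ ≤ ‖Φ ⟨d, hd⟩ y‖ + ‖Φ ⟨d, hd⟩ (y - d)‖ := by
          rw [map_sub]
          calc ‖Φ ⟨d, hd⟩ d‖ = ‖Φ ⟨d, hd⟩ y - (Φ ⟨d, hd⟩ y - Φ ⟨d, hd⟩ d)‖ := by congr 1; abel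
            _ ≤ _ := norm_sub_le _ _
        have h5 : ‖y‖ ≤ ‖d‖ + ‖y - d‖ := by
          calc ‖y‖ = ‖d + (y - d)‖ := by congr 1; abel
            _ ≤ _ := norm_add_le _ _
        rw [dist_eq_norm] at hdy
        linarith
      refine le_trans ?_ (add_le_add_left (le_iSup (fun d : D => ‖Φ d y‖ₑ) ⟨d, hd⟩) _)
      rw [← ofReal_norm, ← ofReal_norm, ← ENNReal.ofReal_coe_nnreal,
        ← ENNReal.ofReal_add (norm_nonneg _) (NNReal.coe_nonneg ε)]
      exact ENNReal.ofReal_le_ofReal h1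
    · rw [← ofReal_norm, ← ofReal_norm]
      exact ENNReal.ofReal_le_ofReal (by simpa using (Φ d).le_of_opNorm_le (hΦ1 d) y)
  have hDspan : ∀ y ∈ Submodule.span ℂ t, ∀ s, g s - y ∈ closure D := fun y hy s =>
    hD ((Submodule.span ℂ t).sub_mem (Submodule.subset_span (hgt s)) hy)
  obtain ⟨E, hEt, hEc, hE⟩ := ht.exists_countable_dense_subset
  have hmeasball : ∀ y ∈ t, ∀ r : ℝ, MeasurableSet (g ⁻¹' Metric.ball y r) := by
    intro y hy r
    have : Measurable fun s => ‖g s - y‖ₑ := by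
      have e : (fun s => ‖g s - y‖ₑ) = fun s => ⨆ d : D, ‖Φ d (g s - y)‖ₑ :=
        funext fun s => hnorm _ (hDspan y (Submodule.subset_span hy) s)
      rw [e]
      refine Measurable.iSup fun d => ?_
      simp only [map_sub]
      exact ((hg (Φ d)).sub_const _).enorm
    have h2 : g ⁻¹' Metric.ball y r = (fun s => (‖g s - y‖ₑ).toReal) ⁻¹' Iio r := by
      ext s
      simp [dist_eq_norm]
    rw [h2]
    exact this.ennreal_toReal measurableSet_Iio
  refine stronglyMeasurable_iff_measurable_separable.2 ⟨measurable_of_isOpen fun U hU => ?_,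
    ht.mono (range_subset_iff.2 hgt)⟩
  have hUeq : g ⁻¹' U = ⋃ d ∈ E, ⋃ q ∈ {q : ℚ | Metric.ball d (q : ℝ) ⊆ U},
      g ⁻¹' Metric.ball d (q : ℝ) := by
    ext s
    simp only [mem_preimage, mem_iUnion, mem_ofPred_eq, exists_prop]
    constructor
    · intro hs
      obtain ⟨ε, hε, hball⟩ := Metric.isOpen_iff.1 hU _ hs
      obtain ⟨q, hq0, hqε⟩ := exists_rat_btwn (half_pos hε)
      obtain ⟨d, hd, hds⟩ := Metric.mem_closure_iff.1 (hE (hgt s)) q (by exact_mod_cast hq0)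
      refine ⟨d, hd, q, fun z hz => hball ?_, by simpa using hds⟩
      rw [Metric.mem_ball] at hz ⊢
      calc dist z (g s) ≤ dist z d + dist (g s) d := dist_triangle_right _ _ _
        _ < ε := by linarith
    · rintro ⟨d, hd, q, hq, hs⟩
      exact hq hs
  rw [hUeq]
  exact MeasurableSet.biUnion hEc fun d hd => MeasurableSet.biUnion (to_countable _)
    fun q _ => hmeasball d (hEt hd) q

lemma aestronglyMeasurable_of_dual {μ : Measure α} {g : α → X} {t : Set X}
    (ht : TopologicalSpace.IsSeparable t) (hgt : ∀ᵐ s ∂μ, g s ∈ t)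
    (hg : ∀ F : StrongDual ℂ X, Measurable fun s => F (g s)) : AEStronglyMeasurable g μ := by
  classical
  -- The exceptional set need not be measurable. It is enlarged to a measurable null set on which
  -- `g` is replaced by 0, so 0 is added to the separable set.
  set T := toMeasurable μ {s | ¬ g s ∈ t} with hT
  have hT0 : μ T = 0 := (measure_toMeasurable _).trans (ae_iff.1 hgt)
  refine ⟨Tᶜ.indicator g, stronglyMeasurable_of_dual (t := insert 0 t)
    ((finite_singleton 0).isSeparable.union ht) (fun s => ?_) (fun F => ?_), ?_⟩
  · by_cases hs : s ∈ T
    · simp [hs]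
    · have : g s ∈ t := by
        by_contra h
        exact hs (subset_toMeasurable μ _ h)
      simp [hs, this]
  · have : (fun s => F (Tᶜ.indicator g s)) = Tᶜ.indicator fun s => F (g s) := by
      ext s
      by_cases hs : s ∈ T <;> simp [hs]
    rw [this]
    exact (hg F).indicator (measurableSet_toMeasurable _ _).compl
  · filter_upwards [measure_eq_zero_iff_ae_notMem.1 hT0] with s hs
    simp [hs]

end Pettis

/-- A continuous functional that annihilates a closed subspace but not a point outside. -/
lemma exists_dual_eq_zero_of_notMem {X : Type*} [NormedAddCommGroup X] [NormedSpace ℂ X]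
    {p : Submodule ℂ X} (hp : IsClosed (p : Set X)) {x : X} (hx : x ∉ p) :
    ∃ F : StrongDual ℂ X, F x ≠ 0 ∧ ∀ y ∈ p, F y = 0 := by
  obtain ⟨F, u, hu, hux⟩ := RCLike.geometric_hahn_banach_closed_point (𝕜 := ℂ)
    (s := (p : Set X)) (p.restrictScalars ℝ).convex hp hx
  have hu0 : 0 < u := by simpa using hu 0 p.zero_mem
  refine ⟨F, fun h0 => ?_, fun y hy => ?_⟩
  · rw [h0, map_zero] at hux
    exact lt_asymm hu0 hux
  · by_contra hne
    -- The subspace contains a multiple of `y` on which `F` takes the value `u` exactly,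
    -- contradicting the strict bound.
    have := hu (((u : ℂ) / F y) • y) (p.smul_mem _ hy)
    rw [map_smul, smul_eq_mul, div_mul_cancel₀ _ hne] at this
    simp at this

/-! ### Sections of jointly measurable functions -/

section Sections
variable {X Y : Type*} [MeasurableSpace X] [MeasurableSpace Y]

/-- The sections of a set in the product `σ`-algebra are determined by countably many sets. -/
lemma exists_countable_sections (l : Measure Y) {E : Set (X × Y)}
    (hE : MeasurableSet E) : ∃ 𝓑 : Set (Set Y), 𝓑.Countable ∧ (∀ B ∈ 𝓑, MeasurableSet B) ∧
      ∀ h : Y → ℂ, Integrable h l → (∀ B ∈ 𝓑, ∫ y in B, h y ∂l = 0) →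
        ∀ x, ∫ y in Prod.mk x ⁻¹' E, h y ∂l = 0 := by
  -- Each step of the π-λ induction enlarges the family countably: a rectangle contributes its
  -- second factor, a complement the whole space (so that the total integral of `h` vanishes), a
  -- disjoint union the union of the families.
  induction E, hE using MeasurableSpace.induction_on_inter generateFrom_prod.symm
    isPiSystem_prod with
  | empty => exact ⟨∅, countable_empty, by simp, by simp⟩
  | basic U hU =>
    obtain ⟨A, hA, B, hB, rfl⟩ := hU
    refine ⟨{B}, countable_singleton B, by simpa using hB, fun h _ h0 x => ?_⟩
    by_cases hx : x ∈ A
    · rw [mk_preimage_prod_right hx]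
      exact h0 B rfl
    · rw [mk_preimage_prod_right_eq_empty hx]
      simp
  | compl E hE ih =>
    obtain ⟨𝓑, hc, hm, hs⟩ := ih
    refine ⟨insert univ 𝓑, hc.insert _, by simpa using hm, fun h hi h0 x => ?_⟩
    have h1 := hs h hi (fun B hB => h0 B (mem_insert_of_mem _ hB)) x
    have h2 := h0 univ (mem_insert _ _)
    have h3 := integral_add_compl (measurable_prodMk_left (x := x) hE) hi
    rw [setIntegral_univ] at h2
    rw [h1, h2, zero_add] at h3
    rwa [preimage_compl]
  | iUnion f hd hf ih =>
    choose 𝓑 hc hm hs using ih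
    refine ⟨⋃ i, 𝓑 i, countable_iUnion hc, fun B hB => ?_, fun h hi h0 x => ?_⟩
    · obtain ⟨i, hi⟩ := mem_iUnion.1 hB
      exact hm i B hi
    · rw [preimage_iUnion]
      have := hasSum_integral_iUnion (μ := l) (f := h)
        (fun i => measurable_prodMk_left (x := x) (hf i))
        (fun i j hij => (hd hij).preimage _) hi.integrableOn
      refine this.unique ?_
      simp only [hs _ h hi (fun B hB => h0 B (mem_iUnion.2 ⟨_, hB⟩)) x]
      exact hasSum_zero

/-- The sections of a measurable function on a product are determined by countably many sets. -/
lemma exists_countable_sections_fun (l : Measure Y) [IsFiniteMeasure l] {k : X × Y → ℝ≥0∞}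
    (hk : Measurable k) : ∃ 𝓑 : Set (Set Y), 𝓑.Countable ∧ (∀ B ∈ 𝓑, MeasurableSet B) ∧
      ∀ h : Y → ℂ, Measurable h → (∃ C, ∀ y, ‖h y‖ ≤ C) → (∀ B ∈ 𝓑, ∫ y in B, h y ∂l = 0) →
        ∀ x, ∫⁻ y, k (x, y) ∂l ≠ ∞ → ∫ y, ((k (x, y)).toReal : ℂ) * h y ∂l = 0 := by
  have hbdd : ∀ {k : X × Y → ℝ≥0∞} {h : Y → ℂ}, Measurable k → Measurable h →
      (∃ C, ∀ y, ‖h y‖ ≤ C) → ∀ x, ∫⁻ y, k (x, y) ∂l ≠ ∞ →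
      Integrable (fun y => ((k (x, y)).toReal : ℂ) * h y) l := by
    rintro k h hk hh ⟨C, hC⟩ x hx
    refine Integrable.mul_bdd (c := C) ?_ hh.aestronglyMeasurable (Eventually.of_forall hC)
    exact (integrable_toReal_of_lintegral_ne_top
      (hk.comp measurable_prodMk_left).aemeasurable hx).ofReal
  refine Measurable.ennreal_induction (motive := fun k => ∃ 𝓑 : Set (Set Y), 𝓑.Countable ∧
    (∀ B ∈ 𝓑, MeasurableSet B) ∧ ∀ h : Y → ℂ, Measurable h → (∃ C, ∀ y, ‖h y‖ ≤ C) →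
      (∀ B ∈ 𝓑, ∫ y in B, h y ∂l = 0) → ∀ x, ∫⁻ y, k (x, y) ∂l ≠ ∞ →
        ∫ y, ((k (x, y)).toReal : ℂ) * h y ∂l = 0) ?_ ?_ ?_ hk
  · intro c E hE
    obtain ⟨𝓑, hc, hm, hs⟩ := exists_countable_sections l hE
    refine ⟨𝓑, hc, hm, fun h hh ⟨C, hC⟩ h0 x _ => ?_⟩
    have h1 := hs h (Integrable.of_bound hh.aestronglyMeasurable C (Eventually.of_forall hC)) h0 x
    have h2 : (fun y => ((E.indicator (fun _ => c) (x, y)).toReal : ℂ) * h y) =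
        (Prod.mk x ⁻¹' E).indicator fun y => (c.toReal : ℂ) * h y := by
      ext y
      by_cases hy : (x, y) ∈ E <;> simp [indicator, hy]
    rw [h2, integral_indicator (measurable_prodMk_left hE), integral_const_mul, h1, mul_zero]
  · intro f g _ hf hg ihf ihg
    obtain ⟨𝓑, hc, hm, hs⟩ := ihf
    obtain ⟨𝓑', hc', hm', hs'⟩ := ihg
    refine ⟨𝓑 ∪ 𝓑', hc.union hc', fun B hB => hB.elim (hm B) (hm' B),
      fun h hh hC h0 x hx => ?_⟩
    have hfx : ∫⁻ y, f (x, y) ∂l ≠ ∞ :=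
      ne_top_of_le_ne_top hx (lintegral_mono fun y => le_self_add)
    have hgx : ∫⁻ y, g (x, y) ∂l ≠ ∞ :=
      ne_top_of_le_ne_top hx (lintegral_mono fun y => le_add_self)
    have h1 := hs h hh hC (fun B hB => h0 B (Or.inl hB)) x hfx
    have h2 := hs' h hh hC (fun B hB => h0 B (Or.inr hB)) x hgx
    rw [← add_zero (0 : ℂ)]
    nth_rewrite 1 [← h1]
    rw [← h2, ← integral_add (hbdd hf hh hC x hfx) (hbdd hg hh hC x hgx)]
    refine integral_congr_ae ?_
    -- `toReal` is additive only at finite values, and finiteness of both integrals gives these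
    -- almost everywhere.
    filter_upwards [ae_lt_top (hf.comp measurable_prodMk_left) hfx,
      ae_lt_top (hg.comp measurable_prodMk_left) hgx] with y h3 h4
    simp only [Function.comp_apply] at h3 h4
    rw [Pi.add_apply, ENNReal.toReal_add h3.ne h4.ne]
    push_cast
    ring
  · intro f hf hmono ih
    choose 𝓑 hc hm hs using ih
    refine ⟨⋃ i, 𝓑 i, countable_iUnion hc, fun B hB => ?_, fun h hh hC h0 x hx => ?_⟩
    · obtain ⟨i, hi⟩ := mem_iUnion.1 hB
      exact hm i B hi
    · have hle : ∀ n y, f n (x, y) ≤ ⨆ n, f n (x, y) := fun n y => le_iSup (fun n => f n (x, y)) n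
      have hxn : ∀ n, ∫⁻ y, f n (x, y) ∂l ≠ ∞ := fun n =>
        ne_top_of_le_ne_top hx (lintegral_mono (hle n))
      have hintegrable := hbdd (Measurable.iSup hf) hh hC x hx
      have hfin := ae_lt_top ((Measurable.iSup hf).comp (measurable_prodMk_left (x := x))) hx
      -- The sequence increases, so it is dominated by its own limit, which is integrable on the
      -- section at `x` by `hx`.
      have hlim := tendsto_integral_of_dominated_convergence (μ := l)
        (F := fun n y => ((f n (x, y)).toReal : ℂ) * h y)
        (f := fun y => ((⨆ n, f n (x, y)).toReal : ℂ) * h y) _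
        (fun n => (hbdd (hf n) hh hC x (hxn n)).aestronglyMeasurable) hintegrable.norm
        (fun n => by
          filter_upwards [hfin] with y hy
          simp only [norm_mul, Complex.norm_real, Real.norm_of_nonneg ENNReal.toReal_nonneg]
          gcongr
          · exact hy.ne
          · exact hle n y)
        (by
          filter_upwards [hfin] with y hy
          refine Tendsto.mul_const _ ((Complex.continuous_ofReal.tendsto _).comp ?_)
          exact (ENNReal.tendsto_toReal hy.ne).comp
            (tendsto_atTop_iSup fun a b hab => hmono hab (x, y)))
      refine tendsto_nhds_unique hlim ?_
      simp only [hs _ h hh hC (fun B hB => h0 B (mem_iUnion.2 ⟨_, hB⟩)) x (hxn _)]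
      exact tendsto_const_nhds

end Sections

/-! ### The space M_a(S) and strong measurability of s ↦ a * δ_s -/

section AbsolutelyContinuousMeasures
variable {S : Type*} [TopologicalSpace S] [MeasurableSpace S] [BorelSpace S] [T2Space S]
variable [LocallyCompactSpace S] [Semigroup S] [ContinuousMul S]

lemma ofM_mem_Ma_iff {a : Measure S} [IsFiniteMeasure a] [a.Regular] :
    ofM a ∈ Ma S ↔ RightCont a ∧ LeftCont a := by
  have h : absM (ofM a) = ofM a := ofM_congr (variation_ofM a)
  change _ ∧ _ ↔ _
  rw [weaklyContinuous_iff, weaklyContinuous_iff, h]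
  rfl

/-- M_a(S) is solid, since both weak continuity conditions pass to smaller positive measures. -/
lemma ofM_mem_Ma_of_le {μ : M S} (hμ : μ ∈ Ma S) {a : Measure S} [IsFiniteMeasure a] [a.Regular]
    (h : a ≤ μ.1.variation) : ofM a ∈ Ma S := by
  obtain ⟨h1, h2⟩ := hμ
  rw [weaklyContinuous_iff] at h1 h2
  have hR : RightCont μ.1.variation := h1
  have hL : LeftCont μ.1.variation := h2
  exact ofM_mem_Ma_iff.2 ⟨hR.of_le h, hL.of_le h⟩

/-- The Jordan decomposition, recorded together with the bounds by `m`. When `m` is the variation of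
a measure in M_a(S), these bounds keep both parts in M_a(S). -/
lemma exists_jordan_le (s : SignedMeasure S) (m : Measure S) [IsFiniteMeasure m] [m.Regular]
    (h : s.variation ≤ m) : ∃ (a b : Measure S) (_ : IsFiniteMeasure a) (_ : a.Regular)
      (_ : IsFiniteMeasure b) (_ : b.Regular), a ≤ m ∧ b ≤ m ∧ ∀ E, MeasurableSet E →
        ((s E : ℝ) : ℂ) = (ofM a - ofM b).1 E := by
  set j := s.toJordanDecomposition
  have hj : j.posPart + j.negPart ≤ m := by
    rw [← SignedMeasure.totalVariation_eq_variation] at h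
    exact h
  have hp : j.posPart ≤ m := le_trans (Measure.le_add_right le_rfl) hj
  have hn : j.negPart ≤ m := le_trans (Measure.le_add_left le_rfl) hj
  have h1 : j.posPart.Regular := regular_of_le hp
  have h2 : j.negPart.Regular := regular_of_le hn
  refine ⟨j.posPart, j.negPart, inferInstance, h1, inferInstance, h2, hp, hn, fun E hE => ?_⟩
  conv_lhs => rw [← s.toSignedMeasure_toJordanDecomposition]
  rw [JordanDecomposition.toSignedMeasure, Measure.toSignedMeasure_sub_apply hE,
    Submodule.coe_sub, sub_apply, ofM_apply _ hE, ofM_apply _ hE,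
    Complex.ofReal_sub]

/-- Every measure in `M_a(S)` is a linear combination of positive measures in `M_a(S)`. -/
lemma Ma_induction {P : M S → Prop}
    (hpos : ∀ (m : Measure S) [IsFiniteMeasure m] [m.Regular], ofM m ∈ Ma S → P (ofM m))
    (hadd : ∀ μ ν, μ ∈ Ma S → ν ∈ Ma S → P μ → P ν → P (μ + ν))
    (hsmul : ∀ (c : ℂ) μ, μ ∈ Ma S → P μ → P (c • μ)) {μ : M S} (hμ : μ ∈ Ma S) : P μ := by
  have h1 : (ComplexMeasure.re μ.1).variation ≤ μ.1.variation := by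
    refine VectorMeasure.variation_le_of_forall_enorm_le fun A _ => ?_
    refine le_trans ?_ (VectorMeasure.enorm_measure_le_variation μ.1 A)
    rw [← ofReal_norm, ← ofReal_norm]
    exact ENNReal.ofReal_le_ofReal (Complex.abs_re_le_norm (μ.1 A))
  have h2 : (ComplexMeasure.im μ.1).variation ≤ μ.1.variation := by
    refine VectorMeasure.variation_le_of_forall_enorm_le fun A _ => ?_
    refine le_trans ?_ (VectorMeasure.enorm_measure_le_variation μ.1 A)
    rw [← ofReal_norm, ← ofReal_norm]
    exact ENNReal.ofReal_le_ofReal (Complex.abs_im_le_norm (μ.1 A))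
  obtain ⟨a, b, _, _, _, _, ha, hb, hab⟩ := exists_jordan_le _ _ h1
  obtain ⟨c, d, _, _, _, _, hc, hd, hcd⟩ := exists_jordan_le _ _ h2
  have hsub : ∀ μ ν, μ ∈ Ma S → ν ∈ Ma S → P μ → P ν → P (μ - ν) := fun μ ν hm hn hμ hν => by
    have := hadd _ _ hm ((Ma S).smul_mem (-1) hn) hμ (hsmul (-1) _ hn hν)
    rwa [neg_one_smul, ← sub_eq_add_neg] at this
  have hdec : μ = (ofM a - ofM b) + Complex.I • (ofM c - ofM d) := by
    refine Subtype.ext (VectorMeasure.ext fun E hE => ?_)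
    rw [Submodule.coe_add, add_apply, Submodule.coe_smul, smul_apply,
      ← hab E hE, ← hcd E hE, smul_eq_mul, mul_comm]
    exact (Complex.re_add_im _).symm
  have ha' := ofM_mem_Ma_of_le hμ ha
  have hb' := ofM_mem_Ma_of_le hμ hb
  have hc' := ofM_mem_Ma_of_le hμ hc
  have hd' := ofM_mem_Ma_of_le hμ hd
  rw [hdec]
  exact hadd _ _ ((Ma S).sub_mem ha' hb') ((Ma S).smul_mem _ ((Ma S).sub_mem hc' hd'))
    (hsub _ _ ha' hb' (hpos a ha') (hpos b hb'))
    (hsmul _ _ ((Ma S).sub_mem hc' hd') (hsub _ _ hc' hd' (hpos c hc') (hpos d hd')))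

/-- The definition of M_a(S) concerns |ν| only; decomposing ν into positive members of M_a(S)
transfers weak continuity to ν itself. -/
lemma continuous_apply_delta_conv (F : StrongDual ℂ (M S)) {ν : M S} (hν : ν ∈ Ma S) :
    Continuous fun s => F (conv (delta s) ν) := by
  refine Ma_induction (P := fun ν => Continuous fun s => F (conv (delta s) ν))
    (fun m _ _ hm => (ofM_mem_Ma_iff.1 hm).2 F) (fun μ ν _ _ h h' => ?_) (fun c μ _ h => ?_) hν
  · simp only [conv_add, map_add]
    exact h.add h'
  · simp only [conv_smul, map_smul]
    exact h.const_smul c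

lemma norm_delta (s : S) : ‖delta s‖ = 1 := by
  rw [delta, norm_ofM]
  simp

lemma norm_apply_delta_conv_le (F : StrongDual ℂ (M S)) (ν : M S) (s : S) :
    ‖F (conv (delta s) ν)‖ ≤ ‖F‖ * ‖ν‖ := by
  refine (F.le_opNorm _).trans ?_
  gcongr
  refine (norm_conv_le _ _).trans ?_
  rw [norm_delta, one_mul]

lemma integrable_apply_delta_conv (F : StrongDual ℂ (M S)) {ν : M S} (hν : ν ∈ Ma S)
    (m : Measure S) [IsFiniteMeasure m] : Integrable (fun s => F (conv (delta s) ν)) m :=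
  Integrable.of_bound (continuous_apply_delta_conv F hν).measurable.aestronglyMeasurable
    _ (Eventually.of_forall (norm_apply_delta_conv_le F ν))

/-- Functionals commute with the integral that defines `m * ν` for `ν ∈ M_a(S)`. -/
lemma apply_ofM_conv (F : StrongDual ℂ (M S)) {ν : M S} (hν : ν ∈ Ma S)
    (m : Measure S) [IsFiniteMeasure m] [m.Regular] :
    F (conv (ofM m) ν) = ∫ s, F (conv (delta s) ν) ∂m := by
  refine Ma_induction (P := fun ν => F (conv (ofM m) ν) = ∫ s, F (conv (delta s) ν) ∂m)
    (fun n _ _ hn => ?_) (fun μ ν hμ hν h h' => ?_) (fun c μ hμ h => ?_) hν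
  · rw [conv_ofM, functional_posConv (ofM_mem_Ma_iff.1 hn).2]
  · simp only [conv_add, map_add]
    rw [h, h', integral_add (integrable_apply_delta_conv F hμ m)
      (integrable_apply_delta_conv F hν m)]
  · simp only [conv_smul, map_smul, h]
    rw [integral_smul]

/-- If N is null for a * m, then {x | x s ∈ N} is a-null for m-almost every s. Its a-measure is a
continuous function of s, by weak continuity tested on the functional of the indicator of N. A
continuous function that vanishes almost everywhere vanishes on the support, so the conclusion holds
at every `t` there. -/
lemma absolutelyContinuous_map_mul_right {a : Measure S} [IsFiniteMeasure a] [a.Regular]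
    (ha : RightCont a) (m : Measure S) [IsFiniteMeasure m] [m.Regular] {t : S}
    (ht : t ∈ m.support) : a.map (· * t) ≪ posConv a m := by
  refine Measure.AbsolutelyContinuous.mk fun N hN h0 => ?_
  by_contra hne
  obtain ⟨G, hG⟩ := exists_bddFunctional (g := N.indicator fun _ => (1 : ℂ))
    (measurable_const.indicator hN) (C := 1) (fun x => by
      by_cases hx : x ∈ N <;> simp [hx])
  have hG' : ∀ s, G (conv (ofM a) (delta s)) = ((a ((· * s) ⁻¹' N)).toReal : ℂ) := fun s => by
    rw [delta, conv_ofM, hG, integral_indicator hN, posConv_dirac]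
    simp [Measure.real, Measure.map_apply (measurable_mulR s) hN]
  have hcont : Continuous fun s => (a ((· * s) ⁻¹' N)).toReal := by
    have := Complex.continuous_re.comp (ha G)
    simpa only [Function.comp_def, hG', Complex.ofReal_re] using this
  rw [Measure.map_apply (measurable_mulR t) hN] at hne
  have hpos : 0 < (a ((· * t) ⁻¹' N)).toReal := ENNReal.toReal_pos hne (by finiteness)
  have hev : {s | 0 < (a ((· * s) ⁻¹' N)).toReal} ∈ 𝓝 t :=
    hcont.tendsto t |>.eventually_const_lt hpos
  have hmpos : 0 < m {s | 0 < (a ((· * s) ⁻¹' N)).toReal} :=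
    Measure.mem_support_iff_forall t |>.1 ht _ hev
  rw [posConv_apply _ _ hN, lintegral_eq_zero_iff (measurable_section a hN)] at h0
  refine hmpos.ne' (measure_mono_null (fun s hs => ?_) h0)
  change ¬ (a ((· * s) ⁻¹' N) = 0)
  intro h
  have hs' : 0 < (a ((· * s) ⁻¹' N)).toReal := hs
  rw [h] at hs'
  simp at hs'

/-- The weakly continuous map `s ↦ a * δ_s` is strongly measurable for every regular finite
measure. -/
lemma RightCont.aestronglyMeasurable {a : Measure S} [IsFiniteMeasure a] [a.Regular]
    (ha : RightCont a) (m : Measure S) [IsFiniteMeasure m] [m.Regular] :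
    AEStronglyMeasurable (fun s => SemigroupMeasure.conv (ofM a) (delta s)) m := by
  have hkm : Measurable fun y : S => a.map (· * y) := by
    refine Measure.measurable_of_measurable_coe _ fun A hA => ?_
    simp_rw [Measure.map_apply (measurable_mulR _) hA]
    exact measurable_section a hA
  let κ : ProbabilityTheory.Kernel S S := ⟨fun y => a.map (· * y), hkm⟩
  have hκ : ∀ s, κ s = a.map (· * s) := fun s => rfl
  have hκfin : ProbabilityTheory.IsFiniteKernel κ := ⟨a univ, measure_lt_top _ _, fun s => by
    rw [hκ, Measure.map_apply (measurable_mulR _) .univ, preimage_univ]⟩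
  set l := posConv a m with hl
  have hsupp : ∀ᵐ t ∂m, t ∈ m.support := by
    rw [ae_iff]
    exact Measure.measure_compl_support_of_regular
  -- Fibrewise absolute continuity integrates to the product. The density `k` is then a jointly
  -- measurable choice of the densities of a * δ_s with respect to `l`, for almost every s.
  have hac : m.compProd κ ≪ m.prod l := by
    rw [← Measure.compProd_const]
    refine Measure.AbsolutelyContinuous.compProd_right ?_
    filter_upwards [hsupp] with t ht
    exact absolutelyContinuous_map_mul_right ha m ht
  set k := (m.compProd κ).rnDeriv (m.prod l) with hk
  have hkmeas : Measurable k := Measure.measurable_rnDeriv _ _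
  obtain ⟨𝓑, hBc, hBm, hB⟩ := exists_countable_sections_fun l hkmeas
  have hreg : ∀ B, (l.restrict B).Regular := fun B => regular_of_le Measure.restrict_le_self
  -- Candidate for the separable range: the closed span of the restrictions of `l` to the countably
  -- many sets that control the sections of `k`.
  let T : Set (M S) := (fun B => @ofM S _ _ _ _ (l.restrict B) _ (hreg B)) '' 𝓑
  have hTsep : TopologicalSpace.IsSeparable
      ((Submodule.span ℂ T).topologicalClosure : Set (M S)) := by
    rw [Submodule.topologicalClosure_coe]
    exact ((hBc.image _).isSeparable.span).closure
  refine aestronglyMeasurable_of_dual hTsep ?_ fun F => (ha F).measurable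
  filter_upwards [hsupp] with t ht
  -- Otherwise some `F` kills all these restrictions but not a * δ_t. On measures dominated by `l`
  -- it is integration of a bounded `h`, so `h` has integral zero over each B in `𝓑`, hence against
  -- almost every section of `k`.
  by_contra hnot
  obtain ⟨F, hFt, hF0⟩ := exists_dual_eq_zero_of_notMem
    (Submodule.isClosed_topologicalClosure _) hnot
  obtain ⟨h, hh, ⟨C, hC⟩, hF⟩ := exists_repr F l
  have hintegrable : ∀ (m : Measure S) [IsFiniteMeasure m], Integrable h m := fun m _ =>
    Integrable.of_bound hh.aestronglyMeasurable C (Eventually.of_forall hC)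
  have hhB : ∀ B ∈ 𝓑, ∫ y in B, h y ∂l = 0 := fun B hBB => by
    have := hreg B
    rw [← hF _ (Measure.absolutelyContinuous_of_le Measure.restrict_le_self)]
    exact hF0 _ (Submodule.le_topologicalClosure _ (Submodule.subset_span ⟨B, hBB, rfl⟩))
  have hkfin : ∀ᵐ s ∂m, ∫⁻ y, k (s, y) ∂l ≠ ∞ := by
    have h1 : ∫⁻ z, k z ∂(m.prod l) ≠ ∞ :=
      (Measure.lintegral_rnDeriv_lt_top _ _).ne
    rw [lintegral_prod _ hkmeas.aemeasurable] at h1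
    filter_upwards [ae_lt_top hkmeas.lintegral_prod_right' h1] with s hs using hs.ne
  -- Integration over sets `A` passes from the kernel to its joint density, since `k` is known only
  -- as a density on the product space.
  have hzero : ∀ A, MeasurableSet A → m A < ∞ →
      ∫ s in A, F (SemigroupMeasure.conv (ofM a) (delta s)) ∂m = 0 := by
    intro A hA _
    have e1 : ∫ s in A, F (SemigroupMeasure.conv (ofM a) (delta s)) ∂m =
        ∫ s in A, ∫ y, h y ∂κ s ∂m := by
      refine setIntegral_congr_ae hA ?_
      filter_upwards [hsupp] with s hs _
      have := absolutelyContinuous_map_mul_right ha m hs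
      rw [← posConv_dirac] at this
      rw [delta, conv_ofM, hF _ this, hκ, posConv_dirac]
    set g : S × S → ℂ := (A ×ˢ univ).indicator fun z => h z.2 with hg
    have hgm : Measurable g := (hh.comp measurable_snd).indicator (hA.prod .univ)
    have hgi : ∀ (n : Measure (S × S)) [IsFiniteMeasure n], Integrable g n := fun n _ =>
      Integrable.of_bound hgm.aestronglyMeasurable |C| (Eventually.of_forall fun z => by
        by_cases hz : z ∈ A ×ˢ (univ : Set S)
        · simpa [hg, hz] using (hC _).trans (le_abs_self C)
        · simp only [hg, indicator_of_notMem hz, norm_zero]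
          exact abs_nonneg C)
    have e2 : ∫ s in A, ∫ y, h y ∂κ s ∂m = ∫ z, g z ∂(m.compProd κ) := by
      rw [Measure.integral_compProd (hgi _), ← integral_indicator hA]
      refine integral_congr_ae (Eventually.of_forall fun s => ?_)
      by_cases hs : s ∈ A <;> simp [hg, hs, indicator]
    have e3 : ∫ z, g z ∂(m.compProd κ) = ∫ s, ∫ y, (k (s, y)).toReal • g (s, y) ∂l ∂m := by
      rw [← integral_rnDeriv_smul hac, integral_prod]
      exact (integrable_rnDeriv_smul_iff hac).2 (hgi _)
    rw [e1, e2, e3]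
    refine integral_eq_zero_of_ae ?_
    filter_upwards [hkfin] with s hs
    by_cases hsA : s ∈ A
    · have : (fun y => (k (s, y)).toReal • g (s, y)) =
          fun y => ((k (s, y)).toReal : ℂ) * h y := by
        ext y
        simp [hg, hsA]
      rw [this, hB h hh ⟨C, hC⟩ hhB s hs]
      rfl
    · simp [hg, hsA]
  have hFint : Integrable (fun s => F (SemigroupMeasure.conv (ofM a) (delta s))) m := by
    refine Integrable.of_bound (ha F).measurable.aestronglyMeasurable (‖F‖ * ‖ofM a‖)
      (Eventually.of_forall fun s => (F.le_opNorm _).trans ?_)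
    gcongr
    refine (norm_conv_le _ _).trans ?_
    rw [norm_delta, mul_one]
  have hae := hFint.ae_eq_zero_of_forall_setIntegral_eq_zero hzero
  -- By continuity the set where `F` does not vanish is a neighbourhood of `t`. As `t` lies in the
  -- support it has positive measure, against `hae`.
  have hopen : {s | F (SemigroupMeasure.conv (ofM a) (delta s)) ≠ 0} ∈ 𝓝 t :=
    (ha F).tendsto t |>.eventually_ne hFt
  have hmpos := Measure.mem_support_iff_forall t |>.1 ht _ hopen
  exact hmpos.ne' hae

end AbsolutelyContinuousMeasures

/-! ### Conjugation, and real and imaginary parts of functionals on M(S) -/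

section Conjugation
variable {S : Type*} [TopologicalSpace S] [MeasurableSpace S] [BorelSpace S] [T2Space S]

/-- The complex conjugate of a complex measure. -/
def conjMeasure (μ : ComplexMeasure S) : ComplexMeasure S :=
  μ.mapRange (starRingEnd ℂ : ℂ →+* ℂ).toAddMonoidHom Complex.continuous_conj

lemma conjMeasure_apply (μ : ComplexMeasure S) (E : Set S) :
    conjMeasure μ E = starRingEnd ℂ (μ E) := rfl

lemma variation_conjMeasure_le (μ : ComplexMeasure S) :
    (conjMeasure μ).variation ≤ μ.variation := by
  refine VectorMeasure.variation_le_of_forall_enorm_le fun A _ => ?_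
  refine le_trans (le_of_eq ?_) (VectorMeasure.enorm_measure_le_variation μ A)
  rw [← ofReal_norm, ← ofReal_norm, conjMeasure_apply, RCLike.norm_conj]

/-- Complex conjugation on `M(S)`. -/
def conjM (μ : M S) : M S := ⟨conjMeasure μ.1,
  isFiniteMeasure_of_le _ (variation_conjMeasure_le μ.1),
  regular_of_le (variation_conjMeasure_le μ.1)⟩

lemma norm_conjM_le (μ : M S) : ‖conjM μ‖ ≤ ‖μ‖ :=
  ENNReal.toReal_mono (by finiteness) (variation_conjMeasure_le μ.1 univ)

lemma conjM_ofM (m : Measure S) [IsFiniteMeasure m] [m.Regular] : conjM (ofM m) = ofM m := by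
  refine Subtype.ext (VectorMeasure.ext fun E hE => ?_)
  change starRingEnd ℂ ((ofM m).1 E) = (ofM m).1 E
  rw [ofM_apply m hE, Complex.conj_ofReal]

/-- The complex conjugate of a functional on `M(S)`. -/
def conjDual (F : StrongDual ℂ (M S)) : StrongDual ℂ (M S) :=
  LinearMap.mkContinuous
    { toFun := fun μ => starRingEnd ℂ (F (conjM μ))
      map_add' := fun μ ν => by
        have : conjM (μ + ν) = conjM μ + conjM ν :=
          Subtype.ext (VectorMeasure.ext fun E _ => map_add (starRingEnd ℂ) (μ.1 E) (ν.1 E))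
        rw [this, map_add, map_add]
      map_smul' := fun c μ => by
        have : conjM (c • μ) = starRingEnd ℂ c • conjM μ :=
          Subtype.ext (VectorMeasure.ext fun E _ => map_mul (starRingEnd ℂ) c (μ.1 E))
        rw [this, map_smul, smul_eq_mul, map_mul, Complex.conj_conj]
        rfl } ‖F‖ fun μ => by
    change ‖starRingEnd ℂ (F (conjM μ))‖ ≤ _
    rw [RCLike.norm_conj]
    exact (F.le_opNorm _).trans (mul_le_mul_of_nonneg_left (norm_conjM_le μ) (norm_nonneg _))

lemma conjDual_ofM (F : StrongDual ℂ (M S)) (m : Measure S) [IsFiniteMeasure m] [m.Regular] :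
    conjDual F (ofM m) = starRingEnd ℂ (F (ofM m)) := by
  change starRingEnd ℂ (F (conjM (ofM m))) = _
  rw [conjM_ofM]

/-- Every functional on `M(S)` has a real and an imaginary part. -/
lemma exists_re_im (F : StrongDual ℂ (M S)) : ∃ F₁ F₂ : StrongDual ℂ (M S),
    F = F₁ + Complex.I • F₂ ∧ ∀ (m : Measure S) [IsFiniteMeasure m] [m.Regular],
      F₁ (ofM m) = ((F (ofM m)).re : ℂ) ∧ F₂ (ofM m) = ((F (ofM m)).im : ℂ) := by
  refine ⟨(2⁻¹ : ℂ) • (F + conjDual F), (-(Complex.I) * 2⁻¹ : ℂ) • (F - conjDual F), ?_,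
    fun m _ _ => ⟨?_, ?_⟩⟩
  · ext μ
    simp only [add_apply, smul_apply, sub_apply, smul_eq_mul]
    linear_combination (2⁻¹ * (F μ - conjDual F μ)) * Complex.I_mul_I
  · rw [smul_apply, add_apply, conjDual_ofM, Complex.add_conj]
    simp
  · rw [smul_apply, sub_apply, conjDual_ofM, Complex.sub_conj, smul_eq_mul]
    push_cast
    linear_combination (-((F (ofM m)).im : ℂ)) * Complex.I_mul_I

end Conjugation

/-! ### Probability measures and positivity of means -/

section Probability
variable {S : Type*} [TopologicalSpace S] [MeasurableSpace S] [BorelSpace S] [T2Space S]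

lemma ofM_smul_of_eq {m n : Measure S} [IsFiniteMeasure m] [m.Regular] [IsFiniteMeasure n]
    [n.Regular] {c : ℝ} (h : ∀ E, MeasurableSet E → m.real E = c * n.real E) :
    ofM m = (c : ℂ) • ofM n := by
  refine Subtype.ext (VectorMeasure.ext fun E hE => ?_)
  rw [Submodule.coe_smul, smul_apply, ofM_apply _ hE, ofM_apply _ hE, h E hE]
  simp

/-- Normalization of a positive measure. -/
lemma exists_toM_eq_smul (n : Measure S) [IsFiniteMeasure n] [n.Regular] (hn : n ≠ 0) :
    ∃ ρ : M₀ S, ρ.1 = (n univ)⁻¹ • n ∧ ofM n = (n.real univ : ℂ) • ρ.toM ∧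
      ρ.toM = ((n.real univ)⁻¹ : ℂ) • ofM n := by
  have h0 : n univ ≠ 0 := fun h => hn (Measure.measure_univ_eq_zero.1 h)
  have hinv : (n univ)⁻¹ ≠ ∞ := ENNReal.inv_ne_top.2 h0
  have hreg : ((n univ)⁻¹ • n).Regular := Measure.Regular.smul hinv
  have hprob : IsProbabilityMeasure ((n univ)⁻¹ • n) :=
    ⟨by simpa using ENNReal.inv_mul_cancel h0 (measure_ne_top _ _)⟩
  have hr : n.real univ ≠ 0 := by
    rw [measureReal_def]
    exact (ENNReal.toReal_pos h0 (measure_ne_top _ _)).ne'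
  have hkey : ofM ((n univ)⁻¹ • n) = (((n.real univ)⁻¹ : ℝ) : ℂ) • ofM n := by
    refine ofM_smul_of_eq fun E _ => ?_
    simp [Measure.real, ENNReal.toReal_inv]
  rw [Complex.ofReal_inv] at hkey
  refine ⟨⟨_, hprob, hreg⟩, rfl, ?_, hkey⟩
  change _ = _ • ofM ((n univ)⁻¹ • n)
  rw [hkey, smul_smul, mul_inv_cancel₀ (by exact_mod_cast hr), one_smul]

lemma ofM_eq_zero (n : Measure S) [IsFiniteMeasure n] [n.Regular] (hn : n = 0) : ofM n = 0 := by
  refine Subtype.ext (VectorMeasure.ext fun E hE => ?_)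
  rw [ofM_apply _ hE, hn]
  simp

lemma M₀.norm_toM (ρ : M₀ S) : ‖ρ.toM‖ = 1 := by
  rw [M₀.toM, norm_ofM]
  simp

lemma M₀.toM_univ (ρ : M₀ S) : ρ.toM.1 univ = 1 := by
  rw [M₀.toM, ofM_apply _ .univ]
  simp

/-- Convex combinations of probability measures. -/
lemma M₀.exists_convex (ρ σ : M₀ S) {a b : ℝ} (ha : 0 ≤ a) (hb : 0 ≤ b) (hab : a + b = 1) :
    ∃ τ : M₀ S, τ.toM = (a : ℂ) • ρ.toM + (b : ℂ) • σ.toM := by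
  set n := ENNReal.ofReal a • ρ.1 + ENNReal.ofReal b • σ.1 with hn
  have r1 : (ENNReal.ofReal a • ρ.1).Regular := Measure.Regular.smul ENNReal.ofReal_ne_top
  have r2 : (ENNReal.ofReal b • σ.1).Regular := Measure.Regular.smul ENNReal.ofReal_ne_top
  have f1 : IsFiniteMeasure (ENNReal.ofReal a • ρ.1) := Measure.smul_finite _ ENNReal.ofReal_ne_top
  have f2 : IsFiniteMeasure (ENNReal.ofReal b • σ.1) := Measure.smul_finite _ ENNReal.ofReal_ne_top
  have r3 : n.Regular := regular_add
  have hp : IsProbabilityMeasure n := ⟨by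
    rw [hn]
    simp [← ENNReal.ofReal_add ha hb, hab]⟩
  refine ⟨⟨n, hp, r3⟩, Subtype.ext (VectorMeasure.ext fun E hE => ?_)⟩
  change (ofM n).1 E = _
  rw [Submodule.coe_add, add_apply, Submodule.coe_smul, smul_apply, Submodule.coe_smul, smul_apply,
    M₀.toM, M₀.toM, ofM_apply _ hE, ofM_apply _ hE, ofM_apply _ hE]
  simp only [hn, Measure.real, Measure.add_apply, Measure.smul_apply, smul_eq_mul]
  rw [ENNReal.toReal_add (by finiteness) (by finiteness)]
  simp [ENNReal.toReal_ofReal, ha, hb]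

/-- The point mass at `s` as a probability measure. -/
def deltaProb (s : S) : M₀ S := ⟨Measure.dirac s, inferInstance, inferInstance⟩

lemma deltaProb_toM (s : S) : (deltaProb s).toM = delta s := rfl

variable [LocallyCompactSpace S] [Semigroup S] [ContinuousMul S]

/-- Bounds on probability measures are inherited by means. -/
lemma IsTopRightInvariantMean.re_le {m : StrongDual ℂ (StrongDual ℂ (M S))}
    (hm : IsTopRightInvariantMean S m) {F : StrongDual ℂ (M S)} {c : ℝ}
    (hF : ∀ ρ : M₀ S, (F ρ.toM).re ≤ c) : (m F).re ≤ c := by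
  obtain ⟨F₁, F₂, hdec, hval⟩ := exists_re_im F
  have hone : ∀ (n : Measure S) [IsFiniteMeasure n] [n.Regular],
      oneM S (ofM n) = (n.real univ : ℂ) := fun n _ _ => ofM_apply n .univ
  -- By normalization the bound on probability measures says that c 1 - F₁ is nonnegative, so m F₁
  -- is real and at most c.
  obtain ⟨r, hr, hr'⟩ := hm.nonneg ((c : ℂ) • oneM S - F₁) (by
    rintro _ ⟨n, _, _, rfl⟩
    rw [sub_apply, smul_apply, hone, (hval n).1]
    refine ⟨c * n.real univ - (F (ofM n)).re, sub_nonneg.2 ?_, by simp⟩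
    by_cases hn : n = 0
    · rw [ofM_eq_zero n hn, hn]
      simp
    · obtain ⟨ρ, -, h2, -⟩ := exists_toM_eq_smul n hn
      rw [h2, map_smul, smul_eq_mul, Complex.re_ofReal_mul, mul_comm c]
      exact mul_le_mul_of_nonneg_left (hF ρ) measureReal_nonneg)
  -- The crude bound by ‖F‖ serves only to show that m F₂ is real, so that the imaginary part of `F`
  -- contributes nothing to the real part of m F.
  obtain ⟨q, hq, hq'⟩ := hm.nonneg ((‖F‖ : ℂ) • oneM S - F₂) (by
    rintro _ ⟨n, _, _, rfl⟩
    rw [sub_apply, smul_apply, hone, (hval n).2]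
    refine ⟨‖F‖ * n.real univ - (F (ofM n)).im, sub_nonneg.2 ?_, by simp⟩
    refine ((le_abs_self _).trans (Complex.abs_im_le_norm _)).trans ?_
    rw [← norm_ofM]
    exact F.le_opNorm _)
  rw [map_sub, map_smul, hm.one, smul_eq_mul, mul_one] at hr' hq'
  have h1 : m F₁ = ((c - r : ℝ) : ℂ) := by
    push_cast
    linear_combination -hr'
  have h2 : m F₂ = ((‖F‖ - q : ℝ) : ℂ) := by
    push_cast
    linear_combination -hq'
  rw [hdec, map_add, map_smul, h1, h2]
  simpa using hr

end Probability

/-! ### The action of M(S) on M_a(S)^* and its averages -/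

section Actions
variable {S : Type*} [TopologicalSpace S] [MeasurableSpace S] [BorelSpace S] [T2Space S]
variable [LocallyCompactSpace S] [Semigroup S] [ContinuousMul S]

/-- Hahn–Banach. Passing to M(S) avoids carrying membership proofs through convolution identities,
and supplies elements of M(S)^* to which a mean can be applied. -/
lemma exists_extension (f : MaDual S) : ∃ F : StrongDual ℂ (M S), ∀ ν : Ma S, F ν = f ν := by
  obtain ⟨F, hF, -⟩ := exists_extension_norm_eq (Ma S) f
  exact ⟨F, hF⟩

lemma act_add_right (f : MaDual S) (μ ν : M S) : act f (μ + ν) = act f μ + act f ν := by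
  obtain ⟨F, hF⟩ := exists_extension f
  ext ρ
  simp only [act_apply, add_apply, ← hF, add_conv, map_add]

lemma act_smul_right (f : MaDual S) (c : ℂ) (μ : M S) : act f (c • μ) = c • act f μ := by
  obtain ⟨F, hF⟩ := exists_extension f
  ext ρ
  simp only [act_apply, smul_apply, ← hF, smul_conv, map_smul]

lemma act_sub_right (f : MaDual S) (μ ν : M S) : act f (μ - ν) = act f μ - act f ν := by
  rw [sub_eq_add_neg, ← neg_one_smul ℂ ν, act_add_right, act_smul_right, neg_one_smul,
    ← sub_eq_add_neg]

lemma act_sub (f g : MaDual S) (μ : M S) : act (f - g) μ = act f μ - act g μ := rfl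

lemma norm_act_le (f : MaDual S) (μ : M S) : ‖act f μ‖ ≤ ‖f‖ * ‖μ‖ := by
  refine ContinuousLinearMap.opNorm_le_bound _ (by positivity) fun ν => ?_
  rw [act_apply, mul_assoc]
  exact (f.le_opNorm _).trans (mul_le_mul_of_nonneg_left (norm_conv_le μ ν) (norm_nonneg _))

/-- The action of `M(S)` on a functional as a bounded linear map. -/
def actL (f : MaDual S) : M S →L[ℂ] MaDual S :=
  LinearMap.mkContinuous
    { toFun := act f
      map_add' := act_add_right f
      map_smul' := act_smul_right f } ‖f‖ (norm_act_le f)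

lemma continuous_translate_apply (f : MaDual S) (ν : Ma S) :
    Continuous fun s => translate f s ν := by
  obtain ⟨F, hF⟩ := exists_extension f
  refine (continuous_apply_delta_conv F ν.2).congr fun s => ?_
  exact hF ⟨conv (delta s) ν, conv_mem_Ma _ ν.2⟩

/-- For every f in M_a(S)^* the action of m is the weak* integral of the translates; that it is a
Bochner integral needs weak almost periodicity. -/
lemma act_ofM_apply (f : MaDual S) (m : Measure S) [IsFiniteMeasure m] [m.Regular] (ν : Ma S) :
    act f (ofM m) ν = ∫ s, translate f s ν ∂m := by
  obtain ⟨F, hF⟩ := exists_extension f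
  have h1 := apply_ofM_conv F ν.2 m
  rw [act_apply, ← hF]
  refine h1.trans (integral_congr_ae (Eventually.of_forall fun s => ?_))
  exact hF ⟨conv (delta s) ν, conv_mem_Ma _ ν.2⟩

lemma convex_orbit (f : MaDual S) : Convex ℝ (orbit f) := by
  rintro _ ⟨μ, hμ, h1, rfl⟩ _ ⟨ν, hν, h2, rfl⟩ a b ha hb hab
  refine ⟨(a : ℂ) • μ + (b : ℂ) • ν,
    (Ma S).add_mem ((Ma S).smul_mem _ hμ) ((Ma S).smul_mem _ hν), ?_, ?_⟩
  · refine (norm_add_le _ _).trans ?_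
    rw [norm_smul, norm_smul, Complex.norm_real, Complex.norm_real, Real.norm_of_nonneg ha,
      Real.norm_of_nonneg hb, ← hab]
    exact add_le_add (mul_le_of_le_one_right ha h1) (mul_le_of_le_one_right hb h2)
  · rw [act_add_right, act_smul_right, act_smul_right]
    rfl

/-- The set of all `f ρ` with `ρ` a probability measure. -/
def probOrbit (f : MaDual S) : Set (MaDual S) := {g | ∃ ρ : M₀ S, g = act f ρ.toM}

/-- The set of all `f ρ` with `ρ` a probability measure in `M_a(S)`. -/
def probOrbitMa (f : MaDual S) : Set (MaDual S) :=
  {g | ∃ ρ : M₀ S, ρ.toM ∈ Ma S ∧ g = act f ρ.toM}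

lemma convex_probOrbit (f : MaDual S) : Convex ℝ (probOrbit f) := by
  rintro _ ⟨μ, rfl⟩ _ ⟨ν, rfl⟩ a b ha hb hab
  obtain ⟨τ, hτ⟩ := M₀.exists_convex μ ν ha hb hab
  refine ⟨τ, ?_⟩
  rw [hτ, act_add_right, act_smul_right, act_smul_right]
  rfl

lemma convex_probOrbitMa (f : MaDual S) : Convex ℝ (probOrbitMa f) := by
  rintro _ ⟨μ, hμ, rfl⟩ _ ⟨ν, hν, rfl⟩ a b ha hb hab
  obtain ⟨τ, hτ⟩ := M₀.exists_convex μ ν ha hb hab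
  refine ⟨τ, ?_, ?_⟩
  · rw [hτ]
    exact (Ma S).add_mem ((Ma S).smul_mem _ hμ) ((Ma S).smul_mem _ hν)
  · rw [hτ, act_add_right, act_smul_right, act_smul_right]
    rfl

/-- `wap(M_a(S))` is closed in norm. -/
lemma isClosed_wap : IsClosed (wap S : Set (MaDual S)) := by
  refine isClosed_of_closure_subset fun f hf => ?_
  -- All orbits are indexed by the same unit ball, so norm closeness of two functionals becomes
  -- uniform closeness of the families.
  let I := {μ : M S // μ ∈ Ma S ∧ ‖μ‖ ≤ 1}
  have horb : ∀ g : MaDual S, orbit g = range fun μ : I => act g μ.1 := fun g => by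
    ext x
    constructor
    · rintro ⟨μ, h1, h2, rfl⟩
      exact ⟨⟨μ, h1, h2⟩, rfl⟩
    · rintro ⟨μ, rfl⟩
      exact ⟨μ.1, μ.2.1, μ.2.2, rfl⟩
  change RelWeaklyCompact (orbit f)
  rw [horb]
  refine relWeaklyCompact_range_of_uniform_limit _ fun ε hε => ?_
  obtain ⟨g, hg, hfg⟩ := Metric.mem_closure_iff.1 hf ε hε
  refine ⟨fun μ => act g μ.1, ?_, fun μ => ?_⟩
  · rw [← horb]
    exact hg
  · rw [← act_sub]
    refine (norm_act_le _ _).trans ?_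
    rw [dist_eq_norm] at hfg
    exact (mul_le_of_le_one_right (norm_nonneg _) μ.2.2).trans hfg.le

/-- `⟨f, ρ * ν⟩` as a functional of `ρ ∈ M(S)`. -/
def evalAct (f : MaDual S) (ν : Ma S) : StrongDual ℂ (M S) :=
  f ∘L ((convL.flip ν.1).codRestrict (Ma S) fun ρ => conv_mem_Ma ρ ν.2)

lemma evalAct_apply (f : MaDual S) (ν : Ma S) (ρ : M S) : evalAct f ν ρ = act f ρ ν := rfl

lemma norm_evalAct_le (f : MaDual S) (ν : Ma S) : ‖evalAct f ν‖ ≤ ‖f‖ * ‖ν‖ := by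
  refine ContinuousLinearMap.opNorm_le_bound _ (by positivity) fun ρ => ?_
  rw [evalAct_apply]
  refine ((act f ρ).le_opNorm _).trans ?_
  calc ‖act f ρ‖ * ‖ν‖ ≤ ‖f‖ * ‖ρ‖ * ‖ν‖ :=
        mul_le_mul_of_nonneg_right (norm_act_le f ρ) (norm_nonneg _)
    _ = _ := by ring

lemma evalAct_add (f : MaDual S) (ν ν' : Ma S) :
    evalAct f (ν + ν') = evalAct f ν + evalAct f ν' := by
  ext ρ
  exact map_add (act f ρ) ν ν'

lemma evalAct_smul (f : MaDual S) (c : ℂ) (ν : Ma S) :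
    evalAct f (c • ν) = c • evalAct f ν := by
  ext ρ
  exact map_smul (act f ρ) c ν

/-- The mean of the functionals `f ρ` with respect to a functional `m` on `M(S)^*`. -/
def meanAct (m : StrongDual ℂ (StrongDual ℂ (M S))) (f : MaDual S) : MaDual S :=
  LinearMap.mkContinuous
    { toFun := fun ν => m (evalAct f ν)
      map_add' := fun ν ν' => (congrArg m (evalAct_add f ν ν')).trans (map_add m _ _)
      map_smul' := fun c ν => (congrArg m (evalAct_smul f c ν)).trans (map_smul m c _) }
    (‖m‖ * ‖f‖) fun ν =>
      ((m.le_opNorm _).trans (mul_le_mul_of_nonneg_left (norm_evalAct_le f ν)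
        (norm_nonneg m))).trans_eq (mul_assoc _ _ _).symm

lemma meanAct_apply (m : StrongDual ℂ (StrongDual ℂ (M S))) (f : MaDual S) (ν : Ma S) :
    meanAct m f ν = m (evalAct f ν) := rfl

/-- Associativity turns the action of μ on `meanAct` into `leftAct μ` inside the mean, which a
topologically right invariant mean ignores when μ is a probability measure. Hence `act_meanAct`. -/
lemma evalAct_conv (f : MaDual S) (μ : M S) (ν : Ma S) :
    evalAct f ⟨conv μ ν, conv_mem_Ma μ ν.2⟩ = leftAct μ (evalAct f ν) := by
  ext σ
  have h : leftAct μ (evalAct f ν) σ = act f (conv σ μ) ν := rfl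
  rw [h, ← act_act, evalAct_apply, act_apply (act f σ)]

lemma act_meanAct {m : StrongDual ℂ (StrongDual ℂ (M S))} (hm : IsTopRightInvariantMean S m)
    (f : MaDual S) (ρ : M₀ S) : act (meanAct m f) ρ.toM = meanAct m f := by
  ext ν
  rw [act_apply, meanAct_apply, meanAct_apply, evalAct_conv]
  exact hm.invariant ρ (evalAct f ν)

/-- A functional fixed by translations is fixed by `M(S)` up to the total mass. -/
lemma act_eq_smul_of_translate_eq {g : MaDual S} (hg : ∀ s : S, translate g s = g) (σ : M S) :
    act g σ = σ.1 univ • g := by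
  refine induction_pos (P := fun σ => act g σ = σ.1 univ • g) (fun n _ _ => ?_)
    (fun μ ν h h' => ?_) (fun c μ h => ?_) σ
  · ext ν
    rw [act_ofM_apply, ofM_apply _ .univ]
    simp [hg]
  · rw [act_add_right, h, h', Submodule.coe_add, add_apply, add_smul]
  · rw [act_smul_right, h, Submodule.coe_smul, smul_apply, smul_smul, smul_eq_mul]

/-- Functionals fixed by translations are constant if there is an invariant mean. -/
lemma exists_eq_smul_one {m : StrongDual ℂ (StrongDual ℂ (M S))}
    (hm : IsTopRightInvariantMean S m) {g : MaDual S} (hg : ∀ s : S, translate g s = g) :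
    ∃ c : ℂ, g = c • one S := by
  obtain ⟨G, hG⟩ := exists_extension g
  have hprob : ∀ (ρ : M₀ S) (hρ : ρ.toM ∈ Ma S), g ⟨ρ.toM, hρ⟩ = m G := by
    intro ρ hρ
    -- Since `ρ` lies in M_a(S), which is a left ideal, G(σ * ρ) equals (g σ)(ρ) = σ(S) g(ρ) for
    -- every σ, whatever the extension `G`. The mean then returns the value at `ρ`, which is thus
    -- independent of `ρ`.
    have h1 : leftAct ρ.toM G = g ⟨ρ.toM, hρ⟩ • oneM S := by
      ext σ
      have h2 : act g σ ⟨ρ.toM, hρ⟩ = σ.1 univ * g ⟨ρ.toM, hρ⟩ := by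
        rw [act_eq_smul_of_translate_eq hg]
        rfl
      rw [smul_apply, smul_eq_mul, mul_comm]
      refine Eq.trans ?_ h2
      exact hG ⟨conv σ ρ.toM, conv_mem_Ma σ hρ⟩
    have h2 := hm.invariant ρ G
    rw [h1, map_smul, hm.one, smul_eq_mul, mul_one] at h2
    exact h2
  refine ⟨m G, ?_⟩
  have hext : ∀ ν ∈ Ma S, G ν = m G * ν.1 univ := by
    intro ν hν
    refine Ma_induction (P := fun ν => G ν = m G * ν.1 univ) (fun n _ _ hn => ?_)
      (fun μ ν _ _ h h' => ?_) (fun c μ _ h => ?_) hν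
    · by_cases h0 : n = 0
      · rw [ofM_eq_zero n h0, map_zero]
        simp
      · obtain ⟨ρ, -, h2, h3⟩ := exists_toM_eq_smul n h0
        have hρ : ρ.toM ∈ Ma S := by
          rw [h3]
          exact (Ma S).smul_mem _ hn
        have h4 : G ρ.toM = m G := (hG ⟨ρ.toM, hρ⟩).trans (hprob ρ hρ)
        rw [h2, map_smul, h4, Submodule.coe_smul, smul_apply, ρ.toM_univ]
        simp [mul_comm]
    · rw [map_add, h, h', Submodule.coe_add, add_apply, mul_add]
    · rw [map_smul, h, Submodule.coe_smul, smul_apply, smul_eq_mul, smul_eq_mul]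
      ring
  ext ν
  rw [← hG ν, hext ν ν.2]
  rfl

end Actions

/-! ### Approximation at the identity and Bochner integrability -/

section Identity
variable {S : Type*} [TopologicalSpace S] [MeasurableSpace S] [BorelSpace S] [T2Space S]
variable [LocallyCompactSpace S] [Monoid S] [ContinuousMul S]

lemma delta_one_conv (ν : M S) : conv (delta 1) ν = ν := by
  refine induction_pos (P := fun ν => conv (delta 1) ν = ν) (fun m _ _ => ?_)
    (fun μ ν h h' => by rw [conv_add, h, h']) (fun c μ h => by rw [conv_smul, h]) ν
  rw [delta, conv_ofM]
  refine ofM_congr ?_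
  rw [dirac_posConv]
  simp

lemma act_delta_one (f : MaDual S) : act f (delta 1) = f := by
  ext ν
  have : (⟨conv (delta 1) ν, conv_mem_Ma _ ν.2⟩ : Ma S) = ν := Subtype.ext (delta_one_conv ν.1)
  rw [act_apply, this]

/-- In a foundation semigroup there are probability measures in `M_a(S)` that are concentrated on
a given neighbourhood of the identity. -/
lemma IsFoundation.exists_prob (hS : IsFoundation S) {U : Set S} (hU : U ∈ 𝓝 (1 : S)) :
    ∃ e : M₀ S, e.toM ∈ Ma S ∧ ∀ᵐ t ∂e.1, t ∈ U := by
  -- Density puts a support point of some measure of M_a(S) in the interior of `U`; the required `e`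
  -- is the normalized restriction of its variation, which stays in M_a(S) by solidity.
  obtain ⟨x, hxU, hx⟩ := hS.inter_open_nonempty (interior U) isOpen_interior
    ⟨1, mem_interior_iff_mem_nhds.2 hU⟩
  obtain ⟨μ, hμ, hxμ⟩ := mem_iUnion₂.1 hx
  have hpos : 0 < μ.1.variation (interior U) :=
    Measure.mem_support_iff_forall x |>.1 hxμ _ (isOpen_interior.mem_nhds hxU)
  have hreg : (μ.1.variation.restrict (interior U)).Regular :=
    regular_of_le Measure.restrict_le_self
  obtain ⟨e, he1, -, he3⟩ := exists_toM_eq_smul (μ.1.variation.restrict (interior U))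
    (fun h => hpos.ne' (Measure.restrict_eq_zero.1 h))
  refine ⟨e, ?_, ?_⟩
  · rw [he3]
    exact (Ma S).smul_mem _ (ofM_mem_Ma_of_le hμ Measure.restrict_le_self)
  · rw [he1]
    refine Measure.ae_smul_measure ?_ _
    filter_upwards [ae_restrict_mem isOpen_interior.measurableSet] with t ht
    exact interior_subset ht

/-- `f μ` is approximated by the functionals `f (μ * e)` with `e ∈ M_a(S)`. -/
lemma IsFoundation.re_act_le (hS : IsFoundation S) (f : MaDual S) (μ : M S) (ν : Ma S) {c : ℝ}
    (h : ∀ e : M₀ S, e.toM ∈ Ma S → (act f (conv μ e.toM) ν).re ≤ c) : (act f μ ν).re ≤ c := by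
  refine le_of_forall_pos_le_add fun ε hε => ?_
  -- φ(t) = ⟨f, μ * δ_t * ν⟩ is continuous and its value at 1 is ⟨f μ, ν⟩. Averaging it over an `e`
  -- concentrated near 1 lowers the real part by at most `ε`.
  set φ : S → ℂ := fun t => translate (act f μ) t ν with hφ
  have hφc : Continuous φ := continuous_translate_apply (act f μ) ν
  have hφ1 : φ 1 = act f μ ν := by
    rw [hφ]
    simp only [translate, act_delta_one]
  have hU : {t | (φ 1).re - ε < (φ t).re} ∈ 𝓝 (1 : S) :=
    (Complex.continuous_re.comp hφc).tendsto 1 |>.eventually_const_lt (sub_lt_self _ hε)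
  obtain ⟨e, he, heU⟩ := hS.exists_prob hU
  have h1 := h e he
  have hφi : Integrable φ e.1 := by
    refine Integrable.of_bound hφc.measurable.aestronglyMeasurable (‖act f μ‖ * ‖ν‖)
      (Eventually.of_forall fun t => ((translate (act f μ) t).le_opNorm ν).trans ?_)
    gcongr
    refine (norm_act_le _ _).trans ?_
    rw [norm_delta, mul_one]
  have h2 : act f (conv μ e.toM) ν = ∫ t, φ t ∂e.1 := by
    rw [← act_act]
    exact act_ofM_apply (act f μ) e.1 ν
  have h3 : (∫ t, φ t ∂e.1).re = ∫ t, (φ t).re ∂e.1 := (integral_re hφi).symm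
  have h4 : (φ 1).re - ε ≤ ∫ t, (φ t).re ∂e.1 := by
    have h5 : ∫ _, ((φ 1).re - ε) ∂e.1 = (φ 1).re - ε := by simp
    rw [← h5]
    refine integral_mono_ae (integrable_const _) hφi.re ?_
    filter_upwards [heU] with t ht
    exact le_of_lt ht
  rw [h2, h3] at h1
  rw [← hφ1]
  linarith

/-- The action of the unit ball of `M(S)` stays in the closure of the orbit. -/
lemma IsFoundation.act_mem_closure_orbit (hS : IsFoundation S) {f : MaDual S} (hf : f ∈ wap S)
    {μ : M S} (hμ : ‖μ‖ ≤ 1) : act f μ ∈ closure (orbit f) := by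
  refine mem_closure_of_forall_re_le (convex_orbit f) hf fun ν c h => ?_
  -- Although `μ` need not lie in M_a(S), μ * e does, and its norm is still at most 1.
  refine hS.re_act_le f μ ν fun e he => h _ ⟨conv μ e.toM, conv_mem_Ma μ he, ?_, rfl⟩
  refine (norm_conv_le _ _).trans ?_
  rw [e.norm_toM, mul_one]
  exact hμ

/-- Weak almost periodicity controls only measures in M_a(S). Arbitrary probability measures, such
as point masses and the members of the net, are reached because their f ρ lie in the closure of the
orbit. -/
lemma IsFoundation.relWeaklyCompact_probOrbit (hS : IsFoundation S) {f : MaDual S}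
    (hf : f ∈ wap S) : RelWeaklyCompact (probOrbit f) := by
  have hc : IsCompact (closure (toWeakSpace ℂ (MaDual S) '' orbit f)) := hf
  refine RelWeaklyCompact.of_subset hc ?_
  rintro _ ⟨ρ, rfl⟩
  rw [← (convex_orbit f).toWeakSpace_closure ℂ]
  exact mem_image_of_mem _ (hS.act_mem_closure_orbit hf ρ.norm_toM.le)

/-- The probability measures of M_a(S) near the identity act as a weak* approximate identity on f =
f δ_1; weak compactness and convexity upgrade this to norm approximation. Strong measurability of
translation depends on it. -/
lemma IsFoundation.mem_closure_probOrbitMa (hS : IsFoundation S) {f : MaDual S}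
    (hf : f ∈ wap S) : f ∈ closure (probOrbitMa f) := by
  have hc : IsCompact (closure (toWeakSpace ℂ (MaDual S) '' orbit f)) := hf
  refine mem_closure_of_forall_re_le (convex_probOrbitMa f) (RelWeaklyCompact.of_subset hc ?_)
    fun ν c h => ?_
  · rintro _ ⟨ρ, hρ, rfl⟩
    exact subset_closure (mem_image_of_mem _ ⟨ρ.toM, hρ, ρ.norm_toM.le, rfl⟩)
  · rw [← act_delta_one f]
    refine hS.re_act_le f (delta 1) ν fun e he => ?_
    rw [delta_one_conv]
    exact h _ ⟨e, he, rfl⟩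

/-- Translation of weakly almost periodic functionals is Bochner integrable. -/
lemma IsFoundation.integrable_translate (hS : IsFoundation S) {f : MaDual S} (hf : f ∈ wap S)
    (m : Measure S) [IsFiniteMeasure m] [m.Regular] :
    Integrable (fun s : S => translate f s) m := by
  obtain ⟨g, hg, hgf⟩ := mem_closure_iff_seq_limit.1 (hS.mem_closure_probOrbitMa hf)
  have hmeas : ∀ n, AEStronglyMeasurable (fun s : S => translate (g n) s) m := by
    intro n
    obtain ⟨e, he, hge⟩ := hg n
    have h1 := (ofM_mem_Ma_iff.1 he).1.aestronglyMeasurable m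
    -- Translating f e by s gives f (e * δ_s), the image of e * δ_s under the bounded map `actL f`;
    -- `e` in M_a(S) makes s ↦ e * δ_s strongly measurable.
    have h2 : (fun s : S => translate (g n) s) =
        fun s => actL f (conv (ofM e.1) (delta s)) := by
      ext1 s
      rw [translate, hge, act_act]
      rfl
    rw [h2]
    exact (actL f).continuous.comp_aestronglyMeasurable h1
  have hlim : ∀ s : S, Tendsto (fun n => translate (g n) s) atTop (𝓝 (translate f s)) := by
    intro s
    rw [tendsto_iff_norm_sub_tendsto_zero] at hgf ⊢
    refine squeeze_zero (fun _ => norm_nonneg _) (fun n => ?_) hgf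
    rw [translate, translate, ← act_sub]
    refine (norm_act_le _ _).trans ?_
    rw [norm_delta, mul_one]
  refine Integrable.of_bound
    (aestronglyMeasurable_of_tendsto_ae atTop hmeas (Eventually.of_forall hlim)) ‖f‖
    (Eventually.of_forall fun s => ?_)
  refine (norm_act_le _ _).trans ?_
  rw [norm_delta, mul_one]

/-- Evaluation at ν commutes with the Bochner integral, so the average agrees with the weak*
integral. Thereafter averages are handled through convolution alone. -/
lemma IsFoundation.average_eq (hS : IsFoundation S) {f : MaDual S} (hf : f ∈ wap S) (ρ : M₀ S) :
    average ρ f = act f ρ.toM := by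
  ext ν
  rw [average, ContinuousLinearMap.integral_apply (hS.integrable_translate hf ρ.1)]
  exact (act_ofM_apply f ρ.1 ν).symm

/-! ### The ergodic theorem, invariant means and coboundaries -/

variable {m : StrongDual ℂ (StrongDual ℂ (M S))}

/-- A half-space given by some ν that contains all f ρ contains their mean, by positivity. So no
element of the predual separates, and weak compactness gives membership in the norm closure. -/
lemma IsFoundation.meanAct_mem_closure (hS : IsFoundation S) (hm : IsTopRightInvariantMean S m)
    {f : MaDual S} (hf : f ∈ wap S) : meanAct m f ∈ closure (probOrbit f) := by
  refine mem_closure_of_forall_re_le (convex_probOrbit f) (hS.relWeaklyCompact_probOrbit hf)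
    fun ν c h => ?_
  exact hm.re_le fun ρ => h _ ⟨ρ, rfl⟩

lemma translate_meanAct (hm : IsTopRightInvariantMean S m) (f : MaDual S) (s : S) :
    translate (meanAct m f) s = meanAct m f :=
  act_meanAct hm f (deltaProb s)

/-- The mean ergodic theorem for asymptotically invariant nets. -/
lemma IsFoundation.tendsto_act (hS : IsFoundation S) (hm : IsTopRightInvariantMean S m)
    {f : MaDual S} (hf : f ∈ wap S) {κ : Type*} [Preorder κ] {μ : κ → M₀ S}
    (hμ : AsympInvariant μ) :
    Tendsto (fun α => act f (μ α).toM) atTop (𝓝 (meanAct m f)) := by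
  rw [Metric.tendsto_nhds]
  intro ε hε
  obtain ⟨_, ⟨ρ, rfl⟩, hρ⟩ :=
    Metric.mem_closure_iff.1 (hS.meanAct_mem_closure hm hf) (ε / 2) (half_pos hε)
  have h1 := (hμ ρ).const_mul ‖f‖
  rw [mul_zero] at h1
  filter_upwards [h1.eventually_lt_const (half_pos hε)] with α hα
  have h2 : ‖act f (conv ρ.toM (μ α).toM) - act f (μ α).toM‖ < ε / 2 := by
    rw [← act_sub_right]
    exact (norm_act_le _ _).trans_lt hα
  -- The limit is fixed by μ_α, so this difference is the image of `meanAct m f` - f ρ under the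
  -- action of μ_α, which does not increase norms.
  have h3 : ‖meanAct m f - act f (conv ρ.toM (μ α).toM)‖ < ε / 2 := by
    rw [dist_eq_norm] at hρ
    rw [← act_act, ← act_meanAct hm f (μ α), ← act_sub]
    refine (norm_act_le _ _).trans_lt ?_
    rwa [(μ α).norm_toM, mul_one]
  rw [dist_comm, dist_eq_norm]
  calc ‖meanAct m f - act f (μ α).toM‖
      = ‖(meanAct m f - act f (conv ρ.toM (μ α).toM)) +
          (act f (conv ρ.toM (μ α).toM) - act f (μ α).toM)‖ := by rw [sub_add_sub_cancel]
    _ ≤ _ := norm_add_le _ _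
    _ < ε := by linarith

/-- The mean of `f` evaluated at a probability measure in `M_a(S)`. -/
def wapMean (m : StrongDual ℂ (StrongDual ℂ (M S))) (ν : Ma S) : StrongDual ℂ (wap S) :=
  LinearMap.mkContinuous
    { toFun := fun f => m (evalAct f.1 ν)
      map_add' := fun f g => map_add m (evalAct f.1 ν) (evalAct g.1 ν)
      map_smul' := fun c f => map_smul m c (evalAct f.1 ν) } (‖m‖ * ‖ν‖) fun f =>
    ((m.le_opNorm _).trans (mul_le_mul_of_nonneg_left (norm_evalAct_le f.1 ν)
      (norm_nonneg m))).trans_eq (by rw [mul_comm ‖f.1‖, mul_assoc]; rfl)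

lemma wapMean_apply (ν : Ma S) (f : wap S) : wapMean m ν f = meanAct m f.1 ν := rfl

/-- The mean on M(S)^* is invariant on the right, whereas replacing f by f σ inserts σ on the left.
Left invariance is obtained from the net: the averages of f σ and f differ by f (σ * μ_α - μ_α),
which tends to 0. -/
lemma IsFoundation.isTopLeftInvariantMean_wapMean (hS : IsFoundation S)
    (hm : IsTopRightInvariantMean S m) {ι : Type*} [Preorder ι] [IsDirectedOrder ι] [Nonempty ι]
    {μ : ι → M₀ S} (hμ : AsympInvariant μ) (ρ : M₀ S) (hρ : ρ.toM ∈ Ma S) :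
    IsTopLeftInvariantMean S (wapMean m ⟨ρ.toM, hρ⟩) where
  nonneg f hf := by
    refine hm.nonneg (evalAct f.1 ⟨ρ.toM, hρ⟩) ?_
    rintro _ ⟨n, _, _, rfl⟩
    exact hf _ ⟨posConv n ρ.1, inferInstance, inferInstance, conv_ofM n ρ.1⟩
  one := by
    have h : evalAct (one S) ⟨ρ.toM, hρ⟩ = oneM S := by
      ext σ
      rw [evalAct_apply, act_one, smul_apply]
      change σ.1 univ * ρ.toM.1 univ = σ.1 univ
      rw [ρ.toM_univ, mul_one]
    exact (congrArg m h).trans hm.one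
  invariant σ f := by
    have h : meanAct m (act f.1 σ.toM) = meanAct m f.1 := by
      refine tendsto_nhds_unique (hS.tendsto_act hm (act_mem_wap f.2 σ.toM) hμ) ?_
      have h1 := hS.tendsto_act hm f.2 hμ
      have h2 : Tendsto (fun α => act (act f.1 σ.toM) (μ α).toM - act f.1 (μ α).toM) atTop
          (𝓝 0) := by
        rw [tendsto_zero_iff_norm_tendsto_zero]
        refine squeeze_zero (fun _ => norm_nonneg _) (fun α => ?_)
          (by simpa using (hμ σ).const_mul ‖f.1‖)
        rw [act_act, ← act_sub_right]
        exact norm_act_le _ _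
      simpa using h2.add h1
    rw [wapMean_apply, wapMean_apply, h]

/-- An invariant mean takes at `f` the constant value of the mean of the functionals `f ρ`. -/
lemma IsFoundation.smul_one_eq_meanAct (hS : IsFoundation S) (hm : IsTopRightInvariantMean S m)
    {p : StrongDual ℂ (wap S)} (hp : IsTopLeftInvariantMean S p) (f : wap S) :
    p f • one S = meanAct m f.1 := by
  obtain ⟨c, hc⟩ := exists_eq_smul_one hm (translate_meanAct hm f.1)
  -- The constant functional c 1 is a norm limit of functionals f ρ_n, on all of which `p` takes the
  -- value p(f); continuity yields c = p(f).
  obtain ⟨g, hg, hgf⟩ := mem_closure_iff_seq_limit.1 (hS.meanAct_mem_closure hm f.2)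
  choose ρ hρ using hg
  have h1 : Tendsto (fun n => p ⟨act f.1 (ρ n).toM, act_mem_wap f.2 _⟩) atTop
      (𝓝 (p (c • ⟨one S, one_mem_wap⟩))) := by
    refine (p.continuous.tendsto _).comp (tendsto_subtype_rng.2 ?_)
    simp only [← hρ]
    rw [hc] at hgf
    exact hgf
  simp only [hp.invariant] at h1
  have h2 := tendsto_nhds_unique tendsto_const_nhds h1
  rw [h2, map_smul, hp.one, hc, smul_eq_mul, mul_one]

/-- The difference is the Bochner integral of f - f s against a probability measure, and a closed
convex set contains such averages of its points. -/
lemma IsFoundation.sub_act_mem_coboundarySpace (hS : IsFoundation S) {f : MaDual S}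
    (hf : f ∈ wap S) (ρ : M₀ S) : f - act f ρ.toM ∈ coboundarySpace S := by
  have hi := hS.integrable_translate hf ρ.1
  have h1 : f - act f ρ.toM = ∫ s, (f - translate f s) ∂ρ.1 := by
    rw [integral_sub (integrable_const _) hi, ← hS.average_eq hf ρ, average]
    simp
  rw [h1]
  have hconv : Convex ℝ (coboundarySpace S : Set (MaDual S)) :=
    ((coboundarySpace S).restrictScalars ℝ).convex
  refine hconv.integral_mem (Submodule.isClosed_topologicalClosure _)
    (Eventually.of_forall fun s => ?_) ((integrable_const _).sub hi)
  exact Submodule.le_topologicalClosure _ (Submodule.subset_span ⟨f, hf, s, rfl⟩)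

lemma coboundarySpace_le_wap : coboundarySpace S ≤ wap S := by
  refine Submodule.topologicalClosure_minimal _ (Submodule.span_le.2 ?_) isClosed_wap
  rintro _ ⟨f, hf, s, rfl⟩
  exact (wap S).sub_mem hf (act_mem_wap hf _)

/-- Point masses are probability measures, so `p` kills every generator f - f s; continuity extends
this to the closed span. -/
lemma IsTopLeftInvariantMean.eq_zero_of_mem_coboundarySpace {p : StrongDual ℂ (wap S)}
    (hp : IsTopLeftInvariantMean S p) {f : MaDual S} (hf : f ∈ coboundarySpace S) :
    p ⟨f, coboundarySpace_le_wap hf⟩ = 0 := by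
  -- The closure in Z is taken in M_a(S)^*, so the kernel must be closed there; it is, because `wap
  -- S` is closed.
  have hclosed : IsClosed ((↑) '' (p.ker : Set (wap S)) : Set (MaDual S)) :=
    isClosed_wap.isClosedEmbedding_subtypeVal.isClosedMap _ p.isClosed_ker
  have hle : coboundarySpace S ≤ p.ker.map (wap S).subtype := by
    refine Submodule.topologicalClosure_minimal _ (Submodule.span_le.2 ?_) hclosed
    rintro _ ⟨f, hf, s, rfl⟩
    refine ⟨⟨f, hf⟩ - ⟨translate f s, act_mem_wap hf _⟩, ?_, rfl⟩
    have := hp.invariant (deltaProb s) ⟨f, hf⟩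
    change p _ = 0
    rw [map_sub, sub_eq_zero]
    exact this.symm
  obtain ⟨g, hg, hgf⟩ := hle hf
  have : g = ⟨f, coboundarySpace_le_wap hf⟩ := Subtype.ext hgf
  rw [← this]
  exact hg

end Identity

end SemigroupMeasure
end

theorem corollary2 {S : Type u} [TopologicalSpace S] [T2Space S] [LocallyCompactSpace S]
    [MeasurableSpace S] [BorelSpace S] [Monoid S] [ContinuousMul S]
    (hfound : IsFoundation S)
    (hmean : ∃ m : StrongDual ℂ (StrongDual ℂ (M S)), IsTopRightInvariantMean S m)
    {ι : Type v} [Preorder ι] [IsDirectedOrder ι] [Nonempty ι] (μ : ι → M₀ S)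
    (hμ : AsympInvariant μ) :
    -- the averages of weakly almost periodic functionals are genuine integrals
    (∀ f ∈ wap S, ∀ m : M₀ S, Integrable (fun s : S => translate f s) m.1) ∧
    -- (1)
    (∀ f ∈ wap S, ∃ f' ∈ wap S, (∀ s : S, translate f' s = f') ∧
      Tendsto (fun α => average (μ α) f) atTop (𝓝 f') ∧
      ∀ (κ : Type w) [Preorder κ] [IsDirectedOrder κ] [Nonempty κ] (ν : κ → M₀ S),
        AsympInvariant ν → Tendsto (fun β => average (ν β) f) atTop (𝓝 f')) ∧
    -- (2)
    (∃! m : StrongDual ℂ (wap S), IsTopLeftInvariantMean S m) ∧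
    fixedSpace S = Set.range (fun c : ℂ => c • one S) ∧
    ∀ m : StrongDual ℂ (wap S), IsTopLeftInvariantMean S m →
      (coboundarySpace S : Set (MaDual S)) = {f | ∃ hf : f ∈ wap S, m ⟨f, hf⟩ = 0} := by
  obtain ⟨m, hm⟩ := hmean
  -- The neighbourhood plays no role here; only some probability measure in M_a(S) is needed, to
  -- evaluate multiples of 1.
  obtain ⟨e, he, -⟩ := hfound.exists_prob (univ_mem : univ ∈ 𝓝 (1 : S))
  have hone : one S ⟨e.toM, he⟩ = 1 := e.toM_univ
  refine ⟨fun f hf ρ => hfound.integrable_translate hf ρ.1, fun f hf => ?_, ?_, ?_,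
    fun p hp => ?_⟩
  · obtain ⟨c, hc⟩ := exists_eq_smul_one hm (translate_meanAct hm f)
    refine ⟨meanAct m f, ?_, translate_meanAct hm f, ?_, fun κ _ _ _ ν hν => ?_⟩
    · rw [hc]
      exact (wap S).smul_mem c one_mem_wap
    · simpa only [hfound.average_eq hf] using hfound.tendsto_act hm hf hμ
    · simpa only [hfound.average_eq hf] using hfound.tendsto_act hm hf hν
  · refine ⟨wapMean m ⟨e.toM, he⟩, hfound.isTopLeftInvariantMean_wapMean hm hμ e he,
      fun p hp => ?_⟩
    ext f
    rw [wapMean_apply, ← hfound.smul_one_eq_meanAct hm hp f, smul_apply, hone, smul_eq_mul,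
      mul_one]
  · ext f
    constructor
    · rintro ⟨-, hf⟩
      obtain ⟨c, hc⟩ := exists_eq_smul_one hm hf
      exact ⟨c, hc.symm⟩
    · rintro ⟨c, rfl⟩
      refine ⟨(wap S).smul_mem c one_mem_wap, fun s => ?_⟩
      have h1 : translate (one S) s = one S := by
        rw [SemigroupMeasure.translate, act_one, ← deltaProb_toM, M₀.toM_univ, one_smul]
      change c • translate (one S) s = c • one S
      rw [h1]
  · ext f
    constructor
    · intro hf
      exact ⟨coboundarySpace_le_wap hf, hp.eq_zero_of_mem_coboundarySpace hf⟩
    · rintro ⟨hf, h0⟩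
      have h1 := hfound.smul_one_eq_meanAct hm hp ⟨f, hf⟩
      rw [h0, zero_smul] at h1
      have h2 := hfound.tendsto_act hm hf hμ
      rw [← h1] at h2
      -- When the mean of `f` vanishes, f μ_α → 0, so `f` is the limit of the elements f - f μ_α of
      -- the closed space Z.
      have h3 : Tendsto (fun α => f - act f (μ α).toM) atTop (𝓝 f) := by
        simpa using tendsto_const_nhds.sub h2
      exact (Submodule.isClosed_topologicalClosure _).mem_of_tendsto h3
        (Eventually.of_forall fun α => hfound.sub_act_mem_coboundarySpace hf (μ α))
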